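/- Let $\beta\in(\tfrac13,\tfrac12)$, $r>0$, $T>0$, $d,m\in\mathbb N$, and write $w_{\cdot-r}(t)=w(t-r)$. **Multiplicative functionals.** $(x,y,x\otimes y)\in M^\beta_{k,l}(a,b)$ means: $x:[a,b]\to\mathbb R^k$ and $y:[a,b]\to\mathbb R^l$ are $\beta$-Hölder continuous, $x\otimes y:\{a\le s<t\le b\}\to\mathbb R^k\otimes\mathbb R^l$ is continuous (with $(x\otimes y)_{s,s}:=0$), $(x\otimes y)_{s,u}+(x\otimes y)_{u,t}+(x(u)-x(s))\otimes(y(t)-y(u))=(x\otimes y)_{s,t}$ for $s\le u\le t$, and $|(x\otimes y)_{s,t}|\le c|t-s|^{2\beta}$ for some constant $c$. **Integrals.** Let $f=(f_1,\dots,f_l):\mathbb R^k\to\mathbb R^l$ be $C^1$ with locally $\gamma$-Hölder derivative, $\frac1\beta-2<\gamma\le1$, and fix $\alpha$ with $1-\beta<\alpha<2\beta$ and $\alpha<\frac{\gamma\beta+1}2$. For $(x,y,x\otimes y)\in M^\beta_{k,l}(a,b)$ put, with $(-1)^{c}=e^{i\pi c}$, $$\int_a^b f(x)\,dy=(-1)^\alpha\sum_{j}\int_a^b\widehat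 D^\alpha_{a+}f_j(x)(v)\,D^{1-\alpha}_{b-}y^j_{b-}(v)\,dv-(-1)^{2\alpha-1}\sum_{i,j}\int_a^bD^{2\alpha-1}_{a+}\partial_if_j(x)(v)\,D^{1-\alpha}_{b-}\mathcal D^{1-\alpha}_{b-}(x\otimes y)^{i,j}(v)\,dv,$$ where $y_{b-}(v)=y(v)-y(b)$, $$D^{c}_{a+}g(v)=\tfrac1{\Gamma(1-c)}\Big(\tfrac{g(v)}{(v-a)^c}+c\int_a^v\tfrac{g(v)-g(s)}{(v-s)^{c+1}}ds\Big),\qquad D^{c}_{b-}g(v)=\tfrac{(-1)^c}{\Gamma(1-c)}\Big(\tfrac{g(v)}{(b-v)^c}+c\int_v^b\tfrac{g(v)-g(s)}{(s-v)^{c+1}}ds\Big),$$ $$\widehat D^{\alpha}_{a+}f_j(x)(v)=\tfrac1{\Gamma(1-\alpha)}\Big(\tfrac{f_j(x(v))}{(v-a)^\alpha}+\alpha\int_a^v\tfrac{f_j(x(v))-f_j(x(s))-\sum_i\partial_if_j(x(s))(x^i(v)-x^i(s))}{(v-s)^{\alpha+1}}ds\Big),$$ $$\mathcal D^{1-\alpha}_{b-}(x\otimes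 y)(v)=\tfrac{(-1)^{1-\alpha}}{\Gamma(\alpha)}\Big(\tfrac{(x\otimes y)_{v,b}}{(b-v)^{1-\alpha}}+(1-\alpha)\int_v^b\tfrac{(x\otimes y)_{v,s}}{(s-v)^{2-\alpha}}ds\Big).$$ For a real path $z$ such that also $(y,z,y\otimes z)\in M^\beta_{l,1}(a,b)$, the integral $\int_a^b f(x)\,d(y\otimes z)_{\cdot,b}$ means $\int_a^b f(x(v))\,(z(b)-z(v))\,dy_v$, that is, the integral just defined of the function $F(p,q)=(z(b)-q)f(p)$ along the path $(x,z)$ against $y$, where $(x,z)\otimes y$ consists of $x\otimes y$ and of $(z\otimes y)_{s,t}=(z(t)-z(s))(y(t)-y(s))-(y\otimes z)_{s,t}$. **Equation.** Consider the delay equation with normal reflection $$x(t)=\xi(t)+z(t),\quad t\in(0,T],\qquad x(t)=\eta(t),\quad t\in[-r,0],$$ $$\xi(t)=\eta(0)+\int_0^tb(s,x)\,ds+\int_0^t\sigma(x(s-r))\,dy_s,\qquad z^i(t)=\max_{s\in[0,t]}(\xi^i(s))^-,\quad i=1,\dots,d.$$ A solution is a function $x\in C([-r,T];\mathbb R^d_+)$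 satisfying it, where the integral against $y$ is taken with respect to a functional $(x_{\cdot-r},y,x_{\cdot-r}\otimes y)\in M^\beta_{d,m}(0,T)$ such that $(x_{\cdot-r}\otimes y)_{s,t}=(\eta_{\cdot-r}\otimes y)_{s,t}$ for $0\le s<t\le \min(r,T)$ and, for $r\le s<t\le T$, $$(x_{\cdot-r}\otimes y)^{k,l}_{s,t}=\int_s^t(y^l(t)-y^l(v))\,b^k(v-r,x)\,dv+\sum_{j=1}^m\int_s^t\sigma^k_j(x(v-2r))\,d(y_{\cdot-r}\otimes y)^{j,l}_{\cdot,t}(v)+\int_s^t(y^l(t)-y^l(v))\,dz^k(v-r);$$ in the second term the tensor of $x_{\cdot-2r}$ and $y_{\cdot-r}$ is $(x_{\cdot-2r}\otimes y_{\cdot-r})_{s,t}=(x_{\cdot-r}\otimes y)_{s-r,t-r}$, and the last integral is a Stieltjes integral. (For $s<r<t$ the tensor is then given by the multiplicative property.) **Theorem.** Assume: 1. $\sigma:\mathbb R^d\to\mathbb R^{d\times m}$ is continuously differentiable and $\sigma'$ is locally $\gamma$-Hölder continuous, where $\frac1\beta-2<\gamma\le1$. 2. $b:[0,T]\times C([-r,T];\mathbb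 R^d)\to\mathbb R^d$ is measurable; for $t>0$, $b(t,f)$ depends only on $f|_{[-r,t]}$; for every $N\ge0$ there is $L_N>0$ with $|b(t,f)-b(t,g)|\le L_N\sup_{[-r,t]}|f-g|$ for all $t\in[0,T]$ and all $f,g$ with $\sup_{[-r,T]}|f|\le N$, $\sup_{[-r,T]}|g|\le N$; and there are $L_0>0$ and a real function $b_0\in L^\rho(0,T)$, $\frac1{1-\beta}\le\rho\le\infty$, with $|b(t,f)|\le L_0\sup_{[-r,t]}|f|+b_0(t)$ for all $t\in[0,T]$ and all $f$. 3. $\eta:[-r,0]\to\mathbb R^d$ satisfies $\eta\ge0$ componentwise, $(\eta_{\cdot-r},y,\eta_{\cdot-r}\otimes y)\in M^\beta_{d,m}(0,r)$ and $(y_{\cdot-r},y,y_{\cdot-r}\otimes y)\in M^\beta_{m,m}(r,T)$ (no condition if $T<r$). Then, for every $\alpha$ with $1-\beta<\alpha<2\beta$ and $\alpha<\frac{\gamma\beta+1}{2}$, the equation has a unique solution $x\in C([-r,T];\mathbb R^d_+)$. -/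

import Mathlib

noncomputable section

namespace DelayReflection

/-- A `β`-Hölder continuous multiplicative functional `(x, y, x ⊗ y)` on the interval `[a, b]`;
`A s t i j` is the entry `(x ⊗ y)^{i,j}_{s,t}`. -/
structure IsMultFunctional {ι κ : Type*} [Fintype ι] [Fintype κ] (β a b : ℝ)
    (x : ℝ → EuclideanSpace ℝ ι) (y : ℝ → EuclideanSpace ℝ κ) (A : ℝ → ℝ → ι → κ → ℝ) :
    Prop where
  holder_left : ∃ C, HolderOnWith C β.toNNReal x (Set.Icc a b)
  holder_right : ∃ C, HolderOnWith C β.toNNReal y (Set.Icc a b)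
  continuousOn : ContinuousOn (fun p : ℝ × ℝ => A p.1 p.2) {p | a ≤ p.1 ∧ p.1 < p.2 ∧ p.2 ≤ b}
  mult : ∀ s u t, a ≤ s → s ≤ u → u ≤ t → t ≤ b → ∀ i j,
    A s u i j + A u t i j + (x u i - x s i) * (y t j - y u j) = A s t i j
  bound : ∃ c : ℝ, ∀ s t, a ≤ s → s < t → t ≤ b → ‖A s t‖ ≤ c * (t - s) ^ (2 * β)

/-! ### Fractional derivatives and the integral of Hu and Nualart

The right-sided derivatives of order `α` are usually written with a factor `(-1)^α = e^{iπα}`. It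
is left out of `weylRight` and `tensorRight`; in the first term of the integral the factors
`(-1)^α (-1)^{1-α}` multiply to `-1`, and in the second term
`-(-1)^{2α-1} (-1)^{1-α} (-1)^{1-α}` is `+1`. -/

/-- The left-sided Weyl derivative `D_{a+}^α f (t)`. -/
def weylLeft (a α : ℝ) (f : ℝ → ℝ) (t : ℝ) : ℝ :=
  1 / Real.Gamma (1 - α) *
    (f t / (t - a) ^ α + α * ∫ s in a..t, (f t - f s) / (t - s) ^ (α + 1))

/-- The right-sided Weyl derivative `D_{b-}^α f (t)`, without its factor `(-1)^α`. -/
def weylRight (b α : ℝ) (f : ℝ → ℝ) (t : ℝ) : ℝ :=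
  1 / Real.Gamma (1 - α) *
    (f t / (b - t) ^ α + α * ∫ s in t..b, (f t - f s) / (s - t) ^ (α + 1))

/-- The compensated fractional derivative of `f ∘ x` of order `α`, from the left end point `a`. -/
def compensatedLeft {ι : Type*} [Fintype ι] (a α : ℝ) (f : EuclideanSpace ℝ ι → ℝ)
    (x : ℝ → EuclideanSpace ℝ ι) (t : ℝ) : ℝ :=
  1 / Real.Gamma (1 - α) *
    (f (x t) / (t - a) ^ α +
      α * ∫ s in a..t, (f (x t) - f (x s) - fderiv ℝ f (x s) (x t - x s)) / (t - s) ^ (α + 1))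

/-- The extended fractional derivative of order `α` of a function `A` of two variables,
`s, t ↦ A s t`, at the right end point `b`, without its factor `(-1)^α`. -/
def tensorRight (b α : ℝ) (A : ℝ → ℝ → ℝ) (t : ℝ) : ℝ :=
  1 / Real.Gamma (1 - α) *
    (A t b / (b - t) ^ α + α * ∫ s in t..b, A t s / (s - t) ^ (α + 1))

/-- The integral `∑_j ∫_a^b f_j(x(v)) dy^j_v` with respect to the multiplicative functional
`(x, y, A)`, `A = x ⊗ y`, computed with fractional derivatives of order `α`. -/
def hnIntegral {ι κ : Type*} [Fintype ι] [Fintype κ] [DecidableEq ι] (α : ℝ)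
    (f : EuclideanSpace ℝ ι → κ → ℝ) (x : ℝ → EuclideanSpace ℝ ι)
    (y : ℝ → EuclideanSpace ℝ κ) (A : ℝ → ℝ → ι → κ → ℝ) (a b : ℝ) : ℝ :=
  -(∑ j, ∫ v in a..b,
      compensatedLeft a α (fun p => f p j) x v * weylRight b (1 - α) (fun s => y s j - y b j) v) +
  ∑ i, ∑ j, ∫ v in a..b,
      weylLeft a (2 * α - 1)
        (fun s => fderiv ℝ (fun p => f p j) (x s) (EuclideanSpace.single i 1)) v *
      weylRight b (1 - α) (tensorRight b (1 - α) (fun s t => A s t i j)) v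

/-- The integral `∑_j ∫_a^b f_j(x(v)) d(y ⊗ z)^j_{·,b}(v)`, for a real path `z`, with `A = x ⊗ y`
and `B = y ⊗ z`. The differential `d(y ⊗ z)_{·,b}(v)` is `(z(b) - z(v)) dy_v`, so this is the
integral of the function `F(p, q) = (z(b) - q) f(p)` of the path `(x, z)` against `y`. The
multiplicative functional over `((x, z), y)` has the blocks `x ⊗ y = A` and `z ⊗ y`; the latter is
obtained from `B` by integration by parts,
`(z ⊗ y)_{s,t} = (z(t) - z(s)) (y(t) - y(s)) - (y ⊗ z)_{s,t}`. -/
def hnTensorIntegral {ι κ : Type*} [Fintype ι] [Fintype κ] [DecidableEq ι] (α : ℝ)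
    (f : EuclideanSpace ℝ ι → κ → ℝ) (x : ℝ → EuclideanSpace ℝ ι)
    (y : ℝ → EuclideanSpace ℝ κ) (z : ℝ → ℝ) (A : ℝ → ℝ → ι → κ → ℝ)
    (B : ℝ → ℝ → κ → ℝ) (a b : ℝ) : ℝ :=
  hnIntegral (ι := ι ⊕ Unit) α
    (fun p j => (z b - p (Sum.inr ())) * f (WithLp.toLp 2 fun i => p (Sum.inl i)) j)
    (fun v => WithLp.toLp 2 (Sum.elim (fun i => x v i) fun _ => z v))
    y
    (fun s t => Sum.elim (fun i => A s t i) fun _ j => (z t - z s) * (y t j - y s j) - B s t j)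
    a b

/-! ### The Stieltjes integral and the Skorokhod regulator -/

open Classical in
/-- The Stieltjes integral `∫_a^b f dg` for `g` continuous and nondecreasing on `[a, b]`: the
integral of `f` over `(a, b]` against the measure of `g`, frozen outside `[a, b]`. -/
def stieltjesIntegral (f g : ℝ → ℝ) (a b : ℝ) : ℝ :=
  if h : Monotone (fun v => g (max a (min b v))) then
    ∫ v in Set.Ioc a b, f v ∂h.stieltjesFunction.measure
  else 0

/-- The regulator of `ξ`: `z^i(t) = max_{s ∈ [0,t]} (ξ^i(s))⁻`. -/
def regulator {ι : Type*} [Fintype ι] (ξ : ℝ → EuclideanSpace ℝ ι) (t : ℝ) :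
    EuclideanSpace ℝ ι :=
  WithLp.toLp 2 fun i => sSup ((fun s => max (-(ξ s i)) 0) '' Set.Icc 0 t)

/-! ### Hypotheses on the coefficients -/

/-- `σ` is continuously differentiable and its derivative is `γ`-Hölder on every ball. -/
structure DiffusionHyp {d m : ℕ} (γ : ℝ)
    (σ : EuclideanSpace ℝ (Fin d) → Fin d → Fin m → ℝ) : Prop where
  contDiff : ContDiff ℝ 1 σ
  holder : ∀ N : ℝ, ∃ C, HolderOnWith C γ.toNNReal (fderiv ℝ σ) (Metric.closedBall 0 N)

/-- The supremum norm `‖f‖_{∞(-r,t)}` of a path on `[-r, T]`. -/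
def supNorm {d : ℕ} {r T : ℝ} (f : C(Set.Icc (-r) T, EuclideanSpace ℝ (Fin d))) (t : ℝ) : ℝ :=
  sSup ((fun s => ‖f s‖) '' {s : Set.Icc (-r) T | (s : ℝ) ≤ t})

/-- The hypotheses on the hereditary drift `b : [0,T] × C(-r,T;ℝ^d) → ℝ^d`: it is (Borel)
measurable, nonanticipative, locally Lipschitz, and of linear growth up to a function `b₀ ∈ L^ρ`. -/
structure DriftHyp {d : ℕ} (r T : ℝ) (ρ : ENNReal)
    (b : ℝ → C(Set.Icc (-r) T, EuclideanSpace ℝ (Fin d)) → EuclideanSpace ℝ (Fin d)) :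
    Prop where
  measurable :
    letI : MeasurableSpace C(Set.Icc (-r) T, EuclideanSpace ℝ (Fin d)) := borel _
    Measurable fun p : Set.Icc 0 T × C(Set.Icc (-r) T, EuclideanSpace ℝ (Fin d)) => b p.1 p.2
  hereditary : ∀ t ∈ Set.Ioc 0 T, ∀ f g : C(Set.Icc (-r) T, EuclideanSpace ℝ (Fin d)),
    (∀ s : Set.Icc (-r) T, (s : ℝ) ≤ t → f s = g s) → b t f = b t g
  lipschitz : ∀ N : ℝ, 0 ≤ N → ∃ L : ℝ, 0 < L ∧
    ∀ f g : C(Set.Icc (-r) T, EuclideanSpace ℝ (Fin d)), ‖f‖ ≤ N → ‖g‖ ≤ N →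
      ∀ t ∈ Set.Icc 0 T, ‖b t f - b t g‖ ≤ L * supNorm (f - g) t
  growth : ∃ L₀ : ℝ, 0 < L₀ ∧ ∃ b₀ : ℝ → ℝ,
    MeasureTheory.MemLp b₀ ρ (MeasureTheory.volume.restrict (Set.Icc 0 T)) ∧
    ∀ f : C(Set.Icc (-r) T, EuclideanSpace ℝ (Fin d)), ∀ t ∈ Set.Icc 0 T,
      ‖b t f‖ ≤ L₀ * supNorm f t + b₀ t

/-! ### The equation -/

/-- A path on `[-r, T]` as a function on `ℝ`, constant outside `[-r, T]`. -/
def extendPath {d : ℕ} {r T : ℝ} (h : -r ≤ T) (x : C(Set.Icc (-r) T, EuclideanSpace ℝ (Fin d))) :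
    ℝ → EuclideanSpace ℝ (Fin d) :=
  Set.IccExtend h x

/-- The unreflected path `ξ(t) = η(0) + ∫_0^t b(s,x) ds + ∫_0^t σ(x(s-r)) dy_s`; the last integral
is taken with respect to the multiplicative functional `(x_{·-r}, y, A)`. -/
def unreflected {d m : ℕ} {r T : ℝ} (h : -r ≤ T) (α : ℝ)
    (σ : EuclideanSpace ℝ (Fin d) → Fin d → Fin m → ℝ)
    (b : ℝ → C(Set.Icc (-r) T, EuclideanSpace ℝ (Fin d)) → EuclideanSpace ℝ (Fin d))
    (η : ℝ → EuclideanSpace ℝ (Fin d)) (y : ℝ → EuclideanSpace ℝ (Fin m))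
    (x : C(Set.Icc (-r) T, EuclideanSpace ℝ (Fin d))) (A : ℝ → ℝ → Fin d → Fin m → ℝ)
    (t : ℝ) : EuclideanSpace ℝ (Fin d) :=
  η 0 + (∫ s in (0 : ℝ)..t, b s x) +
    WithLp.toLp 2 fun k =>
      hnIntegral α (fun p => σ p k) (fun s => extendPath h x (s - r)) y A 0 t

/-- `A = x_{·-r} ⊗ y` is the multiplicative functional over `(x_{·-r}, y)` on `[0, T]` generated by
the data `ηy = η_{·-r} ⊗ y` on `[0, r]`, `yy = y_{·-r} ⊗ y` on `[r, T]` and the equation: on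
`[0, r]` it is `η_{·-r} ⊗ y`, and for `r ≤ s < t ≤ T` it is `∫_s^t (y(t) - y(v)) dx(v - r)`, that is
`∫_s^t (y^l(t) - y^l(v)) b^k(v-r, x) dv + ∑_j ∫_s^t σ^k_j(x(v-2r)) d(y_{·-r} ⊗ y)^{j,l}_{·,t}(v)
 + ∫_s^t (y^l(t) - y^l(v)) dz^k(v-r)`. For `s ≤ r ≤ t` it is then given by the multiplicative
property. -/
structure IsGeneratedTensor {d m : ℕ} {r T : ℝ} (h : -r ≤ T) (α β : ℝ)
    (σ : EuclideanSpace ℝ (Fin d) → Fin d → Fin m → ℝ)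
    (b : ℝ → C(Set.Icc (-r) T, EuclideanSpace ℝ (Fin d)) → EuclideanSpace ℝ (Fin d))
    (η : ℝ → EuclideanSpace ℝ (Fin d)) (y : ℝ → EuclideanSpace ℝ (Fin m))
    (ηy : ℝ → ℝ → Fin d → Fin m → ℝ) (yy : ℝ → ℝ → Fin m → Fin m → ℝ)
    (x : C(Set.Icc (-r) T, EuclideanSpace ℝ (Fin d))) (A : ℝ → ℝ → Fin d → Fin m → ℝ) :
    Prop where
  isMultFunctional : IsMultFunctional β 0 T (fun s => extendPath h x (s - r)) y A
  eq_initial : ∀ s t, 0 ≤ s → s < t → t ≤ r → t ≤ T → A s t = ηy s t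
  eq_later : ∀ s t, r ≤ s → s < t → t ≤ T → ∀ k l,
    A s t k l = (∫ v in s..t, (y t l - y v l) * b (v - r) x k) +
      hnTensorIntegral α (fun p => σ p k) (fun v => extendPath h x (v - 2 * r)) (fun v => y (v - r))
        (fun v => y v l) (fun u v => A (u - r) (v - r)) (fun u v j => yy u v j l) s t +
      stieltjesIntegral (fun v => y t l - y v l)
        (fun v => regulator (unreflected h α σ b η y x A) (v - r) k) s t

/-- `x` is a continuous solution, with values in `ℝ^d_+`, of the delay equation with normal
reflection `x(t) = η(0) + ∫_0^t b(s,x) ds + ∫_0^t σ(x(s-r)) dy_s + z(t)` on `(0, T]`, `x = η` on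
`[-r, 0]`, where `z` is the regulator. -/
def IsSolution {d m : ℕ} {r T : ℝ} (h : -r ≤ T) (α β : ℝ)
    (σ : EuclideanSpace ℝ (Fin d) → Fin d → Fin m → ℝ)
    (b : ℝ → C(Set.Icc (-r) T, EuclideanSpace ℝ (Fin d)) → EuclideanSpace ℝ (Fin d))
    (η : ℝ → EuclideanSpace ℝ (Fin d)) (y : ℝ → EuclideanSpace ℝ (Fin m))
    (ηy : ℝ → ℝ → Fin d → Fin m → ℝ) (yy : ℝ → ℝ → Fin m → Fin m → ℝ)
    (x : C(Set.Icc (-r) T, EuclideanSpace ℝ (Fin d))) : Prop :=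
  (∀ t i, 0 ≤ x t i) ∧
  (∀ t : Set.Icc (-r) T, (t : ℝ) ≤ 0 → x t = η t) ∧
  ∃ A : ℝ → ℝ → Fin d → Fin m → ℝ, IsGeneratedTensor h α β σ b η y ηy yy x A ∧
    ∀ t : Set.Icc (-r) T, 0 < (t : ℝ) →
      x t = unreflected h α σ b η y x A t + regulator (unreflected h α σ b η y x A) t

end DelayReflection

end

noncomputable section

namespace DelayReflection

open MeasureTheory Set Filter Topology

/-! The delay turns the equation into a recursion. Once the solution is known up to time `τ`, the
integrand `σ(x(s - r))` is known up to `τ + r`, and so is the functional `x_{·-r} ⊗ y`, because its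
formula on `[r, τ + r]` involves the path and the tensor only up to `τ`. On the new interval there
remains a reflected ordinary equation with a given Hölder forcing. It is solved uniquely by Picard
iteration, since the regulator is Lipschitz in the supremum norm (`ForcedHyp.exists_forced`,
`ForcedHyp.eq_of_forced`). Finitely many steps of length `r` reach `T` (`SolvesUpTo.exists_step`,
`SolvesUpTo.eq_step`).

The recursion can continue only if the new tensor is again multiplicative and of order `2β`. Each of
its three terms, from the drift, the rough integral and the regulator, fails to be additive by the
increment of `y` times an increment of its own integrator, and the equation says that these three
increments add up to that of `x` (`StepHyp.laterTensor_mult`). For this argument the rough integral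
must be additive and local, and it must be close to its second-order summand on short intervals.
None of this is visible in the definition by fractional derivatives.

The first half of the proof therefore shows that the fractional formula is the limit of the Riemann
sums of `f(x_s)(y_t - y_s) + f'(x_s)(x ⊗ y)_{s,t}` (`exists_hnIntegral_riemann_bound`). For an
integrand affine in `x` the formula is computed exactly. With all paths frozen beyond `b`, the
right-sided derivatives are Marchaud derivatives on a half-line, and the fractional integral of the
same order inverts them (`integral_rpow_mul_marchaud`). A scaling identity reduces this inversion to
one explicit function, a tent. For the tensor term the inversion is applied twice, together with the
multiplicative property (`StoppedRough.integral_tensor`). A general integrand is replaced by its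
first-order extrapolation frozen along a partition. This is a sum of affine pieces, each starting at
a partition point, and the exact values of the pieces telescope to the Riemann sum
(`sum_elementary`). The left-sided derivative of the frozen extrapolation is close to the original
one (`GermBound.abs_leftDeriv_sub_le`), and the total error tends to zero with the mesh.

Limits of Riemann sums are unique and additive, and they satisfy a sewing estimate because `γβ + 2β
> 1` (`IsRiemannLimit.abs_sub_le`). The integral against `y ⊗ z` is covered by applying the same
results to the path `(x, z)`. -/

lemma min_one_rpow_le {x μ ν : ℝ} (hx : 0 ≤ x) (hμ : 0 ≤ μ) (hμν : μ ≤ ν) :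
    (min x 1) ^ ν ≤ x ^ μ := by
  have h0 : 0 ≤ min x 1 := le_min hx zero_le_one
  rcases h0.eq_or_lt with h | h
  · rw [← h]
    rcases hμν.eq_or_lt with h' | h'
    · subst h'
      have : x = 0 := by
        rcases min_choice x 1 with h1 | h1 <;> rw [h1] at h <;> linarith
      rw [this]
    · rw [Real.zero_rpow (by linarith)]
      positivity
  · exact (Real.rpow_le_rpow_of_exponent_ge h (min_le_right _ _) hμν).trans
      (Real.rpow_le_rpow h0 (min_le_left _ _) hμ)

/-- Near `0` the exponent `ν - κ - 1` exceeds `-1`, and beyond `1` the truncation leaves the tail `w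
^ (-κ - 1)`. This is the majorant of all the Marchaud integrals. -/
lemma integrableOn_min_one_rpow {κ ν : ℝ} (hκ : 0 < κ) (hκν : κ < ν) :
    IntegrableOn (fun w : ℝ => (min w 1) ^ ν * w ^ (-κ - 1)) (Ioi 0) := by
  rw [← Ioc_union_Ioi_eq_Ioi (zero_le_one' ℝ)]
  refine IntegrableOn.union ?_ ?_
  · have : IntegrableOn (fun w : ℝ => w ^ (ν - κ - 1)) (Ioc 0 1) :=
      (intervalIntegrable_iff_integrableOn_Ioc_of_le zero_le_one).1
        (intervalIntegral.intervalIntegrable_rpow' (by linarith))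
    refine this.congr_fun (fun w hw => ?_) measurableSet_Ioc
    simp only
    rw [min_eq_left hw.2, ← Real.rpow_add hw.1]
    congr 1; ring
  · refine (integrableOn_Ioi_rpow_of_lt (by linarith : -κ - 1 < -1) zero_lt_one).congr_fun
      (fun w hw => ?_) measurableSet_Ioi
    simp only
    rw [min_eq_right (le_of_lt hw), Real.one_rpow, one_mul]

/-! ### Marchaud derivatives of truncated Hölder functions on the line -/

/-- Functions `g` with `|g t - g s| ≤ C min(t - s, 1)^ν` for `s ≤ t`. -/
def CutHolder (ν C : ℝ) (g : ℝ → ℝ) : Prop :=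
  ∀ s t, s ≤ t → |g t - g s| ≤ C * (min (t - s) 1) ^ ν

lemma CutHolder.nonneg {ν C : ℝ} {g : ℝ → ℝ} (h : CutHolder ν C g) : 0 ≤ C := by
  have := h 0 1 zero_le_one
  simp at this
  exact (abs_nonneg _).trans this

lemma CutHolder.continuous {ν C : ℝ} {g : ℝ → ℝ} (hν : 0 < ν) (h : CutHolder ν C g) :
    Continuous g := by
  rw [continuous_iff_continuousAt]
  intro t
  have hC := h.nonneg
  have key : ∀ s, |g s - g t| ≤ C * |s - t| ^ ν := by
    intro s
    rcases le_total s t with hs | hs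
    · rw [abs_sub_comm, abs_sub_comm s, abs_of_nonneg (sub_nonneg.2 hs)]
      exact (h s t hs).trans (mul_le_mul_of_nonneg_left
        (min_one_rpow_le (by linarith) hν.le le_rfl) hC)
    · rw [abs_of_nonneg (sub_nonneg.2 hs)]
      exact (h t s hs).trans (mul_le_mul_of_nonneg_left
        (min_one_rpow_le (by linarith) hν.le le_rfl) hC)
  rw [ContinuousAt, tendsto_iff_norm_sub_tendsto_zero]
  refine squeeze_zero (fun _ => norm_nonneg _) key ?_
  have : Continuous fun s : ℝ => C * |s - t| ^ ν :=
    continuous_const.mul ((continuous_abs.comp (continuous_id.sub continuous_const)).rpow_const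
      fun _ => Or.inr hν.le)
  have h2 := this.tendsto t
  simpa [Real.zero_rpow hν.ne'] using h2

lemma CutHolder.comp_const_add {ν C : ℝ} {g : ℝ → ℝ} (h : CutHolder ν C g) (c : ℝ) :
    CutHolder ν C fun t => g (c + t) := by
  intro s t hst
  have := h (c + s) (c + t) (by linarith)
  simpa using this

/-- The integral `∫_0^∞ A(v, v + w) w^{-κ-1} dw`. -/
def marchaud (κ : ℝ) (A : ℝ → ℝ → ℝ) (v : ℝ) : ℝ :=
  ∫ w in Ioi (0 : ℝ), A v (v + w) * w ^ (-κ - 1)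

lemma integrableOn_marchaud {κ ν C : ℝ} (hκ : 0 < κ) (hκν : κ < ν) {A : ℝ → ℝ → ℝ} {v : ℝ}
    (hm : AEStronglyMeasurable (fun w => A v (v + w)) (volume.restrict (Ioi 0)))
    (hA : ∀ w, 0 < w → |A v (v + w)| ≤ C * (min w 1) ^ ν) :
    IntegrableOn (fun w => A v (v + w) * w ^ (-κ - 1)) (Ioi 0) := by
  refine ((integrableOn_min_one_rpow hκ hκν).const_mul C).mono' (hm.mul ?_) ?_
  · exact (measurable_id.pow_const _).aestronglyMeasurable
  · filter_upwards [ae_restrict_mem measurableSet_Ioi] with w hw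
    rw [norm_mul, Real.norm_eq_abs, Real.norm_eq_abs, abs_of_nonneg (Real.rpow_nonneg (le_of_lt hw) _),
      ← mul_assoc]
    exact mul_le_mul_of_nonneg_right (hA w hw) (Real.rpow_nonneg (le_of_lt hw) _)

lemma abs_marchaud_sub_le {κ ν C : ℝ} (hκ : 0 < κ) (hκν : κ < ν) {A A' : ℝ → ℝ → ℝ} {v v' : ℝ}
    (hi : IntegrableOn (fun w => A v (v + w) * w ^ (-κ - 1)) (Ioi 0))
    (hi' : IntegrableOn (fun w => A' v' (v' + w) * w ^ (-κ - 1)) (Ioi 0))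
    (hA : ∀ w, 0 < w → |A v (v + w) - A' v' (v' + w)| ≤ C * (min w 1) ^ ν) :
    |marchaud κ A v - marchaud κ A' v'| ≤
      C * ∫ w in Ioi (0 : ℝ), (min w 1) ^ ν * w ^ (-κ - 1) := by
  unfold marchaud
  rw [← integral_sub hi hi', ← integral_const_mul, ← Real.norm_eq_abs]
  refine norm_integral_le_of_norm_le ((integrableOn_min_one_rpow hκ hκν).const_mul C) ?_
  filter_upwards [ae_restrict_mem measurableSet_Ioi] with w hw
  rw [← sub_mul, norm_mul, Real.norm_eq_abs, Real.norm_eq_abs,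
    abs_of_nonneg (Real.rpow_nonneg (le_of_lt hw) _), ← mul_assoc]
  exact mul_le_mul_of_nonneg_right (hA w hw) (Real.rpow_nonneg (le_of_lt hw) _)

/-- Beyond `b` the function `A v` is constant, so the part of the Marchaud integral over `w > b - v`
is explicit: it is `A v b * (b - v) ^ (-κ) / κ`, which is the boundary term up to normalization. The
end point thereby disappears from the formula, and scaling and translation become available. -/
lemma tensorRight_eq_marchaud {κ ν C b : ℝ} (hκ : 0 < κ) (hκν : κ < ν) {A : ℝ → ℝ → ℝ} {v : ℝ}
    (hv : v ≤ b) (hm : AEStronglyMeasurable (fun w => A v (v + w)) (volume.restrict (Ioi 0)))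
    (hA : ∀ w, 0 < w → |A v (v + w)| ≤ C * (min w 1) ^ ν)
    (hb : ∀ t, b ≤ t → A v t = A v b) (hbb : A b b = 0) :
    tensorRight b κ A v = κ / Real.Gamma (1 - κ) * marchaud κ A v := by
  have hI := integrableOn_marchaud hκ hκν hm hA
  unfold tensorRight
  rcases hv.eq_or_lt with rfl | hvb
  · have : marchaud κ A v = 0 := by
      unfold marchaud
      refine setIntegral_eq_zero_of_forall_eq_zero fun w hw => ?_
      rw [hb _ (by have : 0 < w := hw; linarith), hbb, zero_mul]
    rw [this, hbb]
    simp
  · have hL : 0 < b - v := by linarith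
    have h1 : marchaud κ A v = (∫ w in Ioc 0 (b - v), A v (v + w) * w ^ (-κ - 1)) +
        ∫ w in Ioi (b - v), A v (v + w) * w ^ (-κ - 1) := by
      unfold marchaud
      rw [← setIntegral_union Ioc_disjoint_Ioi_same measurableSet_Ioi
        (hI.mono_set Ioc_subset_Ioi_self)
        (hI.mono_set (Ioi_subset_Ioi hL.le)), Ioc_union_Ioi_eq_Ioi hL.le]
    have h2 : ∫ w in Ioi (b - v), A v (v + w) * w ^ (-κ - 1) = A v b * ((b - v) ^ (-κ) / κ) := by
      rw [setIntegral_congr_fun (g := fun w => A v b * w ^ (-κ - 1)) measurableSet_Ioi]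
      · rw [integral_const_mul, integral_Ioi_rpow_of_lt (by linarith) hL]
        congr 1
        rw [show -κ - 1 + 1 = -κ by ring, neg_div_neg_eq]
      · intro w hw
        have hw' : b - v < w := hw
        simp only
        rw [hb (v + w) (by linarith)]
    have h3 : ∫ s in v..b, A v s / (s - v) ^ (κ + 1) =
        ∫ w in Ioc 0 (b - v), A v (v + w) * w ^ (-κ - 1) := by
      rw [← intervalIntegral.integral_of_le hL.le]
      have := intervalIntegral.integral_comp_add_left (a := 0) (b := b - v)
        (fun s => A v s / (s - v) ^ (κ + 1)) v
      simp only [add_zero, add_sub_cancel] at this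
      rw [← this, intervalIntegral.integral_of_le hL.le, intervalIntegral.integral_of_le hL.le]
      refine setIntegral_congr_fun measurableSet_Ioc fun w hw => ?_
      rw [add_sub_cancel_left, div_eq_mul_inv, ← Real.rpow_neg hw.1.le, neg_add']
    rw [h1, h2, h3, Real.rpow_neg hL.le]
    field_simp
    ring

lemma weylRight_eq_tensorRight {b κ : ℝ} {g : ℝ → ℝ} (hg : g b = 0) (v : ℝ) :
    weylRight b κ g v = tensorRight b κ (fun t s => g t - g s) v := by
  simp [weylRight, tensorRight, hg]

/-- The scaling identity behind the inversion of the Marchaud derivative. -/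
lemma integral_rpow_mul_marchaud_eq_zero {κ ν C B : ℝ} (hκ : 0 < κ) (hκν : κ < ν) (hB : 0 < B)
    {H : ℝ → ℝ} (hH : CutHolder ν C H) (h0 : H 0 = 0) (hHB : ∀ t, B ≤ t → H t = 0) :
    ∫ L in Ioi (0 : ℝ), L ^ (κ - 1) * marchaud κ (fun t s => H t - H s) L = 0 := by
  have hC := hH.nonneg
  have hcont := hH.continuous (hκ.trans hκν)
  -- Substituting `w = L σ` collapses all powers of `L` to `L⁻¹`. The outer integral is then taken
  -- against `dL / L`, which is invariant under dilations.
  set K : ℝ → ℝ → ℝ := fun L σ => L⁻¹ * (H L - H ((1 + σ) * L)) * σ ^ (-κ - 1) with hK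
  have h1 : ∀ L ∈ Ioi (0 : ℝ), L ^ (κ - 1) * marchaud κ (fun t s => H t - H s) L =
      ∫ σ in Ioi (0 : ℝ), K L σ := by
    intro L hL
    have hL : 0 < L := hL
    have := integral_comp_mul_left_Ioi (fun w => (H L - H (L + w)) * w ^ (-κ - 1)) 0 hL
    rw [mul_zero] at this
    have h2 : marchaud κ (fun t s => H t - H s) L =
        L * ∫ σ in Ioi (0 : ℝ), (H L - H (L + L * σ)) * (L * σ) ^ (-κ - 1) := by
      rw [this, smul_eq_mul, ← mul_assoc, mul_inv_cancel₀ hL.ne', one_mul]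
      rfl
    rw [h2, ← mul_assoc, ← integral_const_mul]
    refine setIntegral_congr_fun measurableSet_Ioi fun σ hσ => ?_
    have hσ : 0 < σ := hσ
    simp only [hK]
    rw [Real.mul_rpow hL.le hσ.le, show (1 + σ) * L = L + L * σ by ring]
    have : L ^ (κ - 1) * L * L ^ (-κ - 1) = L⁻¹ := by
      rw [← Real.rpow_add_one hL.ne', ← Real.rpow_add hL, ← Real.rpow_neg_one]
      congr 1; ring
    rw [← this]; ring
  rw [setIntegral_congr_fun measurableSet_Ioi h1]
  -- Fubini needs two different majorants in `σ`: the exponent `ν > κ` for `σ < 1` and an exponent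
  -- strictly between `0` and `κ` for `σ ≥ 1`. Half of `κ` serves as the latter.
  set μ := κ / 2 with hμ
  set φ₁ : ℝ → ℝ := (Iio B).indicator fun L => L ^ (ν - 1) with hφ₁
  set φ₂ : ℝ → ℝ := (Iio B).indicator fun L => L ^ (μ - 1) with hφ₂
  set ψ₁ : ℝ → ℝ := (Iio 1).indicator fun σ => σ ^ (ν - κ - 1) with hψ₁
  set ψ₂ : ℝ → ℝ := (Ici 1).indicator fun σ => σ ^ (μ - κ - 1) with hψ₂
  have ir : ∀ {p M : ℝ}, -1 < p → 0 < M →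
      Integrable ((Iio M).indicator fun L : ℝ => L ^ p) (volume.restrict (Ioi 0)) := by
    intro p M hp hM
    rw [integrable_indicator_iff measurableSet_Iio, IntegrableOn,
      Measure.restrict_restrict measurableSet_Iio, Iio_inter_Ioi]
    exact ((intervalIntegrable_iff_integrableOn_Ioc_of_le hM.le).1
      (intervalIntegral.intervalIntegrable_rpow' hp)).mono_set Ioo_subset_Ioc_self
  have iψ₂ : Integrable ψ₂ (volume.restrict (Ioi 0)) := by
    rw [hψ₂, integrable_indicator_iff measurableSet_Ici, IntegrableOn,
      Measure.restrict_restrict measurableSet_Ici,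
      inter_eq_left.2 (Ici_subset_Ioi.2 zero_lt_one)]
    exact (integrableOn_Ici_iff_integrableOn_Ioi).2
      (integrableOn_Ioi_rpow_of_lt (by rw [hμ]; linarith) zero_lt_one)
  have hint : Integrable (Function.uncurry K)
      ((volume.restrict (Ioi 0)).prod (volume.restrict (Ioi 0))) := by
    have hdom := (((ir (by linarith : -1 < ν - 1) hB).mul_prod
      (ir (by linarith : -1 < ν - κ - 1) one_pos)).add
      ((ir (by rw [hμ]; linarith : -1 < μ - 1) hB).mul_prod iψ₂)).const_mul C
    refine hdom.mono' ?_ ?_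
    · apply Measurable.aestronglyMeasurable
      have := hcont.measurable
      simp only [hK, Function.uncurry_def]
      fun_prop
    · rw [Measure.prod_restrict]
      filter_upwards [ae_restrict_mem (measurableSet_Ioi.prod measurableSet_Ioi)] with p hp
      obtain ⟨L, σ⟩ := p
      obtain ⟨hL, hσ⟩ := hp
      have hL : 0 < L := hL
      have hσ : 0 < σ := hσ
      simp only [Function.uncurry_apply_pair, Pi.add_apply, hK]
      by_cases hLB : L < B
      · rw [norm_mul, norm_mul, Real.norm_eq_abs, Real.norm_eq_abs, Real.norm_eq_abs,
          abs_of_nonneg (Real.rpow_nonneg hσ.le _), abs_of_nonneg (inv_nonneg.2 hL.le)]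
        have hb := hH L ((1 + σ) * L) (by nlinarith)
        rw [abs_sub_comm, show (1 + σ) * L - L = L * σ by ring] at hb
        have gen : ∀ p, 0 ≤ p → p ≤ ν → L⁻¹ * |H L - H ((1 + σ) * L)| * σ ^ (-κ - 1) ≤
            C * (L ^ (p - 1) * σ ^ (p - κ - 1)) := by
          intro p hp0 hp
          have h3 : |H L - H ((1 + σ) * L)| ≤ C * (L ^ p * σ ^ p) := by
            rw [← Real.mul_rpow hL.le hσ.le]
            exact hb.trans (mul_le_mul_of_nonneg_left
              (min_one_rpow_le (by positivity) hp0 hp) hC)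
          have e1 : L ^ (p - 1) = L⁻¹ * L ^ p := by
            rw [Real.rpow_sub_one hL.ne']; ring
          have e2 : σ ^ (p - κ - 1) = σ ^ p * σ ^ (-κ - 1) := by
            rw [← Real.rpow_add hσ]; congr 1; ring
          rw [e1, e2]
          calc L⁻¹ * |H L - H ((1 + σ) * L)| * σ ^ (-κ - 1)
              ≤ L⁻¹ * (C * (L ^ p * σ ^ p)) * σ ^ (-κ - 1) := by gcongr
            _ = _ := by ring
        rw [indicator_of_mem (show L ∈ Iio B from hLB), indicator_of_mem (show L ∈ Iio B from hLB)]
        by_cases hσ1 : σ < 1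
        · rw [indicator_of_mem (show σ ∈ Iio 1 from hσ1), hψ₂,
            indicator_of_notMem (show σ ∉ Ici 1 from not_le.2 hσ1), mul_zero, add_zero]
          exact gen ν (by linarith) le_rfl
        · rw [indicator_of_notMem (show σ ∉ Iio 1 from hσ1), hψ₂,
            indicator_of_mem (show σ ∈ Ici 1 from not_lt.1 hσ1), mul_zero, zero_add]
          exact gen μ (by rw [hμ]; linarith) (by rw [hμ]; linarith)
      · have hLB := not_lt.1 hLB
        rw [hHB L hLB, hHB ((1 + σ) * L) (by nlinarith)]
        simp [not_lt.2 hLB]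
  rw [integral_integral_swap hint]
  have hHL : IntegrableOn (fun L => L⁻¹ * H L) (Ioi 0) := by
    refine ((ir (by linarith : -1 < ν - 1) hB).const_mul C).mono' ?_ ?_
    · exact (measurable_inv.mul hcont.measurable).aestronglyMeasurable
    · filter_upwards [ae_restrict_mem measurableSet_Ioi] with L hL
      have hL : 0 < L := hL
      by_cases hLB : L < B
      · rw [indicator_of_mem (show L ∈ Iio B from hLB), norm_mul, Real.norm_eq_abs,
          Real.norm_eq_abs, abs_of_nonneg (inv_nonneg.2 hL.le), Real.rpow_sub_one hL.ne']
        have := hH 0 L hL.le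
        rw [h0, sub_zero, sub_zero] at this
        have h4 := this.trans (mul_le_mul_of_nonneg_left
          (min_one_rpow_le hL.le (by linarith) le_rfl) hC)
        calc L⁻¹ * |H L| ≤ L⁻¹ * (C * L ^ ν) := by gcongr
          _ = _ := by ring
      · simp [hHB L (not_lt.1 hLB), not_lt.2 (not_lt.1 hLB)]
  -- For fixed `σ` both terms are integrable against `dL / L`, since `H` vanishes at `0` and beyond
  -- `B`, and the dilation by `1 + σ` makes their integrals equal.
  have h5 : ∀ σ ∈ Ioi (0 : ℝ), ∫ L in Ioi (0 : ℝ), K L σ = 0 := by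
    intro σ hσ
    have hσ' : 0 < 1 + σ := by have : 0 < σ := hσ; linarith
    have hs : IntegrableOn (fun L => L⁻¹ * H ((1 + σ) * L)) (Ioi 0) ∧
        ∫ L in Ioi (0 : ℝ), L⁻¹ * H ((1 + σ) * L) = ∫ L in Ioi (0 : ℝ), L⁻¹ * H L := by
      have e : ∀ L ∈ Ioi (0 : ℝ), (1 + σ) * (((1 + σ) * L)⁻¹ * H ((1 + σ) * L)) =
          L⁻¹ * H ((1 + σ) * L) := by
        intro L hL
        rw [mul_inv]
        field_simp
      constructor
      · refine IntegrableOn.congr_fun ?_ e measurableSet_Ioi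
        refine Integrable.const_mul ?_ _
        have := (integrableOn_Ioi_comp_mul_left_iff (fun L => L⁻¹ * H L) 0 hσ').2
          (by rwa [mul_zero])
        exact this
      · rw [← setIntegral_congr_fun measurableSet_Ioi e, integral_const_mul,
          integral_comp_mul_left_Ioi (fun L => L⁻¹ * H L) 0 hσ', mul_zero, smul_eq_mul,
          ← mul_assoc, mul_inv_cancel₀ hσ'.ne', one_mul]
    simp only [hK, integral_mul_const, mul_sub]
    rw [integral_sub hHL hs.1, hs.2, sub_self, zero_mul]
  rw [setIntegral_congr_fun measurableSet_Ioi h5]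
  simp

/-! ### Beta integrals and the semigroup property -/

lemma integral_rpow_mul_sub_rpow {s t a : ℝ} (hs : 0 < s) (ht : 0 < t) (ha : 0 < a) :
    ∫ x in (0 : ℝ)..a, x ^ (s - 1) * (a - x) ^ (t - 1) =
      a ^ (s + t - 1) * (Real.Gamma s * Real.Gamma t / Real.Gamma (s + t)) := by
  have h := Complex.betaIntegral_scaled (s : ℂ) (t : ℂ) ha
  have hB := Complex.Gamma_mul_Gamma_eq_betaIntegral (s := (s : ℂ)) (t := (t : ℂ))
    (by simpa using hs) (by simpa using ht)
  have hG : (Real.Gamma (s + t) : ℂ) ≠ 0 := by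
    exact_mod_cast (Real.Gamma_pos_of_pos (by linarith)).ne'
  have hB' : Complex.betaIntegral (s : ℂ) (t : ℂ) =
      ((Real.Gamma s * Real.Gamma t / Real.Gamma (s + t) : ℝ) : ℂ) := by
    rw [← Complex.ofReal_add, Complex.Gamma_ofReal, Complex.Gamma_ofReal,
      Complex.Gamma_ofReal] at hB
    push_cast
    rw [eq_div_iff hG, hB]; ring
  rw [hB'] at h
  have hL : ∫ x in (0 : ℝ)..a, (x : ℂ) ^ ((s : ℂ) - 1) * ((a : ℂ) - x) ^ ((t : ℂ) - 1) =
      ((∫ x in (0 : ℝ)..a, x ^ (s - 1) * (a - x) ^ (t - 1) : ℝ) : ℂ) := by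
    rw [← intervalIntegral.integral_ofReal]
    refine intervalIntegral.integral_congr fun x hx => ?_
    rw [uIcc_of_le ha.le] at hx
    rw [Complex.ofReal_mul, Complex.ofReal_cpow hx.1, Complex.ofReal_cpow (by linarith [hx.2])]
    push_cast
    rfl
  rw [hL] at h
  have hR : (a : ℂ) ^ ((s : ℂ) + t - 1) = ((a ^ (s + t - 1) : ℝ) : ℂ) := by
    rw [Complex.ofReal_cpow ha.le]; push_cast; rfl
  rw [hR] at h
  exact_mod_cast h

lemma integral_sub_rpow_mul_sub_rpow {s t c v : ℝ} (hs : 0 < s) (ht : 0 < t) (hcv : c < v) :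
    ∫ u in c..v, (u - c) ^ (s - 1) * (v - u) ^ (t - 1) =
      (v - c) ^ (s + t - 1) * (Real.Gamma s * Real.Gamma t / Real.Gamma (s + t)) := by
  rw [← integral_rpow_mul_sub_rpow hs ht (sub_pos.2 hcv)]
  have := intervalIntegral.integral_comp_sub_right (a := c) (b := v)
    (fun x => x ^ (s - 1) * (v - c - x) ^ (t - 1)) c
  simpa using this

/-- A function that is not integrable has integral `0` by convention, whereas the Beta formula gives
a positive value. -/
lemma intervalIntegrable_sub_rpow_mul_sub_rpow {s t c v : ℝ} (hs : 0 < s) (ht : 0 < t)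
    (hcv : c < v) :
    IntervalIntegrable (fun u => (u - c) ^ (s - 1) * (v - u) ^ (t - 1)) volume c v := by
  by_contra h
  have h1 := integral_sub_rpow_mul_sub_rpow hs ht hcv
  rw [intervalIntegral.integral_undef h] at h1
  have := Real.Gamma_pos_of_pos hs
  have := Real.Gamma_pos_of_pos ht
  have := Real.Gamma_pos_of_pos (add_pos hs ht)
  have := Real.rpow_pos_of_pos (sub_pos.2 hcv) (s + t - 1)
  have : 0 < (v - c) ^ (s + t - 1) * (Real.Gamma s * Real.Gamma t / Real.Gamma (s + t)) := by
    positivity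
  linarith

lemma intervalIntegrable_sub_rpow {p c b : ℝ} (hp : -1 < p) :
    IntervalIntegrable (fun u => (u - c) ^ p) volume c b := by
  have := (intervalIntegral.intervalIntegrable_rpow' (a := 0) (b := b - c) hp).comp_sub_right c
  simpa using this

/-- The semigroup property of the right-sided fractional integrals, for equal orders. -/
lemma integral_rpow_mul_integral_rpow {κ c b : ℝ} (hκ : 0 < κ) (hcb : c ≤ b) {Z : ℝ → ℝ}
    (hZ : Continuous Z) :
    ∫ u in c..b, (u - c) ^ (κ - 1) * ∫ v in u..b, (v - u) ^ (κ - 1) * Z v =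
      Real.Gamma κ * Real.Gamma κ / Real.Gamma (κ + κ) *
        ∫ v in c..b, (v - c) ^ (κ + κ - 1) * Z v := by
  -- The integrand on the triangle `u < v` is extended by zero to the square, so that Fubini
  -- applies. The inner integral in `u` is then a Beta integral.
  set f : ℝ → ℝ → ℝ := fun u v => if u < v then (u - c) ^ (κ - 1) * ((v - u) ^ (κ - 1) * Z v) else 0
    with hf
  have h1 : ∀ u ∈ Ioc c b, (u - c) ^ (κ - 1) * ∫ v in u..b, (v - u) ^ (κ - 1) * Z v =
      ∫ v in Ioc c b, f u v := by
    intro u hu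
    rw [intervalIntegral.integral_of_le hu.2, ← integral_const_mul]
    have : ∀ v, f u v = (Ioi u).indicator
        (fun v => (u - c) ^ (κ - 1) * ((v - u) ^ (κ - 1) * Z v)) v := by
      intro v; simp [hf, indicator_apply]
    simp_rw [this]
    rw [setIntegral_indicator measurableSet_Ioi]
    congr 2
    ext v
    simp only [mem_Ioc, mem_inter_iff, mem_Ioi]
    constructor
    · rintro ⟨h1, h2⟩; exact ⟨⟨hu.1.trans h1, h2⟩, h1⟩
    · rintro ⟨⟨_, h2⟩, h3⟩; exact ⟨h3, h2⟩
  have h2 : ∀ v ∈ Ioc c b, ∀ G : ℝ → ℝ, ∫ u in Ioc c b, (if u < v then G u else 0) =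
      ∫ u in c..v, G u := by
    intro v hv G
    have : ∀ u, (if u < v then G u else 0) = (Iio v).indicator G u := by
      intro u; simp [indicator_apply]
    simp_rw [this]
    rw [setIntegral_indicator measurableSet_Iio, intervalIntegral.integral_of_le hv.1.le,
      integral_Ioc_eq_integral_Ioo]
    congr 2
    ext u
    simp only [mem_Ioo, mem_inter_iff, mem_Iio, mem_Ioc]
    constructor
    · rintro ⟨⟨h1, h2⟩, h3⟩; exact ⟨h1, h3⟩
    · rintro ⟨h1, h3⟩; exact ⟨⟨h1, h3.le.trans hv.2⟩, h3⟩
  set β₀ := Real.Gamma κ * Real.Gamma κ / Real.Gamma (κ + κ) with hβ₀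
  have h3 : ∀ v ∈ Ioc c b, ∀ z : ℝ, ∫ u in c..v, (u - c) ^ (κ - 1) * ((v - u) ^ (κ - 1) * z) =
      β₀ * ((v - c) ^ (κ + κ - 1) * z) := by
    intro v hv z
    simp_rw [← mul_assoc]
    rw [intervalIntegral.integral_mul_const, integral_sub_rpow_mul_sub_rpow hκ hκ hv.1]
    ring
  have hmeas : Measurable (Function.uncurry f) := by
    have := hZ.measurable
    simp only [hf, Function.uncurry_def]
    refine Measurable.ite (measurableSet_lt measurable_fst measurable_snd) ?_ measurable_const
    fun_prop
  have hrZ : IntegrableOn (fun v => (v - c) ^ (κ + κ - 1) * |Z v|) (Ioc c b) := by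
    rw [← intervalIntegrable_iff_integrableOn_Ioc_of_le hcb]
    exact (intervalIntegrable_sub_rpow (by linarith)).mul_continuousOn hZ.abs.continuousOn
  have hint : Integrable (Function.uncurry f)
      ((volume.restrict (Ioc c b)).prod (volume.restrict (Ioc c b))) := by
    rw [integrable_prod_iff' hmeas.aestronglyMeasurable]
    constructor
    · filter_upwards [ae_restrict_mem measurableSet_Ioc] with v hv
      have : (fun u => Function.uncurry f (u, v)) = (Iio v).indicator
          fun u => (u - c) ^ (κ - 1) * ((v - u) ^ (κ - 1) * Z v) := by
        ext u; simp [hf, indicator_apply]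
      rw [this, integrable_indicator_iff measurableSet_Iio, IntegrableOn,
        Measure.restrict_restrict measurableSet_Iio]
      have h4 := ((intervalIntegrable_iff_integrableOn_Ioc_of_le hv.1.le).1
        (intervalIntegrable_sub_rpow_mul_sub_rpow hκ hκ hv.1)).mul_const (Z v)
      simp_rw [mul_assoc] at h4
      exact IntegrableOn.mono_set (s := Iio v ∩ Ioc c b) h4 fun u hu => ⟨hu.2.1, le_of_lt hu.1⟩
    · refine (Integrable.const_mul hrZ β₀).congr ?_
      filter_upwards [ae_restrict_mem measurableSet_Ioc] with v hv
      rw [← h3 v hv, ← h2 v hv]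
      refine setIntegral_congr_fun measurableSet_Ioc fun u hu => ?_
      simp only [Function.uncurry_apply_pair, hf]
      split_ifs with huv
      · rw [norm_mul, norm_mul, Real.norm_eq_abs, Real.norm_eq_abs, Real.norm_eq_abs,
          abs_of_nonneg (Real.rpow_nonneg (by linarith [hu.1]) _),
          abs_of_nonneg (Real.rpow_nonneg (by linarith) _)]
      · simp
  rw [intervalIntegral.integral_of_le hcb, setIntegral_congr_fun measurableSet_Ioc h1,
    integral_integral_swap hint, intervalIntegral.integral_of_le hcb, ← integral_const_mul]
  refine setIntegral_congr_fun measurableSet_Ioc fun v hv => ?_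
  simp only [hf]
  rw [h2 v hv, h3 v hv]

/-! ### Inversion of the Marchaud derivative -/

lemma continuous_marchaud {κ ν C : ℝ} (hκ : 0 < κ) (hκν : κ < ν) {A : ℝ → ℝ → ℝ}
    (hm : ∀ v, AEStronglyMeasurable (fun w => A v (v + w)) (volume.restrict (Ioi 0)))
    (hA : ∀ v w, 0 < w → |A v (v + w)| ≤ C * (min w 1) ^ ν)
    (hc : ∀ w, 0 < w → Continuous fun v => A v (v + w)) :
    Continuous (marchaud κ A) := by
  refine continuous_of_dominated (bound := fun w => C * ((min w 1) ^ ν * w ^ (-κ - 1))) ?_ ?_ ?_ ?_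
  · exact fun v => (hm v).mul (measurable_id.pow_const _).aestronglyMeasurable
  · intro v
    filter_upwards [ae_restrict_mem measurableSet_Ioi] with w hw
    rw [norm_mul, Real.norm_eq_abs, Real.norm_eq_abs,
      abs_of_nonneg (Real.rpow_nonneg (le_of_lt hw) _), ← mul_assoc]
    exact mul_le_mul_of_nonneg_right (hA v w hw) (Real.rpow_nonneg (le_of_lt hw) _)
  · exact (integrableOn_min_one_rpow hκ hκν).const_mul C
  · filter_upwards [ae_restrict_mem measurableSet_Ioi] with w hw
    exact (hc w hw).mul continuous_const

/-- The increments `A s t = g t - g s`, with reversed sign, as used by `weylRight`. -/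
abbrev negIncr (g : ℝ → ℝ) : ℝ → ℝ → ℝ := fun t s => g t - g s

lemma CutHolder.negIncr_bound {ν C : ℝ} {g : ℝ → ℝ} (hg : CutHolder ν C g) (v w : ℝ)
    (hw : 0 < w) : |negIncr g v (v + w)| ≤ C * (min w 1) ^ ν := by
  have := hg v (v + w) (by linarith)
  rwa [abs_sub_comm, add_sub_cancel_left] at this

lemma CutHolder.continuous_marchaud {κ ν C : ℝ} (hκ : 0 < κ) (hκν : κ < ν) {g : ℝ → ℝ}
    (hg : CutHolder ν C g) : Continuous (marchaud κ (negIncr g)) := by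
  have := hg.continuous (hκ.trans hκν)
  exact DelayReflection.continuous_marchaud hκ hκν
    (fun v => (by fun_prop : Continuous fun w => g v - g (v + w)).aestronglyMeasurable)
    hg.negIncr_bound (fun w _ => by fun_prop)

lemma CutHolder.integrableOn_marchaud {κ ν C : ℝ} (hκ : 0 < κ) (hκν : κ < ν) {g : ℝ → ℝ}
    (hg : CutHolder ν C g) (v : ℝ) :
    IntegrableOn (fun w => negIncr g v (v + w) * w ^ (-κ - 1)) (Ioi 0) := by
  have := hg.continuous (hκ.trans hκν)
  exact DelayReflection.integrableOn_marchaud hκ hκν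
    ((by fun_prop : Continuous fun w => g v - g (v + w)).aestronglyMeasurable) (hg.negIncr_bound v)

/-- The tent is the reference function for which the inversion is computed by hand. The outer `min
1` keeps it bounded to the left of `0`, as the truncated Hölder condition on the whole line demands.
-/
lemma cutHolder_tent {ν B : ℝ} (hν : 0 < ν) (hν1 : ν ≤ 1) (hB : 0 < B) :
    CutHolder ν (max (1 / B) 1) fun t => min 1 (max 0 (1 - t / B)) := by
  intro s t hst
  have hBs : s / B ≤ t / B := by gcongr
  have h0 : 0 ≤ min (t - s) 1 := le_min (by linarith) zero_le_one
  have h1 : min (t - s) 1 ≤ min (t - s) 1 ^ ν := by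
    conv_lhs => rw [← Real.rpow_one (min (t - s) 1)]
    exact Real.rpow_le_rpow_of_exponent_ge' h0 (min_le_right _ _) hν.le hν1
  have h2 : |min 1 (max 0 (1 - t / B)) - min 1 (max 0 (1 - s / B))| ≤ min (1 / B * (t - s)) 1 := by
    rw [show 1 / B * (t - s) = t / B - s / B by ring, abs_le]
    rcases le_total 0 (1 - t / B) with h | h <;> rcases le_total 0 (1 - s / B) with h' | h' <;>
    rcases le_total 1 (1 - t / B) with h'' | h'' <;> rcases le_total 1 (1 - s / B) with h3 | h3 <;>
    rcases le_total (t / B - s / B) 1 with h4 | h4 <;>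
    simp [*] <;> first | (constructor <;> linarith) | linarith
  refine h2.trans (le_trans ?_ (mul_le_mul_of_nonneg_left h1 (by positivity)))
  rcases le_total (t - s) 1 with h | h
  · rw [min_eq_left h]
    exact (min_le_left _ _).trans (mul_le_mul_of_nonneg_right (le_max_left _ _) (by linarith))
  · rw [min_eq_right h]
    exact (min_le_right _ _).trans (by simp)


/-- The integral splits at `w = B - L`, where the tent reaches zero: before this point the increment
is `w / B`, afterwards it is `1 - L / B`. The exponent is left as `(2 - κ) - 1` to match the Beta
integral. -/
lemma marchaud_tent {κ B L : ℝ} (hκ : 0 < κ) (hκ1 : κ < 1) (hL : 0 < L) (hLB : L < B) :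
    marchaud κ (negIncr fun t => min 1 (max 0 (1 - t / B))) L =
      1 / (B * κ * (1 - κ)) * (B - L) ^ ((2 - κ) - 1) := by
  have hB : 0 < B := hL.trans hLB
  have hBL : 0 < B - L := sub_pos.2 hLB
  have hI := (cutHolder_tent (ν := 1) one_pos le_rfl hB).integrableOn_marchaud hκ hκ1 L
  have hLv : min 1 (max 0 (1 - L / B)) = 1 - L / B := by
    have : L / B ≤ 1 := (div_le_one hB).2 hLB.le
    rw [max_eq_right (by linarith), min_eq_right (by linarith [div_pos hL hB])]
  unfold marchaud
  rw [← Ioc_union_Ioi_eq_Ioi hBL.le, setIntegral_union Ioc_disjoint_Ioi_same measurableSet_Ioi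
        (hI.mono_set Ioc_subset_Ioi_self) (hI.mono_set (Ioi_subset_Ioi hBL.le))]
  have h1 : ∫ w in Ioc 0 (B - L), negIncr (fun t => min 1 (max 0 (1 - t / B))) L (L + w) *
      w ^ (-κ - 1) = 1 / B * ((B - L) ^ (1 - κ) / (1 - κ)) := by
    rw [setIntegral_congr_fun (g := fun w => 1 / B * w ^ (-κ)) measurableSet_Ioc]
    · rw [integral_const_mul, ← intervalIntegral.integral_of_le hBL.le,
        integral_rpow (Or.inl (by linarith)), Real.zero_rpow (by linarith), sub_zero,
        show -κ + 1 = 1 - κ by ring]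
    · intro w hw
      have : (L + w) / B ≤ 1 := (div_le_one hB).2 (by linarith [hw.2])
      have h0 : 0 < (L + w) / B := div_pos (by linarith [hw.1]) hB
      simp only [negIncr]
      rw [hLv, max_eq_right (by linarith), min_eq_right (by linarith),
        Real.rpow_sub_one hw.1.ne']
      have := hw.1.ne'
      field_simp
      ring
  have h2 : ∫ w in Ioi (B - L), negIncr (fun t => min 1 (max 0 (1 - t / B))) L (L + w) *
      w ^ (-κ - 1) = (1 - L / B) * ((B - L) ^ (-κ) / κ) := by
    rw [setIntegral_congr_fun (g := fun w => (1 - L / B) * w ^ (-κ - 1)) measurableSet_Ioi]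
    · rw [integral_const_mul, integral_Ioi_rpow_of_lt (by linarith) hBL]
      congr 1
      rw [show -κ - 1 + 1 = -κ by ring, neg_div_neg_eq]
    · intro w hw
      have hw : B - L < w := hw
      have : 1 ≤ (L + w) / B := (one_le_div hB).2 (by linarith)
      simp only [negIncr]
      rw [hLv, max_eq_left (by linarith), min_eq_right zero_le_one, sub_zero]
  rw [h1, h2]
  have e1 : (B - L) ^ (1 - κ) = (B - L) * (B - L) ^ (-κ) := by
    rw [sub_eq_add_neg 1 κ, Real.rpow_add hBL, Real.rpow_one]
  have e2 : (B - L) ^ (2 - κ - 1) = (B - L) * (B - L) ^ (-κ) := by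
    rw [← e1]; congr 1; ring
  rw [e1, e2]
  have : 1 - κ ≠ 0 := by linarith
  field_simp
  ring

lemma CutHolder.sub_const_mul {ν C C' : ℝ} {f g : ℝ → ℝ} (hf : CutHolder ν C f)
    (hg : CutHolder ν C' g) (a : ℝ) : CutHolder ν (C + |a| * C') fun t => f t - a * g t := by
  intro s t hst
  have h1 := hf s t hst
  have h2 := hg s t hst
  calc |f t - a * g t - (f s - a * g s)| = |(f t - f s) - a * (g t - g s)| := by ring_nf
    _ ≤ |f t - f s| + |a| * |g t - g s| := by
        rw [← abs_mul]; exact abs_sub _ _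
    _ ≤ C * min (t - s) 1 ^ ν + |a| * (C' * min (t - s) 1 ^ ν) := by gcongr
    _ = _ := by ring

/-- The fractional integral of order `κ` inverts the Marchaud derivative of order `κ`. -/
lemma integral_rpow_mul_marchaud {κ ν C b c : ℝ} (hκ : 0 < κ) (hκν : κ < ν) (hν1 : ν ≤ 1)
    (hcb : c ≤ b) {g : ℝ → ℝ} (hg : CutHolder ν C g) (hgb : ∀ t, b ≤ t → g t = 0) :
    ∫ v in c..b, (v - c) ^ (κ - 1) * marchaud κ (negIncr g) v =
      Real.Gamma κ * Real.Gamma (1 - κ) / κ * g c := by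
  rcases hcb.eq_or_lt with rfl | hcb
  · simp [hgb c le_rfl]
  set B := b - c with hBdef
  have hB : 0 < B := sub_pos.2 hcb
  set l : ℝ → ℝ := fun t => min 1 (max 0 (1 - t / B)) with hl
  set G : ℝ → ℝ := fun t => g (c + t) with hG
  have hlH : CutHolder ν (max (1 / B) 1) l := cutHolder_tent (hκ.trans hκν) hν1 hB
  have hGH : CutHolder ν C G := hg.comp_const_add c
  have hl0 : l 0 = 1 := by simp [hl]
  have hlB : ∀ t, B ≤ t → l t = 0 := by
    intro t ht
    have : 1 ≤ t / B := (one_le_div hB).2 ht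
    simp only [hl]
    rw [max_eq_left (by linarith), min_eq_right zero_le_one]
  have hGB : ∀ t, B ≤ t → G t = 0 := fun t ht => hgb _ (by linarith)
  -- Subtracting `G 0` times the tent gives a function that vanishes at `0` and beyond `B`, to which
  -- the scaling identity applies. By linearity the integral for `G` is `G 0` times the integral for
  -- the tent.
  have hz := integral_rpow_mul_marchaud_eq_zero hκ hκν hB (hGH.sub_const_mul hlH (G 0))
    (by rw [hl0]; ring) (fun t ht => by rw [hlB t ht, hGB t ht]; ring)
  have hM : ∀ {f : ℝ → ℝ} {C' : ℝ}, CutHolder ν C' f → (∀ t, B ≤ t → f t = 0) →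
      ∫ L in Ioi (0 : ℝ), L ^ (κ - 1) * marchaud κ (negIncr f) L =
        ∫ L in (0 : ℝ)..B, L ^ (κ - 1) * marchaud κ (negIncr f) L := by
    intro f C' _ hf
    rw [intervalIntegral.integral_of_le hB.le]
    refine setIntegral_eq_of_subset_of_forall_sdiff_eq_zero measurableSet_Ioi Ioc_subset_Ioi_self ?_
    intro L hL
    have hBL : B ≤ L := by
      by_contra h
      exact hL.2 ⟨hL.1, (not_le.1 h).le⟩
    have : marchaud κ (negIncr f) L = 0 := by
      refine setIntegral_eq_zero_of_forall_eq_zero fun w hw => ?_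
      have : 0 < w := hw
      simp [negIncr, hf L hBL, hf (L + w) (by linarith)]
    rw [this, mul_zero]
  have hlin : ∀ L, marchaud κ (negIncr fun t => G t - G 0 * l t) L =
      marchaud κ (negIncr G) L - G 0 * marchaud κ (negIncr l) L := by
    intro L
    unfold marchaud
    rw [← integral_const_mul, ← integral_sub (hGH.integrableOn_marchaud hκ hκν L)
      ((hlH.integrableOn_marchaud hκ hκν L).const_mul _)]
    congr 1
    ext w
    simp only [negIncr]
    ring
  have hint : ∀ {f : ℝ → ℝ} {C' : ℝ}, CutHolder ν C' f →
      IntervalIntegrable (fun L => L ^ (κ - 1) * marchaud κ (negIncr f) L) volume 0 B :=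
    fun hf => (intervalIntegral.intervalIntegrable_rpow' (by linarith)).mul_continuousOn
      (hf.continuous_marchaud hκ hκν).continuousOn
  have hκ1 : κ < 1 := hκν.trans_le hν1
  have htent : ∫ L in (0 : ℝ)..B, L ^ (κ - 1) * marchaud κ (negIncr l) L =
      Real.Gamma κ * Real.Gamma (1 - κ) / κ := by
    have : ∫ L in (0 : ℝ)..B, L ^ (κ - 1) * marchaud κ (negIncr l) L =
        ∫ L in (0 : ℝ)..B, 1 / (B * κ * (1 - κ)) * (L ^ (κ - 1) * (B - L) ^ ((2 - κ) - 1)) := by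
      rw [intervalIntegral.integral_of_le hB.le, intervalIntegral.integral_of_le hB.le,
        integral_Ioc_eq_integral_Ioo, integral_Ioc_eq_integral_Ioo]
      refine setIntegral_congr_fun measurableSet_Ioo fun L hL => ?_
      simp only [hl]
      rw [marchaud_tent hκ hκ1 hL.1 hL.2]
      ring
    rw [this, intervalIntegral.integral_const_mul,
      integral_rpow_mul_sub_rpow hκ (by linarith) hB, show κ + (2 - κ) - 1 = 1 by ring,
      Real.rpow_one, show κ + (2 - κ) = 2 by ring, Real.Gamma_two,
      show 2 - κ = (1 - κ) + 1 by ring, Real.Gamma_add_one (by linarith)]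
    have : 1 - κ ≠ 0 := by linarith
    field_simp
  have hzero := hM (hGH.sub_const_mul hlH (G 0))
    (fun t ht => by rw [hlB t ht, hGB t ht]; ring)
  rw [hz] at hzero
  simp_rw [hlin, mul_sub] at hzero
  have hint2 := (hint hlH).const_mul (G 0)
  rw [intervalIntegral.integral_congr (g := fun L => L ^ (κ - 1) * marchaud κ (negIncr G) L -
    G 0 * (L ^ (κ - 1) * marchaud κ (negIncr l) L)) (fun L _ => by ring),
    intervalIntegral.integral_sub (hint hGH) hint2, intervalIntegral.integral_const_mul,
    htent] at hzero
  have hshift := intervalIntegral.integral_comp_add_left (a := 0) (b := B)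
    (fun v => (v - c) ^ (κ - 1) * marchaud κ (negIncr g) v) c
  rw [add_zero, show c + B = b by ring] at hshift
  rw [← hshift, show g c = G 0 by simp [hG]]
  have e : ∀ L, marchaud κ (negIncr g) (c + L) = marchaud κ (negIncr G) L := by
    intro L; simp [marchaud, negIncr, hG, add_assoc]
  simp_rw [e, add_sub_cancel_left]
  linarith

/-! ### Frozen scalar functionals and their elementary integrals -/

/-- A scalar multiplicative functional on the whole line that is frozen to the right of `b`. -/
structure StoppedRough (β C b : ℝ) (x y : ℝ → ℝ) (A : ℝ → ℝ → ℝ) : Prop where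
  left : CutHolder β C x
  right : CutHolder β C y
  mult : ∀ s u t, s ≤ u → u ≤ t → A s u + A u t + (x u - x s) * (y t - y u) = A s t
  bound : ∀ s t, s ≤ t → |A s t| ≤ C * (min (t - s) 1) ^ (2 * β)
  eq_of_ge : ∀ s t, b ≤ t → A s t = A s b
  eq_zero_of_ge : ∀ s t, b ≤ s → s ≤ t → A s t = 0

namespace StoppedRough

variable {β C b κ : ℝ} {x y : ℝ → ℝ} {A : ℝ → ℝ → ℝ}

lemma diag (h : StoppedRough β C b x y A) (s : ℝ) : A s s = 0 := by
  have := h.mult s s s le_rfl le_rfl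
  simpa using this

lemma min_rpow_le_one {w β : ℝ} (hw : 0 ≤ w) (hβ : 0 ≤ β) : (min w 1) ^ β ≤ 1 :=
  Real.rpow_le_one (le_min hw zero_le_one) (min_le_right _ _) hβ

lemma min_rpow_two_mul {w β : ℝ} (hw : 0 ≤ w) :
    (min w 1) ^ (2 * β) = (min w 1) ^ β * (min w 1) ^ β := by
  rw [mul_comm, Real.rpow_mul (le_min hw zero_le_one), Real.rpow_two, sq]

lemma min_rpow_mono {w h β : ℝ} (h0 : 0 ≤ h) (hw : h ≤ w) (hβ : 0 ≤ β) :
    (min h 1) ^ β ≤ (min w 1) ^ β :=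
  Real.rpow_le_rpow (le_min h0 zero_le_one) (min_le_min_right _ hw) hβ

/-- If `w ≤ v' - v`, the two tensors are small separately, and one of the two factors `w ^ β` is
traded for `(v' - v) ^ β`. Otherwise the multiplicative property slides the window from `v` to `v'`,
at the price of two tensors over intervals of length `v' - v` and two products of increments. The
factor `w ^ β` that survives keeps the difference integrable against `w ^ (-κ - 1)` for `κ < β`. -/
lemma tensor_sub_le (h : StoppedRough β C b x y A) (hβ : 0 < β) {v v' w : ℝ} (hv : v ≤ v')
    (hw : 0 < w) :
    |A v (v + w) - A v' (v' + w)| ≤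
      (2 * C + 2 * C ^ 2) * (min (v' - v) 1) ^ β * (min w 1) ^ β := by
  have hC := h.left.nonneg
  set δ := v' - v with hδ
  have hδ0 : 0 ≤ δ := sub_nonneg.2 hv
  have hmδ : 0 ≤ (min δ 1) ^ β := Real.rpow_nonneg (le_min hδ0 zero_le_one) _
  have hmw : 0 ≤ (min w 1) ^ β := Real.rpow_nonneg (le_min hw.le zero_le_one) _
  rcases le_total w δ with hwδ | hwδ
  · have h1 := h.bound v (v + w) (by linarith)
    have h2 := h.bound v' (v' + w) (by linarith)
    rw [add_sub_cancel_left, min_rpow_two_mul hw.le] at h1 h2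
    have h3 := min_rpow_mono hw.le hwδ hβ.le
    calc _ ≤ |A v (v + w)| + |A v' (v' + w)| := abs_sub _ _
      _ ≤ 2 * C * ((min w 1) ^ β * (min w 1) ^ β) := by linarith
      _ ≤ 2 * C * ((min δ 1) ^ β * (min w 1) ^ β) := by gcongr
      _ ≤ _ := by nlinarith [mul_nonneg (mul_nonneg (sq_nonneg C) hmδ) hmw]
  · have e1 := h.mult v v' (v + w) hv (by linarith)
    have e2 := h.mult v' (v + w) (v' + w) (by linarith) (by linarith)
    have b1 := h.bound v v' hv
    have b2 := h.bound (v + w) (v' + w) (by linarith)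
    have b3 := h.left v v' hv
    have b4 := h.right v' (v + w) (by linarith)
    have b5 := h.left v' (v + w) (by linarith)
    have b6 := h.right (v + w) (v' + w) (by linarith)
    rw [show v' + w - (v + w) = δ by ring] at b2 b6
    rw [← hδ] at b1 b3
    rw [min_rpow_two_mul hδ0] at b1 b2
    have hs : (min (v + w - v') 1) ^ β ≤ (min w 1) ^ β :=
      min_rpow_mono (by linarith) (by linarith) hβ.le
    have hδw := min_rpow_mono hδ0 hwδ hβ.le
    have e3 : A v (v + w) - A v' (v' + w) = A v v' - A (v + w) (v' + w) +
        ((x v' - x v) * (y (v + w) - y v') - (x (v + w) - x v') * (y (v' + w) - y (v + w))) := by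
      linarith
    rw [e3]
    calc _ ≤ |A v v'| + |A (v + w) (v' + w)| + (|x v' - x v| * |y (v + w) - y v'| +
          |x (v + w) - x v'| * |y (v' + w) - y (v + w)|) := by
          rw [← abs_mul, ← abs_mul]
          exact (abs_add_le _ _).trans (add_le_add (abs_sub _ _) (abs_sub _ _))
      _ ≤ C * ((min δ 1) ^ β * (min δ 1) ^ β) + C * ((min δ 1) ^ β * (min δ 1) ^ β) +
          ((C * (min δ 1) ^ β) * (C * (min w 1) ^ β) +
          (C * (min w 1) ^ β) * (C * (min δ 1) ^ β)) := by
          have b4' := b4.trans (mul_le_mul_of_nonneg_left hs hC)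
          have b5' := b5.trans (mul_le_mul_of_nonneg_left hs hC)
          gcongr
      _ ≤ C * ((min δ 1) ^ β * (min w 1) ^ β) + C * ((min δ 1) ^ β * (min w 1) ^ β) +
          ((C * (min δ 1) ^ β) * (C * (min w 1) ^ β) +
          (C * (min w 1) ^ β) * (C * (min δ 1) ^ β)) := by gcongr
      _ = _ := by ring

/-- With the first time fixed at `c`, the multiplicative property gives the increment of the tensor
as a tensor over the short interval plus a bounded increment of `x` times a small increment of `y`.
Taking `max t c` makes this a function on the whole line. -/
lemma cutHolder_row (h : StoppedRough β C b x y A) (hβ : 0 < β) (c : ℝ) :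
    CutHolder β (C + C ^ 2) fun t => A c (max t c) - A c b := by
  intro s t hst
  have hC := h.left.nonneg
  have hst' : max s c ≤ max t c := max_le_max_right _ hst
  have e := h.mult c (max s c) (max t c) (le_max_right _ _) hst'
  have hm : max t c - max s c ≤ t - s := by
    rcases max_choice t c with h1 | h1 <;> rcases max_choice s c with h2 | h2 <;>
      rw [h1, h2] <;> linarith [le_max_left t c, le_max_right t c, le_max_left s c, le_max_right s c]
  have h0 : 0 ≤ max t c - max s c := sub_nonneg.2 hst'
  have b1 := h.bound _ _ hst'
  have b2 := h.left c (max s c) (le_max_right _ _)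
  have b3 := h.right _ _ hst'
  have m1 := min_rpow_mono h0 hm hβ.le
  have m2 := min_rpow_le_one h0 hβ.le
  have m3 := min_rpow_le_one (sub_nonneg.2 (le_max_right s c)) hβ.le
  have p1 : 0 ≤ (min (max t c - max s c) 1) ^ β :=
    Real.rpow_nonneg (le_min h0 zero_le_one) _
  rw [min_rpow_two_mul h0] at b1
  calc |A c (max t c) - A c b - (A c (max s c) - A c b)| =
      |A (max s c) (max t c) + (x (max s c) - x c) * (y (max t c) - y (max s c))| := by
        congr 1; linarith
    _ ≤ |A (max s c) (max t c)| + |x (max s c) - x c| * |y (max t c) - y (max s c)| := by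
        rw [← abs_mul]; exact abs_add_le _ _
    _ ≤ C * ((min (max t c - max s c) 1) ^ β * (min (max t c - max s c) 1) ^ β) +
        (C * (min (max s c - c) 1) ^ β) * (C * (min (max t c - max s c) 1) ^ β) := by
        have p2 := (abs_nonneg _).trans b2
        gcongr
    _ ≤ C * ((min (t - s) 1) ^ β * 1) + (C * 1) * (C * (min (t - s) 1) ^ β) := by gcongr
    _ = _ := by ring

lemma continuous_row (h : StoppedRough β C b x y A) (hβ : 0 < β) (c : ℝ) :
    Continuous fun t => A c (max t c) := by
  refine (((h.cutHolder_row hβ c).continuous hβ).add (continuous_const (y := A c b))).congr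
    fun t => ?_
  simp

lemma aestronglyMeasurable_row (h : StoppedRough β C b x y A) (hβ : 0 < β) (v : ℝ) :
    AEStronglyMeasurable (fun w => A v (v + w)) (volume.restrict (Ioi 0)) := by
  have h1 : Continuous fun w => A v (max (v + w) v) := (h.continuous_row hβ v).comp (by fun_prop)
  refine h1.aestronglyMeasurable.congr ?_
  filter_upwards [ae_restrict_mem measurableSet_Ioi] with w hw
  have : 0 < w := hw
  rw [max_eq_left (by linarith)]

lemma tensor_bound (h : StoppedRough β C b x y A) (v w : ℝ) (hw : 0 < w) :
    |A v (v + w)| ≤ C * (min w 1) ^ (2 * β) := by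
  have := h.bound v (v + w) (by linarith)
  rwa [add_sub_cancel_left] at this

lemma integrableOn_marchaud (h : StoppedRough β C b x y A) (hκ : 0 < κ) (hκβ : κ < β) (v : ℝ) :
    IntegrableOn (fun w => A v (v + w) * w ^ (-κ - 1)) (Ioi 0) :=
  DelayReflection.integrableOn_marchaud hκ (by linarith : κ < 2 * β)
    (h.aestronglyMeasurable_row (hκ.trans hκβ) v) (h.tensor_bound v)

/-- A global continuous version of `weylRight b κ (y - y b)`. -/
def rightDeriv (κ : ℝ) (y : ℝ → ℝ) (v : ℝ) : ℝ :=
  κ / Real.Gamma (1 - κ) * marchaud κ (negIncr y) v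

/-- A global version of `tensorRight b κ A`. -/
def tensorDeriv (κ : ℝ) (A : ℝ → ℝ → ℝ) (v : ℝ) : ℝ :=
  κ / Real.Gamma (1 - κ) * marchaud κ A v

lemma continuous_rightDeriv {g : ℝ → ℝ} (hg : CutHolder β C g) (hκ : 0 < κ) (hκβ : κ < β) :
    Continuous (rightDeriv κ g) :=
  continuous_const.mul (hg.continuous_marchaud hκ hκβ)

lemma weylRight_eq_rightDeriv {g : ℝ → ℝ} (hg : CutHolder β C g) (hκ : 0 < κ) (hκβ : κ < β)
    (hgb : ∀ t, b ≤ t → g t = g b) {v : ℝ} (hv : v ≤ b) :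
    weylRight b κ (fun s => g s - g b) v = rightDeriv κ g v := by
  have hc := hg.continuous (hκ.trans hκβ)
  rw [weylRight_eq_tensorRight (by simp)]
  simp only [sub_sub_sub_cancel_right]
  exact tensorRight_eq_marchaud hκ hκβ hv
    (by fun_prop : Continuous fun w => g v - g (v + w)).aestronglyMeasurable (hg.negIncr_bound v)
    (fun t ht => by rw [hgb t ht]) (by simp)

lemma tensorRight_eq (h : StoppedRough β C b x y A) (hκ : 0 < κ) (hκβ : κ < β) {v : ℝ}
    (hv : v ≤ b) : tensorRight b κ A v = tensorDeriv κ A v :=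
  tensorRight_eq_marchaud hκ (by linarith : κ < 2 * β) hv
    (h.aestronglyMeasurable_row (hκ.trans hκβ) v) (h.tensor_bound v) (h.eq_of_ge v) (h.diag b)

lemma tensorDeriv_eq_zero (h : StoppedRough β C b x y A) {v : ℝ} (hv : b ≤ v) :
    tensorDeriv κ A v = 0 := by
  have : marchaud κ A v = 0 := by
    refine setIntegral_eq_zero_of_forall_eq_zero fun w hw => ?_
    have hw : 0 < w := hw
    rw [h.eq_zero_of_ge v _ hv (by linarith), zero_mul]
  rw [tensorDeriv, this, mul_zero]

/-- The estimate `tensor_sub_le` is integrated against the kernel. As the result is again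
`β`-Hölder, a second derivative of order `κ < β` can be taken. -/
lemma exists_cutHolder_tensorDeriv (h : StoppedRough β C b x y A) (hκ : 0 < κ) (hκβ : κ < β) :
    ∃ C', CutHolder β C' (tensorDeriv κ A) := by
  have hβ := hκ.trans hκβ
  refine ⟨|κ / Real.Gamma (1 - κ)| * ((2 * C + 2 * C ^ 2) *
    ∫ w in Ioi (0 : ℝ), (min w 1) ^ β * w ^ (-κ - 1)), fun s t hst => ?_⟩
  rw [tensorDeriv, tensorDeriv, ← mul_sub, abs_mul, mul_assoc]
  refine mul_le_mul_of_nonneg_left ?_ (abs_nonneg _)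
  rw [abs_sub_comm]
  refine (abs_marchaud_sub_le hκ hκβ (h.integrableOn_marchaud hκ hκβ s)
    (h.integrableOn_marchaud hκ hκβ t) (fun w hw => h.tensor_sub_le hβ hst hw)).trans (le_of_eq ?_)
  ring

lemma weylRight_congr {g g' : ℝ → ℝ} {v : ℝ} (hv : v ≤ b) (hg : ∀ s ∈ Icc v b, g s = g' s) :
    weylRight b κ g v = weylRight b κ g' v := by
  unfold weylRight
  rw [hg v ⟨le_rfl, hv⟩]
  congr 3
  refine intervalIntegral.integral_congr fun s hs => ?_
  rw [uIcc_of_le hv] at hs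
  rw [hg s hs]

lemma weylRight_tensorRight_eq (h : StoppedRough β C b x y A) (hκ : 0 < κ) (hκβ : κ < β) {v : ℝ}
    (hv : v ≤ b) : weylRight b κ (tensorRight b κ A) v = rightDeriv κ (tensorDeriv κ A) v := by
  obtain ⟨C', hC'⟩ := h.exists_cutHolder_tensorDeriv hκ hκβ
  rw [weylRight_congr (g' := fun s => tensorDeriv κ A s - tensorDeriv κ A b) hv,
    weylRight_eq_rightDeriv hC' hκ hκβ _ hv]
  · intro t ht
    rw [h.tensorDeriv_eq_zero ht, h.tensorDeriv_eq_zero le_rfl]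
  · intro s hs
    rw [h.tensorDeriv_eq_zero le_rfl, sub_zero, h.tensorRight_eq hκ hκβ hs.2]

lemma integral_rpow_mul_rightDeriv {g : ℝ → ℝ} {c : ℝ} (hg : CutHolder β C g) (hκ : 0 < κ)
    (hκβ : κ < β) (hβ1 : β ≤ 1) (hcb : c ≤ b) (hgb : ∀ t, b ≤ t → g t = g b) :
    ∫ v in c..b, (v - c) ^ (κ - 1) * rightDeriv κ g v = Real.Gamma κ * (g c - g b) := by
  have hg' : CutHolder β C fun t => g t - g b := by
    intro s t hst
    simpa using hg s t hst
  have h1 := integral_rpow_mul_marchaud hκ hκβ hβ1 hcb hg' (fun t ht => by rw [hgb t ht, sub_self])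
  have h2 : (negIncr fun t => g t - g b) = negIncr g := by
    ext; simp
  rw [h2] at h1
  have e : ∀ v, (v - c) ^ (κ - 1) * rightDeriv κ g v =
      κ / Real.Gamma (1 - κ) * ((v - c) ^ (κ - 1) * marchaud κ (negIncr g) v) := by
    intro v; rw [rightDeriv]; ring
  simp_rw [e]
  rw [intervalIntegral.integral_const_mul, h1]
  have : 0 < Real.Gamma (1 - κ) := Real.Gamma_pos_of_pos (by linarith)
  field_simp

/-- The multiplicative property at `c ≤ v ≤ v + w` expresses the tensor by its row at `c` and a
product of increments. After integration against the kernel only derivatives of functions of one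
variable are left, and these can be inverted. -/
lemma tensorDeriv_sub (h : StoppedRough β C b x y A) (hκ : 0 < κ) (hκβ : κ < β) {c v : ℝ}
    (hcv : c ≤ v) : tensorDeriv κ A v = (x v - x c) * rightDeriv κ y v -
      rightDeriv κ (fun t => A c (max t c) - A c b) v := by
  have hβ := hκ.trans hκβ
  have i1 := h.right.integrableOn_marchaud hκ hκβ v
  have i2 := (h.cutHolder_row hβ c).integrableOn_marchaud hκ hκβ v
  rw [tensorDeriv, rightDeriv, rightDeriv, mul_left_comm, ← mul_sub]
  congr 1
  unfold marchaud
  rw [← integral_const_mul, ← integral_sub (i1.const_mul _) i2]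
  refine setIntegral_congr_fun measurableSet_Ioi fun w hw => ?_
  have hw : 0 < w := hw
  have e := h.mult c v (v + w) hcv (by linarith)
  simp only [negIncr]
  rw [max_eq_left hcv, max_eq_left (by linarith : c ≤ v + w), ← e]
  ring

/-- The second elementary integral: the integrand `x - x c` on `[c, b]`. -/
lemma integral_tensor (h : StoppedRough β C b x y A) (hκ : 0 < κ) (hκβ : κ < β)
    (hβ1 : β ≤ 1) {c : ℝ} (hcb : c ≤ b) :
    1 / Real.Gamma (κ + κ) *
        (∫ v in c..b, (v - c) ^ (κ + κ - 1) * rightDeriv κ (tensorDeriv κ A) v) -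
      1 / Real.Gamma κ * (∫ v in c..b, (x v - x c) * ((v - c) ^ (κ - 1) * rightDeriv κ y v)) =
      A c b := by
  have hβ := hκ.trans hκβ
  have hΓ := Real.Gamma_pos_of_pos hκ
  have hΓ2 : 0 < Real.Gamma (κ + κ) := Real.Gamma_pos_of_pos (by linarith)
  obtain ⟨C', hC'⟩ := h.exists_cutHolder_tensorDeriv hκ hκβ
  have hZ := continuous_rightDeriv hC' hκ hκβ
  -- The double derivative is undone in two stages. The inner fractional integral returns
  -- `tensorDeriv κ A`; the outer one is evaluated through `tensorDeriv_sub`, where inverting the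
  -- row gives `A c c - A c b = -A c b`.
  have hsg := integral_rpow_mul_integral_rpow hκ hcb hZ
  have hge : ∀ t, b ≤ t → tensorDeriv κ A t = tensorDeriv κ A b := fun t ht => by
    rw [h.tensorDeriv_eq_zero ht, h.tensorDeriv_eq_zero le_rfl]
  have hinner : ∫ u in c..b, (u - c) ^ (κ - 1) *
      ∫ v in u..b, (v - u) ^ (κ - 1) * rightDeriv κ (tensorDeriv κ A) v =
      ∫ u in c..b, Real.Gamma κ * ((u - c) ^ (κ - 1) * tensorDeriv κ A u) := by
    refine intervalIntegral.integral_congr fun u hu => ?_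
    rw [uIcc_of_le hcb] at hu
    rw [integral_rpow_mul_rightDeriv hC' hκ hκβ hβ1 hu.2 hge, h.tensorDeriv_eq_zero le_rfl,
      sub_zero]
    ring
  rw [hinner, intervalIntegral.integral_const_mul] at hsg
  have hrow := h.cutHolder_row hβ c
  have hir : IntervalIntegrable (fun u => (u - c) ^ (κ - 1)) volume c b :=
    intervalIntegrable_sub_rpow (by linarith)
  have i1 : IntervalIntegrable (fun v => (x v - x c) * ((v - c) ^ (κ - 1) * rightDeriv κ y v))
      volume c b :=
    (hir.mul_continuousOn (continuous_rightDeriv h.right hκ hκβ).continuousOn).continuousOn_mul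
      (((h.left.continuous hβ).sub continuous_const).continuousOn)
  have i2 : IntervalIntegrable (fun v => (v - c) ^ (κ - 1) *
      rightDeriv κ (fun t => A c (max t c) - A c b) v) volume c b :=
    hir.mul_continuousOn (continuous_rightDeriv hrow hκ hκβ).continuousOn
  have hψ : ∫ u in c..b, (u - c) ^ (κ - 1) * tensorDeriv κ A u =
      (∫ v in c..b, (x v - x c) * ((v - c) ^ (κ - 1) * rightDeriv κ y v)) -
      ∫ v in c..b, (v - c) ^ (κ - 1) * rightDeriv κ (fun t => A c (max t c) - A c b) v := by
    rw [← intervalIntegral.integral_sub i1 i2]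
    refine intervalIntegral.integral_congr fun u hu => ?_
    rw [uIcc_of_le hcb] at hu
    rw [h.tensorDeriv_sub hκ hκβ hu.1]
    ring
  rw [hψ, integral_rpow_mul_rightDeriv hrow hκ hκβ hβ1 hcb] at hsg
  · rw [max_eq_left hcb, max_eq_left le_rfl, h.diag c] at hsg
    set I1 := ∫ v in c..b, (x v - x c) * ((v - c) ^ (κ - 1) * rightDeriv κ y v)
    set I2 := ∫ v in c..b, (v - c) ^ (κ + κ - 1) * rightDeriv κ (tensorDeriv κ A) v
    have : I2 / Real.Gamma (κ + κ) = 1 / Real.Gamma κ * I1 + A c b := by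
      field_simp at hsg ⊢
      linarith
    rw [one_div_mul_eq_div, this]
    ring
  · intro t ht
    rw [max_eq_left hcb, max_eq_left (hcb.trans ht), h.eq_of_ge c t ht]

end StoppedRough

/-! ### Left-sided derivatives of extrapolations frozen along a partition -/

/-- The left-sided fractional derivative of order `c` of an extrapolation `P s v`, the prediction
at time `v` from the data at time `s`, without its normalization. -/
def leftDeriv (a c : ℝ) (P : ℝ → ℝ → ℝ) (v : ℝ) : ℝ :=
  P v v * (v - a) ^ (-c) + c * ∫ s in a..v, (P v v - P s v) * (v - s) ^ (-c - 1)

/-- The regularity of an extrapolation that makes its derivative of order `c ∈ (p - q, p)` exist. -/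
structure GermBound (a b C q p : ℝ) (P : ℝ → ℝ → ℝ) : Prop where
  nonneg : 0 ≤ C
  bound : ∀ t s v, a ≤ t → t ≤ s → s ≤ v → v ≤ b →
    |P s v - P t v| ≤ C * ((s - t) ^ q * (v - t) ^ (p - q))
  cont : Continuous fun z : ℝ × ℝ => P z.1 z.2

/-- The jumps at the points `t k` of the extrapolation frozen along a partition. -/
def jump (P : ℝ → ℝ → ℝ) (t : ℕ → ℝ) : ℕ → ℝ → ℝ
  | 0, v => P (t 0) v
  | k + 1, v => P (t (k + 1)) v - P (t k) v

/-- Summation by parts brings a sum over jumps into the shape of `leftDeriv`: a boundary term plus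
differences of predictions, weighted by increments of the kernel. -/
lemma sum_jump_mul (P : ℝ → ℝ → ℝ) (t : ℕ → ℝ) (w : ℕ → ℝ) (v : ℝ) (i : ℕ) :
    ∑ k ∈ Finset.range (i + 1), jump P t k v * w k =
      P (t i) v * w 0 + ∑ j ∈ Finset.range i, (P (t i) v - P (t j) v) * (w (j + 1) - w j) := by
  induction i with
  | zero => simp [jump]
  | succ i ih =>
    rw [Finset.sum_range_succ, ih, Finset.sum_range_succ _ i]
    have h1 : ∑ j ∈ Finset.range i, (P (t (i + 1)) v - P (t j) v) * (w (j + 1) - w j) =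
        ∑ j ∈ Finset.range i, (P (t i) v - P (t j) v) * (w (j + 1) - w j) +
          (P (t (i + 1)) v - P (t i) v) * (w i - w 0) := by
      rw [← Finset.sum_range_sub, Finset.mul_sum, ← Finset.sum_add_distrib]
      exact Finset.sum_congr rfl fun j _ => by ring
    rw [h1, jump]
    ring

lemma integral_sub_left_rpow {c v s₁ s₂ : ℝ} (hc : c ≠ 0) (h1 : s₁ ≤ s₂) (h2 : s₂ < v) :
    ∫ s in s₁..s₂, (v - s) ^ (-c - 1) = ((v - s₂) ^ (-c) - (v - s₁) ^ (-c)) / c := by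
  rw [intervalIntegral.integral_comp_sub_left (fun s => s ^ (-c - 1)) v, integral_rpow]
  · rw [show -c - 1 + 1 = -c by ring]
    field_simp
    ring
  · refine Or.inr ⟨by intro h; apply hc; linarith, ?_⟩
    rw [uIcc_of_le (by linarith)]
    intro h
    linarith [h.1]

lemma intervalIntegrable_sub_left_rpow {p v s₁ s₂ : ℝ} (h1 : s₁ ≤ s₂) (h2 : s₂ < v) :
    IntervalIntegrable (fun s => (v - s) ^ p) volume s₁ s₂ := by
  refine ContinuousOn.intervalIntegrable ?_
  rw [uIcc_of_le h1]
  refine ContinuousOn.rpow_const (by fun_prop) fun s hs => Or.inl ?_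
  have := hs.2
  linarith

lemma intervalIntegrable_sub_left_rpow' {p v s₁ : ℝ} (hp : -1 < p) :
    IntervalIntegrable (fun s => (v - s) ^ p) volume s₁ v := by
  have := (intervalIntegral.intervalIntegrable_rpow' (a := v - s₁) (b := 0) hp).comp_sub_left v
  simpa using this

namespace GermBound

variable {a b C q p c : ℝ} {P : ℝ → ℝ → ℝ}

lemma cont_left (h : GermBound a b C q p P) (v : ℝ) : Continuous fun s => P s v :=
  h.cont.comp (by fun_prop : Continuous fun s : ℝ => (s, v))

lemma cont_right (h : GermBound a b C q p P) (s : ℝ) : Continuous fun v => P s v :=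
  h.cont.comp (by fun_prop : Continuous fun v : ℝ => (s, v))

lemma cont_diag (h : GermBound a b C q p P) : Continuous fun v => P v v :=
  h.cont.comp (by fun_prop : Continuous fun v : ℝ => (v, v))

lemma bound_diag (h : GermBound a b C q p P) {s v : ℝ} (hs : a ≤ s) (hsv : s < v) (hv : v ≤ b) :
    |P v v - P s v| ≤ C * (v - s) ^ p := by
  have := h.bound s v v hs hsv.le le_rfl hv
  rwa [← Real.rpow_add (sub_pos.2 hsv), add_sub_cancel] at this

lemma intervalIntegrable (h : GermBound a b C q p P) (hcp : c < p) {s₁ v : ℝ} (hs : a ≤ s₁)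
    (hsv : s₁ ≤ v) (hv : v ≤ b) :
    IntervalIntegrable (fun s => (P v v - P s v) * (v - s) ^ (-c - 1)) volume s₁ v := by
  refine ((intervalIntegrable_sub_left_rpow' (v := v) (s₁ := s₁)
    (by linarith : -1 < p - c - 1)).const_mul C).mono_fun' ?_ ?_
  · have := h.cont_left v
    apply Measurable.aestronglyMeasurable
    have := this.measurable
    fun_prop
  · rw [uIoc_of_le hsv, ← restrict_Ioo_eq_restrict_Ioc]
    filter_upwards [ae_restrict_mem measurableSet_Ioo] with s hs'
    have h0 : 0 < v - s := sub_pos.2 hs'.2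
    rw [norm_mul, Real.norm_eq_abs, Real.norm_eq_abs, abs_of_nonneg (Real.rpow_nonneg h0.le _)]
    calc _ ≤ C * (v - s) ^ p * (v - s) ^ (-c - 1) :=
          mul_le_mul_of_nonneg_right (h.bound_diag (hs.trans hs'.1.le) hs'.2 hv)
            (Real.rpow_nonneg h0.le _)
      _ = _ := by rw [mul_assoc, ← Real.rpow_add h0]; congr 2; ring

/-- Freezing the extrapolation along a partition changes its derivative by a small amount. -/
lemma abs_leftDeriv_sub_le (h : GermBound a b C q p P) (hq : 0 < q) (hqp : q ≤ p) (hpq1 : p - q ≤ 1)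
    (hc1 : p - q < c) (hcp : c < p) {t : ℕ → ℝ} (ht : Monotone t) (ht0 : t 0 = a) {i : ℕ}
    {δ : ℝ} (hδ : ∀ j ≤ i, t (j + 1) - t j ≤ δ) (hb : t (i + 1) ≤ b) {v : ℝ}
    (hv : v ∈ Ioc (t i) (t (i + 1))) :
    |leftDeriv a c P v - ∑ k ∈ Finset.range (i + 1), jump P t k v * (v - t k) ^ (-c)| ≤
      C * (3 + c / (c - (p - q)) + c / (p - c)) * (δ ^ p * (v - t i) ^ (-c)) := by
  have hC := h.nonneg
  have hc0 : 0 < c := by linarith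
  have hvi : 0 < v - t i := sub_pos.2 hv.1
  have hvδ : v - t i ≤ δ := by linarith [hv.2, hδ i le_rfl]
  have hδ0 : 0 < δ := hvi.trans_le hvδ
  have hvb : v ≤ b := hv.2.trans hb
  have hat : ∀ j, a ≤ t j := fun j => ht0 ▸ ht (Nat.zero_le j)
  have hp0 : 0 < p := by linarith
  set f : ℝ → ℝ := fun s => (P v v - P s v) * (v - s) ^ (-c - 1) with hf
  have hif : IntervalIntegrable f volume a v := h.intervalIntegrable hcp le_rfl
    ((hat i).trans hv.1.le) hvb
  have hsplit : ∫ s in a..v, f s =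
      (∑ j ∈ Finset.range i, ∫ s in t j..t (j + 1), f s) + ∫ s in t i..v, f s := by
    rw [intervalIntegral.sum_integral_adjacent_intervals, ht0,
      intervalIntegral.integral_add_adjacent_intervals]
    · exact hif.mono_set (by
        rw [uIcc_of_le (hat i), uIcc_of_le ((hat i).trans hv.1.le)]
        exact Icc_subset_Icc_right hv.1.le)
    · exact h.intervalIntegrable hcp (hat i) hv.1.le hvb
    · intro k hk
      refine hif.mono_set ?_
      rw [uIcc_of_le (ht (Nat.le_succ k)), uIcc_of_le ((hat i).trans hv.1.le)]
      exact Icc_subset_Icc (hat k) ((ht hk).trans hv.1.le)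
  -- The error has three sources: the boundary term, the complete intervals before `t i`, and the
  -- incomplete interval from `t i` to `v`.
  have hdiff : leftDeriv a c P v -
      ∑ k ∈ Finset.range (i + 1), jump P t k v * (v - t k) ^ (-c) =
      (P v v - P (t i) v) * (v - a) ^ (-c) +
      c * (∑ j ∈ Finset.range i, ∫ s in t j..t (j + 1),
        (f s - (P (t i) v - P (t j) v) * (v - s) ^ (-c - 1))) + c * ∫ s in t i..v, f s := by
    rw [sum_jump_mul P t (fun k => (v - t k) ^ (-c)) v i, leftDeriv]
    have e : ∀ j ∈ Finset.range i, ∫ s in t j..t (j + 1),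
        (f s - (P (t i) v - P (t j) v) * (v - s) ^ (-c - 1)) = (∫ s in t j..t (j + 1), f s) -
        (P (t i) v - P (t j) v) * (((v - t (j + 1)) ^ (-c) - (v - t j) ^ (-c)) / c) := by
      intro j hj
      have hj' : t (j + 1) ≤ t i := ht (Finset.mem_range.1 hj)
      rw [intervalIntegral.integral_sub, intervalIntegral.integral_const_mul,
        integral_sub_left_rpow hc0.ne' (ht (Nat.le_succ j)) (hj'.trans_lt hv.1)]
      · refine hif.mono_set ?_
        rw [uIcc_of_le (ht (Nat.le_succ j)), uIcc_of_le ((hat i).trans hv.1.le)]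
        exact Icc_subset_Icc (hat j) (hj'.trans hv.1.le)
      · exact (intervalIntegrable_sub_left_rpow (ht (Nat.le_succ j))
          (hj'.trans_lt hv.1)).const_mul _
    rw [Finset.sum_congr rfl e, Finset.sum_sub_distrib]
    change _ + c * (∫ s in a..v, f s) - _ = _
    rw [hsplit, ht0]
    have e2 : ∑ j ∈ Finset.range i, (P (t i) v - P (t j) v) *
        (((v - t (j + 1)) ^ (-c) - (v - t j) ^ (-c)) / c) =
        (∑ j ∈ Finset.range i, (P (t i) v - P (t j) v) *
        ((v - t (j + 1)) ^ (-c) - (v - t j) ^ (-c))) / c := by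
      rw [Finset.sum_div]
      exact Finset.sum_congr rfl fun j _ => by ring
    rw [e2]
    field_simp
    ring
  have hPi : |P v v - P (t i) v| ≤ C * δ ^ p :=
    (h.bound_diag (hat i) hv.1 hvb).trans (by gcongr)
  have hw : 0 < (v - t i) ^ (-c) := Real.rpow_pos_of_pos hvi _
  have T1 : |(P v v - P (t i) v) * (v - a) ^ (-c)| ≤ C * (δ ^ p * (v - t i) ^ (-c)) := by
    have hva : v - t i ≤ v - a := by linarith [hat i]
    rw [abs_mul, abs_of_nonneg (Real.rpow_nonneg (by linarith) _), ← mul_assoc]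
    have := Real.rpow_le_rpow_of_nonpos hvi hva (by linarith : -c ≤ 0)
    have := Real.rpow_nonneg (hvi.le.trans hva) (-c)
    gcongr
  -- Here the kernel is singular at `s = v`, and the order `p > c` of the extrapolation error makes
  -- the product integrable.
  have T3 : |∫ s in t i..v, f s| ≤ C * (δ ^ p * (v - t i) ^ (-c)) / (p - c) := by
    have hb3 : |∫ s in t i..v, f s| ≤ ∫ s in t i..v, C * (v - s) ^ (p - c - 1) := by
      rw [← Real.norm_eq_abs]
      refine intervalIntegral.norm_integral_le_of_norm_le hv.1.le ?_
        ((intervalIntegrable_sub_left_rpow' (by linarith)).const_mul C)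
      have hne : ∀ᵐ s : ℝ, s ≠ v := by
        have := measure_singleton (μ := (volume : Measure ℝ)) v
        exact compl_mem_ae_iff.2 this
      filter_upwards [hne] with s hsv hs'
      have hsv := lt_of_le_of_ne hs'.2 hsv
      have h0 : 0 < v - s := sub_pos.2 hsv
      rw [hf, norm_mul, Real.norm_eq_abs, Real.norm_eq_abs, abs_of_nonneg (Real.rpow_nonneg h0.le _)]
      calc _ ≤ C * (v - s) ^ p * (v - s) ^ (-c - 1) :=
            mul_le_mul_of_nonneg_right (h.bound_diag ((hat i).trans hs'.1.le) hsv hvb)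
              (Real.rpow_nonneg h0.le _)
        _ = _ := by rw [mul_assoc, ← Real.rpow_add h0]; congr 2; ring
    refine hb3.trans ?_
    rw [intervalIntegral.integral_const_mul,
      intervalIntegral.integral_comp_sub_left (fun s => s ^ (p - c - 1)) v, sub_self,
      integral_rpow (Or.inl (by linarith)), show p - c - 1 + 1 = p - c by ring,
      Real.zero_rpow (by linarith), sub_zero, mul_div_assoc]
    have : (v - t i) ^ (p - c) ≤ δ ^ p * (v - t i) ^ (-c) := by
      rw [sub_eq_add_neg p c, Real.rpow_add hvi]
      gcongr
    have hpc : 0 < p - c := by linarith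
    gcongr
  have hd : 0 < c - (p - q) := by linarith
  have T2 : |∑ j ∈ Finset.range i, ∫ s in t j..t (j + 1),
      (f s - (P (t i) v - P (t j) v) * (v - s) ^ (-c - 1))| ≤
      C * (2 / c + 1 / (c - (p - q))) * (δ ^ p * (v - t i) ^ (-c)) := by
    set g : ℝ → ℝ := fun s => C * (2 * δ ^ p * (v - s) ^ (-c - 1) +
      δ ^ q * (v - s) ^ (-(c - (p - q)) - 1)) with hg
    have hgi : ∀ {s₁ s₂}, s₁ ≤ s₂ → s₂ < v → IntervalIntegrable g volume s₁ s₂ :=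
      fun h1 h2 => (((intervalIntegrable_sub_left_rpow h1 h2).const_mul _).add
        ((intervalIntegrable_sub_left_rpow h1 h2).const_mul _)).const_mul _
    have hj : ∀ j ∈ Finset.range i, |∫ s in t j..t (j + 1),
        (f s - (P (t i) v - P (t j) v) * (v - s) ^ (-c - 1))| ≤ ∫ s in t j..t (j + 1), g s := by
      intro j hj
      have hj' : t (j + 1) ≤ t i := ht (Finset.mem_range.1 hj)
      rw [← Real.norm_eq_abs]
      refine intervalIntegral.norm_integral_le_of_norm_le (ht (Nat.le_succ j)) ?_
        (hgi (ht (Nat.le_succ j)) (hj'.trans_lt hv.1))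
      refine ae_of_all _ fun s hs => ?_
      have hsv : s < v := (hs.2.trans hj').trans_lt hv.1
      have h0 : 0 < v - s := sub_pos.2 hsv
      have hsj : s - t j ≤ δ := by
        linarith [hs.2, hδ j (Finset.mem_range.1 hj).le]
      have b1 := h.bound (t j) s v (hat j) hs.1.le hsv.le hvb
      -- Subadditivity of the power, valid since `p - q ≤ 1`, separates the distance to `s` from the
      -- mesh. Because `c > p - q`, the integrals of the two resulting kernels up to `t i` are
      -- governed by powers of `v - t i`, however far away `a` is.
      have b2 : (v - t j) ^ (p - q) ≤ (v - s) ^ (p - q) + δ ^ (p - q) :=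
        (Real.rpow_le_rpow (by linarith [hs.1]) (by linarith : v - t j ≤ (v - s) + δ)
          (by linarith)).trans (Real.rpow_add_le_add_rpow h0.le hδ0.le (by linarith) hpq1)
      have b3 : (s - t j) ^ q ≤ δ ^ q :=
        Real.rpow_le_rpow (by linarith [hs.1]) hsj hq.le
      have b4 : |P s v - P (t j) v| ≤ C * (δ ^ q * ((v - s) ^ (p - q) + δ ^ (p - q))) := by
        refine b1.trans ?_
        have := Real.rpow_nonneg (by linarith [hs.1] : 0 ≤ v - t j) (p - q)
        gcongr
      have e : f s - (P (t i) v - P (t j) v) * (v - s) ^ (-c - 1) =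
          ((P v v - P (t i) v) - (P s v - P (t j) v)) * (v - s) ^ (-c - 1) := by
        rw [hf]; ring
      rw [e, norm_mul, Real.norm_eq_abs, Real.norm_eq_abs, abs_of_nonneg (Real.rpow_nonneg h0.le _)]
      have e1 : δ ^ q * δ ^ (p - q) = δ ^ p := by
        rw [← Real.rpow_add hδ0]; congr 1; ring
      have e2 : (v - s) ^ (-(c - (p - q)) - 1) = (v - s) ^ (p - q) * (v - s) ^ (-c - 1) := by
        rw [← Real.rpow_add h0]; congr 1; ring
      have b5 : |(P v v - P (t i) v) - (P s v - P (t j) v)| ≤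
          C * (2 * δ ^ p + δ ^ q * (v - s) ^ (p - q)) := by
        refine (abs_sub _ _).trans ((add_le_add hPi b4).trans (le_of_eq ?_))
        rw [← e1]; ring
      simp only [hg]
      rw [e2]
      calc _ ≤ C * (2 * δ ^ p + δ ^ q * (v - s) ^ (p - q)) * (v - s) ^ (-c - 1) :=
            mul_le_mul_of_nonneg_right b5 (Real.rpow_nonneg h0.le _)
        _ = _ := by ring
    refine (Finset.abs_sum_le_sum_abs _ _).trans ((Finset.sum_le_sum hj).trans ?_)
    rw [intervalIntegral.sum_integral_adjacent_intervals
      (fun k hk => hgi (ht (Nat.le_succ k)) ((ht hk).trans_lt hv.1)), ht0]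
    simp only [hg]
    rw [intervalIntegral.integral_const_mul, intervalIntegral.integral_add
      ((intervalIntegrable_sub_left_rpow (hat i) hv.1).const_mul _)
      ((intervalIntegrable_sub_left_rpow (hat i) hv.1).const_mul _),
      intervalIntegral.integral_const_mul, intervalIntegral.integral_const_mul,
      integral_sub_left_rpow hc0.ne' (hat i) hv.1, integral_sub_left_rpow hd.ne' (hat i) hv.1,
      mul_assoc C]
    refine mul_le_mul_of_nonneg_left ?_ hC
    have u1 : (v - t i) ^ (-(c - (p - q))) ≤ δ ^ (p - q) * (v - t i) ^ (-c) := by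
      rw [show -(c - (p - q)) = (p - q) + -c by ring, Real.rpow_add hvi]
      have : 0 ≤ p - q := by linarith
      gcongr
    have hva : 0 ≤ v - a := by linarith [hat i]
    have u2 := Real.rpow_nonneg hva (-c)
    have u3 := Real.rpow_nonneg hva (-(c - (p - q)))
    have e1 : δ ^ q * δ ^ (p - q) = δ ^ p := by
      rw [← Real.rpow_add hδ0]; congr 1; ring
    calc _ ≤ 2 * δ ^ p * ((v - t i) ^ (-c) / c) +
          δ ^ q * ((δ ^ (p - q) * (v - t i) ^ (-c)) / (c - (p - q))) := by
          gcongr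
          · linarith
          · linarith
      _ = _ := by rw [← e1]; ring
  rw [hdiff]
  calc _ ≤ |(P v v - P (t i) v) * (v - a) ^ (-c)| + c * |∑ j ∈ Finset.range i,
        ∫ s in t j..t (j + 1), (f s - (P (t i) v - P (t j) v) * (v - s) ^ (-c - 1))| +
        c * |∫ s in t i..v, f s| := by
        rw [← abs_of_pos hc0, ← abs_mul, ← abs_mul, abs_of_pos hc0]
        exact abs_add_three _ _ _
    _ ≤ C * (δ ^ p * (v - t i) ^ (-c)) +
        c * (C * (2 / c + 1 / (c - (p - q))) * (δ ^ p * (v - t i) ^ (-c))) +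
        c * (C * (δ ^ p * (v - t i) ^ (-c)) / (p - c)) := by gcongr
    _ = _ := by
      have : p - c ≠ 0 := by linarith
      field_simp
      ring

end GermBound

lemma integral_sub_rpow_neg {c t₁ t₂ : ℝ} (hc : c < 1) :
    ∫ v in t₁..t₂, (v - t₁) ^ (-c) = (t₂ - t₁) ^ (1 - c) / (1 - c) := by
  rw [intervalIntegral.integral_comp_sub_right (fun s => s ^ (-c)) t₁, sub_self,
    integral_rpow (Or.inl (by linarith)), show -c + 1 = 1 - c by ring,
    Real.zero_rpow (by linarith), sub_zero]

namespace GermBound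

variable {a b C q p c : ℝ} {P : ℝ → ℝ → ℝ}

lemma aestronglyMeasurable_leftDeriv (h : GermBound a b C q p P) :
    AEStronglyMeasurable (leftDeriv a c P) (volume.restrict (Ioc a b)) := by
  set k : ℝ × ℝ → ℝ := fun z => if z.2 < z.1 then
    (P z.1 z.1 - P z.2 z.1) * (z.1 - z.2) ^ (-c - 1) else 0 with hk
  have hkm : Measurable k := by
    have h1 : Measurable fun z : ℝ × ℝ => P z.1 z.1 := (h.cont_diag.comp continuous_fst).measurable
    have h2 : Measurable fun z : ℝ × ℝ => P z.2 z.1 := (h.cont.comp continuous_swap).measurable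
    refine Measurable.ite (measurableSet_lt measurable_snd measurable_fst) ?_ measurable_const
    exact (h1.sub h2).mul ((measurable_fst.sub measurable_snd).pow_const _)
  have hI : StronglyMeasurable fun v => ∫ s in Ioc a b, k (v, s) :=
    hkm.stronglyMeasurable.integral_prod_right'
  have hm : AEStronglyMeasurable (fun v => P v v * (v - a) ^ (-c) + c * ∫ s in Ioc a b, k (v, s))
      (volume.restrict (Ioc a b)) := by
    have h1 := h.cont_diag.measurable
    have h2 := hI.measurable
    exact ((h1.mul ((measurable_id.sub_const a).pow_const _)).add (h2.const_mul c)).aestronglyMeasurable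
  refine hm.congr ?_
  filter_upwards [ae_restrict_mem measurableSet_Ioc] with v hv
  rw [leftDeriv]
  congr 2
  have : ∀ s, k (v, s) = (Iio v).indicator (fun s => (P v v - P s v) * (v - s) ^ (-c - 1)) s := by
    intro s; simp [hk, indicator_apply]
  simp_rw [this]
  rw [setIntegral_indicator measurableSet_Iio, intervalIntegral.integral_of_le hv.1.le,
    integral_Ioc_eq_integral_Ioo]
  congr 2
  ext u
  simp only [mem_Ioo, mem_inter_iff, mem_Iio, mem_Ioc]
  constructor
  · rintro ⟨⟨h1, h2⟩, h3⟩; exact ⟨h1, h3⟩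
  · rintro ⟨h1, h3⟩; exact ⟨⟨h1, h3.le.trans hv.2⟩, h3⟩

/-- The approximation lemma for the trivial partition with points `a` and `b` bounds the derivative
by a multiple of `(v - a) ^ (-c)`, which is integrable as `c < 1`. -/
lemma intervalIntegrable_leftDeriv (h : GermBound a b C q p P) (hq : 0 < q) (hqp : q ≤ p)
    (hpq1 : p - q ≤ 1) (hc1 : p - q < c) (hcp : c < p) (hc : c < 1) (hab : a ≤ b) :
    IntervalIntegrable (leftDeriv a c P) volume a b := by
  obtain ⟨M, hM⟩ := (isCompact_Icc (a := a) (b := b)).exists_bound_of_continuousOn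
    (h.cont_right a).continuousOn
  set t : ℕ → ℝ := fun k => if k = 0 then a else b with ht
  have htm : Monotone t := by
    refine monotone_nat_of_le_succ fun n => ?_
    rcases n with _ | n <;> simp [ht, hab]
  refine ((intervalIntegrable_sub_rpow (by linarith : -1 < -c)).const_mul
    (M + C * (3 + c / (c - (p - q)) + c / (p - c)) * (b - a) ^ p)).mono_fun'
    (by rw [uIoc_of_le hab]; exact h.aestronglyMeasurable_leftDeriv) ?_
  rw [uIoc_of_le hab]
  filter_upwards [ae_restrict_mem measurableSet_Ioc] with v hv
  have h1 := h.abs_leftDeriv_sub_le hq hqp hpq1 hc1 hcp htm (i := 0) (δ := b - a) (by simp [ht])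
    (by simp [ht]) (by simp [ht]) (v := v) (by simpa [ht] using hv)
  simp only [zero_add, Finset.range_one, Finset.sum_singleton] at h1
  have ht0 : t 0 = a := by simp [ht]
  simp only [jump] at h1
  rw [ht0] at h1
  have h2 := hM v ⟨hv.1.le, hv.2⟩
  have h3 := Real.rpow_nonneg (sub_nonneg.2 hv.1.le) (-c)
  rw [Real.norm_eq_abs] at h2 ⊢
  calc |leftDeriv a c P v| ≤ |leftDeriv a c P v - P a v * (v - a) ^ (-c)| +
        |P a v * (v - a) ^ (-c)| := by
        have := abs_add_le (leftDeriv a c P v - P a v * (v - a) ^ (-c)) (P a v * (v - a) ^ (-c))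
        rwa [sub_add_cancel] at this
    _ ≤ C * (3 + c / (c - (p - q)) + c / (p - c)) * ((b - a) ^ p * (v - a) ^ (-c)) +
        M * (v - a) ^ (-c) := by
        rw [abs_mul, abs_of_nonneg h3]
        gcongr
    _ = _ := by ring

lemma continuous_jump (h : GermBound a b C q p P) (t : ℕ → ℝ) (k : ℕ) :
    Continuous fun v => jump P t k v := by
  cases k with
  | zero => exact h.cont_right _
  | succ k => exact (h.cont_right _).sub (h.cont_right _)

/-- The pairing of a left-sided derivative with a bounded function is approximated by the sum of
the contributions of the jumps of the frozen extrapolation. -/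
lemma abs_integral_leftDeriv_sub_le (h : GermBound a b C q p P) (hq : 0 < q) (hqp : q ≤ p)
    (hpq1 : p - q ≤ 1) (hc1 : p - q < c) (hcp : c < p) (hc : c < 1) {Y : ℝ → ℝ} {M : ℝ}
    (hY : Continuous Y) (hM : ∀ v ∈ Icc a b, |Y v| ≤ M) {t : ℕ → ℝ} (ht : Monotone t)
    (ht0 : t 0 = a) {n : ℕ} (htn : t n = b) {δ : ℝ} (hδ0 : 0 ≤ δ)
    (hδ : ∀ j < n, t (j + 1) - t j ≤ δ) :
    |(∫ v in a..b, leftDeriv a c P v * Y v) -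
      ∑ k ∈ Finset.range n, ∫ v in t k..b, jump P t k v * (v - t k) ^ (-c) * Y v| ≤
      M * (C * (3 + c / (c - (p - q)) + c / (p - c))) / (1 - c) * (n * (δ ^ p * δ ^ (1 - c))) := by
  have hab : a ≤ b := by rw [← ht0, ← htn]; exact ht (Nat.zero_le n)
  have hC := h.nonneg
  have hM0 : 0 ≤ M := (abs_nonneg _).trans (hM a ⟨le_rfl, hab⟩)
  have hat : ∀ j, a ≤ t j := fun j => ht0 ▸ ht (Nat.zero_le j)
  have htb : ∀ j ≤ n, t j ≤ b := fun j hj => htn ▸ ht hj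
  set K := C * (3 + c / (c - (p - q)) + c / (p - c)) with hK
  have hK0 : 0 ≤ K := by
    have : 0 < c := by linarith
    have : 0 < c - (p - q) := by linarith
    have : 0 < p - c := by linarith
    positivity
  set u : ℕ → ℝ → ℝ := fun k v => jump P t k v * (v - t k) ^ (-c) * Y v with hu
  have hui : ∀ k s₁ s₂, IntervalIntegrable (u k) volume s₁ s₂ := by
    intro k s₁ s₂
    have h1 : IntervalIntegrable (fun v => (v - t k) ^ (-c)) volume s₁ s₂ := by
      have := (intervalIntegral.intervalIntegrable_rpow' (a := s₁ - t k) (b := s₂ - t k)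
        (by linarith : -1 < -c)).comp_sub_right (t k)
      simpa using this
    exact (h1.continuousOn_mul (h.continuous_jump t k).continuousOn).mul_continuousOn
      hY.continuousOn
  have hLi : IntervalIntegrable (fun v => leftDeriv a c P v * Y v) volume a b :=
    (h.intervalIntegrable_leftDeriv hq hqp hpq1 hc1 hcp hc hab).mul_continuousOn hY.continuousOn
  have hLi' : ∀ i < n, IntervalIntegrable (fun v => leftDeriv a c P v * Y v) volume
      (t i) (t (i + 1)) := by
    intro i hi
    refine hLi.mono_set ?_
    rw [uIcc_of_le (ht (Nat.le_succ i)), uIcc_of_le hab]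
    exact Icc_subset_Icc (hat i) (htb _ hi)
  -- The jump at `t k` acts on all of `[t k, b]`. Exchanging the sums collects, on each partition
  -- interval, the jumps that have already occurred.
  have e1 : ∑ k ∈ Finset.range n, ∫ v in t k..b, u k v =
      ∑ i ∈ Finset.range n, ∑ k ∈ Finset.range (i + 1), ∫ v in t i..t (i + 1), u k v := by
    have : ∀ k ∈ Finset.range n, ∫ v in t k..b, u k v =
        ∑ i ∈ Finset.Ico k n, ∫ v in t i..t (i + 1), u k v := by
      intro k hk
      rw [intervalIntegral.sum_integral_adjacent_intervals_Ico (Finset.mem_range.1 hk).le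
        (fun i _ => hui k _ _), htn]
    rw [Finset.sum_congr rfl this]
    simp only [Finset.range_eq_Ico]
    rw [Finset.sum_Ico_Ico_comm]
  have e2 : ∫ v in a..b, leftDeriv a c P v * Y v =
      ∑ i ∈ Finset.range n, ∫ v in t i..t (i + 1), leftDeriv a c P v * Y v := by
    rw [intervalIntegral.sum_integral_adjacent_intervals hLi', ht0, htn]
  rw [e1, e2, ← Finset.sum_sub_distrib]
  have hpiece : ∀ i ∈ Finset.range n, |(∫ v in t i..t (i + 1), leftDeriv a c P v * Y v) -
      ∑ k ∈ Finset.range (i + 1), ∫ v in t i..t (i + 1), u k v| ≤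
      M * K / (1 - c) * (δ ^ p * δ ^ (1 - c)) := by
    intro i hi
    have hi := Finset.mem_range.1 hi
    have hs : IntervalIntegrable (fun v => ∑ k ∈ Finset.range (i + 1), u k v) volume
        (t i) (t (i + 1)) := by
      have := IntervalIntegrable.sum (Finset.range (i + 1)) (f := u) (fun k _ => hui k (t i) (t (i + 1)))
      rwa [Finset.sum_fn] at this
    rw [← intervalIntegral.integral_finsetSum (fun k _ => hui k _ _),
      ← intervalIntegral.integral_sub (hLi' i hi) hs,
      ← Real.norm_eq_abs]
    have hb : ‖∫ v in t i..t (i + 1), (leftDeriv a c P v * Y v -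
        ∑ k ∈ Finset.range (i + 1), u k v)‖ ≤
        ∫ v in t i..t (i + 1), M * K * δ ^ p * (v - t i) ^ (-c) := by
      refine intervalIntegral.norm_integral_le_of_norm_le (ht (Nat.le_succ i)) ?_
        ((intervalIntegrable_sub_rpow (by linarith)).const_mul _)
      refine ae_of_all _ fun v hv => ?_
      have hd := h.abs_leftDeriv_sub_le hq hqp hpq1 hc1 hcp ht ht0 (i := i)
        (fun j hj => hδ j (hj.trans_lt hi)) (htb _ hi) hv
      have hYv := hM v ⟨(hat i).trans hv.1.le, hv.2.trans (htb _ hi)⟩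
      have : leftDeriv a c P v * Y v - ∑ k ∈ Finset.range (i + 1), u k v =
          (leftDeriv a c P v - ∑ k ∈ Finset.range (i + 1), jump P t k v * (v - t k) ^ (-c)) *
            Y v := by
        rw [sub_mul, Finset.sum_mul]
      rw [this, Real.norm_eq_abs, abs_mul]
      calc _ ≤ K * (δ ^ p * (v - t i) ^ (-c)) * M :=
            mul_le_mul hd hYv (abs_nonneg _) ((abs_nonneg _).trans hd)
        _ = _ := by ring
    refine hb.trans ?_
    rw [intervalIntegral.integral_const_mul, integral_sub_rpow_neg hc]
    have h0 : 0 ≤ t (i + 1) - t i := sub_nonneg.2 (ht (Nat.le_succ i))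
    have h1 : (t (i + 1) - t i) ^ (1 - c) ≤ δ ^ (1 - c) :=
      Real.rpow_le_rpow h0 (hδ i hi) (by linarith)
    have h2 : 0 < 1 - c := by linarith
    have h3 := Real.rpow_nonneg hδ0 p
    calc _ ≤ M * K * δ ^ p * (δ ^ (1 - c) / (1 - c)) := by gcongr
      _ = _ := by ring
  refine (Finset.abs_sum_le_sum_abs _ _).trans ((Finset.sum_le_sum hpiece).trans (le_of_eq ?_))
  rw [Finset.sum_const, Finset.card_range, nsmul_eq_mul]
  ring

end GermBound

/-- The `n` intervals, each with an error of order `n ^ (-(p + 1 - c))`, contribute `n ^ (-(p - c))`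
in total. -/
lemma tendsto_mesh_zero {K L p c : ℝ} (hL : 0 ≤ L) (hcp : c < p) :
    Tendsto (fun n : ℕ => K * (n * ((L / n) ^ p * (L / n) ^ (1 - c)))) atTop (𝓝 0) := by
  have h1 : Tendsto (fun n : ℕ => K * (L ^ p * L ^ (1 - c)) * (n : ℝ) ^ (-(p - c))) atTop (𝓝 0) := by
    have := ((tendsto_rpow_neg_atTop (sub_pos.2 hcp)).comp tendsto_natCast_atTop_atTop).const_mul
      (K * (L ^ p * L ^ (1 - c)))
    simpa using this
  refine h1.congr' ?_
  filter_upwards [eventually_gt_atTop 0] with n hn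
  have hn : (0 : ℝ) < n := by exact_mod_cast hn
  rw [Real.div_rpow hL hn.le, Real.div_rpow hL hn.le]
  have : (n : ℝ) ^ (-(p - c)) = n * ((n : ℝ) ^ p)⁻¹ * ((n : ℝ) ^ (1 - c))⁻¹ := by
    rw [← Real.rpow_neg hn.le, ← Real.rpow_neg hn.le]
    nth_rw 2 [← Real.rpow_one (n : ℝ)]
    rw [← Real.rpow_add hn, ← Real.rpow_add hn]
    congr 1; ring
  rw [this]
  field_simp

/-! ### The scalar pairing as a limit of Riemann sums -/

section ScalarIntegral

variable {ι : Type*} [Fintype ι] {β C b κ : ℝ} {x : ι → ℝ → ℝ} {y : ℝ → ℝ} {A : ι → ℝ → ℝ → ℝ}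

/-- The extrapolation `F(s) + F'(s) (x(v) - x(s))`. -/
def extrapolation (F : ℝ → ℝ) (F' : ι → ℝ → ℝ) (x : ι → ℝ → ℝ) (s v : ℝ) : ℝ :=
  F s + ∑ i, F' i s * (x i v - x i s)

/-- The second-order Riemann summand `F(s) (y(t) - y(s)) + F'(s) (x ⊗ y)_{s,t}`. -/
def scalarGerm (F : ℝ → ℝ) (F' : ι → ℝ → ℝ) (y : ℝ → ℝ) (A : ι → ℝ → ℝ → ℝ) (s t : ℝ) : ℝ :=
  F s * (y t - y s) + ∑ i, F' i s * A i s t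

/-- The pairing of fractional derivatives that defines the integral. -/
def fracPairing (a b κ : ℝ) (F : ℝ → ℝ) (F' : ι → ℝ → ℝ) (x : ι → ℝ → ℝ) (y : ℝ → ℝ)
    (A : ι → ℝ → ℝ → ℝ) : ℝ :=
  -(1 / Real.Gamma κ * ∫ v in a..b, leftDeriv a (1 - κ) (extrapolation F F' x) v *
      StoppedRough.rightDeriv κ y v) +
    ∑ i, 1 / Real.Gamma (κ + κ) * ∫ v in a..b, leftDeriv a (1 - (κ + κ)) (fun s _ => F' i s) v *
      StoppedRough.rightDeriv κ (StoppedRough.tensorDeriv κ (A i)) v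

open StoppedRough in
-- A piece starting at `c` that is affine in `x` has a left derivative consisting of the boundary
-- power alone. Its constant part is evaluated by the inversion formula for `y`, its linear part by
-- `integral_tensor`, whose correction term cancels the integral of `x - x c` against the derivative
-- of `y`.
lemma elementary_integral (hκ : 0 < κ) (hκβ : κ < β) (hβ1 : β ≤ 1)
    (hy : CutHolder β C y) (hyb : ∀ t, b ≤ t → y t = y b)
    (hA : ∀ i, StoppedRough β C b (x i) y (A i)) {c : ℝ} (hcb : c ≤ b) (p : ℝ) (q : ι → ℝ)
    {J : ℝ → ℝ} {J' : ι → ℝ → ℝ} (hJ : ∀ v, J v = p + ∑ i, q i * (x i v - x i c))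
    (hJ' : ∀ i v, J' i v = q i) :
    -(1 / Real.Gamma κ * ∫ v in c..b, J v * (v - c) ^ (-(1 - κ)) * rightDeriv κ y v) +
      ∑ i, 1 / Real.Gamma (κ + κ) * ∫ v in c..b, J' i v * (v - c) ^ (-(1 - (κ + κ))) *
        rightDeriv κ (tensorDeriv κ (A i)) v =
      p * (y b - y c) + ∑ i, q i * A i c b := by
  have hβ := hκ.trans hκβ
  have hΓ := Real.Gamma_pos_of_pos hκ
  have hir : IntervalIntegrable (fun u => (u - c) ^ (κ - 1)) volume c b :=
    intervalIntegrable_sub_rpow (by linarith)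
  have hiY : IntervalIntegrable (fun v => (v - c) ^ (κ - 1) * rightDeriv κ y v) volume c b :=
    hir.mul_continuousOn (continuous_rightDeriv hy hκ hκβ).continuousOn
  have hix : ∀ i, IntervalIntegrable
      (fun v => (x i v - x i c) * ((v - c) ^ (κ - 1) * rightDeriv κ y v)) volume c b := fun i =>
    hiY.continuousOn_mul ((((hA i).left.continuous hβ).sub continuous_const).continuousOn)
  have e1 : ∫ v in c..b, J v * (v - c) ^ (-(1 - κ)) * rightDeriv κ y v =
      p * (Real.Gamma κ * (y c - y b)) + ∑ i, q i *
        ∫ v in c..b, (x i v - x i c) * ((v - c) ^ (κ - 1) * rightDeriv κ y v) := by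
    have : ∀ v, J v * (v - c) ^ (-(1 - κ)) * rightDeriv κ y v =
        p * ((v - c) ^ (κ - 1) * rightDeriv κ y v) +
        ∑ i, q i * ((x i v - x i c) * ((v - c) ^ (κ - 1) * rightDeriv κ y v)) := by
      intro v
      rw [hJ, neg_sub, add_mul, add_mul, Finset.sum_mul, Finset.sum_mul, mul_assoc]
      congr 1
      exact Finset.sum_congr rfl fun i _ => by ring
    simp_rw [this]
    have hs : IntervalIntegrable (fun v => ∑ i, q i * ((x i v - x i c) * ((v - c) ^ (κ - 1) *
        rightDeriv κ y v))) volume c b := by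
      have := IntervalIntegrable.sum Finset.univ (f := fun i v => q i * ((x i v - x i c) *
        ((v - c) ^ (κ - 1) * rightDeriv κ y v))) (fun i _ => (hix i).const_mul (q i))
      rwa [Finset.sum_fn] at this
    rw [intervalIntegral.integral_add (hiY.const_mul p) hs, intervalIntegral.integral_const_mul,
      integral_rpow_mul_rightDeriv hy hκ hκβ hβ1 hcb hyb,
      intervalIntegral.integral_finsetSum (fun i _ => (hix i).const_mul (q i))]
    simp_rw [intervalIntegral.integral_const_mul]
  have e2 : ∀ i, ∫ v in c..b, J' i v * (v - c) ^ (-(1 - (κ + κ))) *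
      rightDeriv κ (tensorDeriv κ (A i)) v =
      q i * ∫ v in c..b, (v - c) ^ (κ + κ - 1) * rightDeriv κ (tensorDeriv κ (A i)) v := by
    intro i
    rw [← intervalIntegral.integral_const_mul]
    congr 1
    ext v
    rw [hJ', neg_sub]; ring
  simp_rw [e2]
  rw [e1]
  have e3 : ∀ i, 1 / Real.Gamma (κ + κ) *
      (q i * ∫ v in c..b, (v - c) ^ (κ + κ - 1) * rightDeriv κ (tensorDeriv κ (A i)) v) =
      q i * A i c b + q i * (1 / Real.Gamma κ *
        ∫ v in c..b, (x i v - x i c) * ((v - c) ^ (κ - 1) * rightDeriv κ y v)) := by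
    intro i
    rw [← (hA i).integral_tensor hκ hκβ hβ1 hcb]
    ring
  simp_rw [e3]
  rw [Finset.sum_add_distrib, mul_add, Finset.mul_sum]
  have e4 : ∑ i, q i * (1 / Real.Gamma κ *
        ∫ v in c..b, (x i v - x i c) * ((v - c) ^ (κ - 1) * rightDeriv κ y v)) =
      ∑ i, 1 / Real.Gamma κ * (q i *
        ∫ v in c..b, (x i v - x i c) * ((v - c) ^ (κ - 1) * rightDeriv κ y v)) :=
    Finset.sum_congr rfl fun i _ => by ring
  rw [e4]
  field_simp
  ring

/-- Lengthening an interval from `u` to `t` adds the summand at `u` of the integrand extrapolated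
from `s`. Through this identity the elementary integrals telescope. -/
lemma scalarGerm_sub {F : ℝ → ℝ} {F' : ι → ℝ → ℝ} (hA : ∀ i, StoppedRough β C b (x i) y (A i))
    {s u t : ℝ} (hsu : s ≤ u) (hut : u ≤ t) :
    scalarGerm F F' y A s t - scalarGerm F F' y A s u =
      extrapolation F F' x s u * (y t - y u) + ∑ i, F' i s * A i u t := by
  simp only [scalarGerm, extrapolation]
  have : ∀ i, F' i s * A i s t = F' i s * A i s u + F' i s * A i u t +
      F' i s * (x i u - x i s) * (y t - y u) := by
    intro i
    rw [← (hA i).mult s u t hsu hut]; ring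
  simp_rw [this]
  rw [Finset.sum_add_distrib, Finset.sum_add_distrib, ← Finset.sum_mul]
  ring

open StoppedRough in
/-- Freezing the integrand along a partition turns the pairing into a Riemann sum. -/
lemma sum_elementary (hκ : 0 < κ) (hκβ : κ < β) (hβ1 : β ≤ 1)
    (hy : CutHolder β C y) (hyb : ∀ t, b ≤ t → y t = y b)
    (hA : ∀ i, StoppedRough β C b (x i) y (A i)) (F : ℝ → ℝ) (F' : ι → ℝ → ℝ) {t : ℕ → ℝ}
    (ht : Monotone t) (n : ℕ) (htn : t n ≤ b) :
    ∑ k ∈ Finset.range (n + 1),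
      (-(1 / Real.Gamma κ * ∫ v in t k..b, jump (extrapolation F F' x) t k v *
        (v - t k) ^ (-(1 - κ)) * rightDeriv κ y v) +
      ∑ i, 1 / Real.Gamma (κ + κ) * ∫ v in t k..b, jump (fun s _ => F' i s) t k v *
        (v - t k) ^ (-(1 - (κ + κ))) * rightDeriv κ (tensorDeriv κ (A i)) v) =
    (∑ k ∈ Finset.range n, scalarGerm F F' y A (t k) (t (k + 1))) +
      scalarGerm F F' y A (t n) b := by
  induction n with
  | zero =>
    simp only [zero_add, Finset.range_one, Finset.sum_singleton, Finset.range_zero,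
      Finset.sum_empty]
    exact elementary_integral hκ hκβ hβ1 hy hyb hA htn _ (fun i => F' i (t 0)) (fun v => rfl)
      (fun i v => rfl)
  | succ n ih =>
    -- The jump at `t (n + 1)` is the true value minus the value extrapolated from `t n`, and it is
    -- again affine in `x`. Its contribution replaces the summand over `[t n, b]` by those over `[t
    -- n, t (n + 1)]` and `[t (n + 1), b]`.
    rw [Finset.sum_range_succ, ih ((ht (Nat.le_succ n)).trans htn), Finset.sum_range_succ _ n,
      elementary_integral hκ hκβ hβ1 hy hyb hA htn
        (F (t (n + 1)) - extrapolation F F' x (t n) (t (n + 1)))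
        (fun i => F' i (t (n + 1)) - F' i (t n))]
    · have h1 := scalarGerm_sub (F := F) (F' := F') hA (ht (Nat.le_succ n)) htn
      have h2 : scalarGerm F F' y A (t (n + 1)) b = F (t (n + 1)) * (y b - y (t (n + 1))) +
        ∑ i, F' i (t (n + 1)) * A i (t (n + 1)) b := rfl
      simp only [sub_mul, Finset.sum_sub_distrib]
      simp only [Nat.succ_eq_add_one] at h1
      linarith
    · intro v
      simp only [jump, extrapolation]
      have : ∀ i, F' i (t n) * (x i v - x i (t n)) = F' i (t n) * (x i (t (n + 1)) - x i (t n)) +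
        F' i (t n) * (x i v - x i (t (n + 1))) := fun i => by ring
      simp_rw [this, sub_mul]
      rw [Finset.sum_add_distrib, Finset.sum_sub_distrib]
      ring
    · intro i v
      rfl

open StoppedRough in
/-- The pairing of fractional derivatives is the limit of the Riemann sums. -/
lemma exists_riemann_bound (hκ : 0 < κ) (hκβ : κ < β) (hβ1 : β < 1 - κ)
    (hy : CutHolder β C y) (hyb : ∀ t, b ≤ t → y t = y b)
    (hA : ∀ i, StoppedRough β C b (x i) y (A i)) {F : ℝ → ℝ} {F' : ι → ℝ → ℝ} {a K q : ℝ}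
    (hq : 1 - (κ + κ) < q) (hqb : 1 - κ < q + β)
    (hP : GermBound a b K q (q + β) (extrapolation F F' x))
    (hP' : ∀ i, GermBound a b K q q (fun s _ => F' i s)) {L : ℝ} (hL : 0 ≤ L) :
    ∃ ε : ℕ → ℝ, Tendsto ε atTop (𝓝 0) ∧ ∀ n : ℕ, ∀ t : ℕ → ℝ, Monotone t → t 0 = a →
      t (n + 1) = b → (∀ j < n + 1, t (j + 1) - t j ≤ L / (n + 1 : ℕ)) →
      |fracPairing a b κ F F' x y A -
        ∑ k ∈ Finset.range (n + 1), scalarGerm F F' y A (t k) (t (k + 1))| ≤ ε n := by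
  have hβ := hκ.trans hκβ
  have hYc : Continuous (rightDeriv κ y) := continuous_rightDeriv hy hκ hκβ
  have hZc : ∀ i, Continuous (rightDeriv κ (tensorDeriv κ (A i))) := by
    intro i
    obtain ⟨C', hC'⟩ := (hA i).exists_cutHolder_tensorDeriv hκ hκβ
    exact continuous_rightDeriv hC' hκ hκβ
  obtain ⟨M, hM⟩ := (isCompact_Icc (a := a) (b := b)).exists_bound_of_continuousOn hYc.continuousOn
  choose N hN using fun i =>
    (isCompact_Icc (a := a) (b := b)).exists_bound_of_continuousOn (hZc i).continuousOn
  -- With `κ = 1 - α` these orders are `α` and `2 * α - 1`. The extrapolation has order `p = q + β`,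
  -- its derivative has order `p = q`, and both must exceed the order of differentiation.
  set c₁ := 1 - κ
  set c₂ := 1 - (κ + κ)
  set B₁ := M * (K * (3 + c₁ / (c₁ - (q + β - q)) + c₁ / (q + β - c₁))) / (1 - c₁)
  set B₂ : ι → ℝ := fun i => N i * (K * (3 + c₂ / (c₂ - (q - q)) + c₂ / (q - c₂))) / (1 - c₂)
  set ε₁ : ℕ → ℝ := fun n => B₁ * (n * ((L / n) ^ (q + β) * (L / n) ^ (1 - c₁)))
  set ε₂ : ι → ℕ → ℝ := fun i n => B₂ i * (n * ((L / n) ^ q * (L / n) ^ (1 - c₂)))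
  refine ⟨fun n => |1 / Real.Gamma κ| * ε₁ (n + 1) +
    ∑ i, |1 / Real.Gamma (κ + κ)| * ε₂ i (n + 1), ?_, ?_⟩
  · have h1 : Tendsto ε₁ atTop (𝓝 0) := tendsto_mesh_zero hL hqb
    have h2 : ∀ i, Tendsto (ε₂ i) atTop (𝓝 0) := fun i => tendsto_mesh_zero hL hq
    have h3 := ((h1.comp (tendsto_add_atTop_nat 1)).const_mul (|1 / Real.Gamma κ|)).add
      (tendsto_finsetSum Finset.univ fun i _ =>
        ((h2 i).comp (tendsto_add_atTop_nat 1)).const_mul (|1 / Real.Gamma (κ + κ)|))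
    simpa using h3
  · intro n t ht ht0 htn hδ
    have hδ0 : 0 ≤ L / (n + 1 : ℕ) := by positivity
    have g1 := hP.abs_integral_leftDeriv_sub_le (c := c₁) (by linarith) (by linarith) (by linarith)
      (by linarith) hqb (by linarith) hYc hM ht ht0 htn hδ0 hδ
    have g2 : ∀ i, _ := fun i => (hP' i).abs_integral_leftDeriv_sub_le (c := c₂) (by linarith)
      le_rfl (by linarith) (by linarith) hq (by linarith) (hZc i) (hN i) ht ht0 htn hδ0 hδ
    have hs := sum_elementary hκ hκβ (by linarith) hy hyb hA F F' ht n
      (by rw [← htn]; exact ht (Nat.le_succ n))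
    rw [Finset.sum_range_succ _ n, htn, ← hs, Finset.sum_add_distrib, Finset.sum_neg_distrib,
      Finset.sum_comm]
    simp_rw [← Finset.mul_sum]
    have e : ∀ (r s X X' : ℝ) (Z Z' : ι → ℝ),
        (-(r * X) + ∑ i, s * Z i) - (-(r * X') + s * ∑ i, Z' i) =
        -(r * (X - X')) + ∑ i, s * (Z i - Z' i) := by
      intro r s X X' Z Z'
      simp_rw [mul_sub]
      rw [Finset.sum_sub_distrib, Finset.mul_sum]; ring
    rw [fracPairing, e, Finset.mul_sum Finset.univ (fun i => ε₂ i (n + 1))]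
    refine (abs_add_le _ _).trans (add_le_add ?_ ?_)
    · rw [abs_neg, abs_mul]
      exact mul_le_mul_of_nonneg_left g1 (abs_nonneg _)
    · refine (Finset.abs_sum_le_sum_abs _ _).trans (Finset.sum_le_sum fun i _ => ?_)
      rw [abs_mul]
      exact mul_le_mul_of_nonneg_left (g2 i) (abs_nonneg _)

end ScalarIntegral

/-! ### From the vector-valued integral to the scalar pairings -/

lemma exists_holder_bound {E : Type*} [SeminormedAddCommGroup E] {β : ℝ} (hβ : 0 ≤ β) {S : Set ℝ}
    {x : ℝ → E} (h : ∃ C, HolderOnWith C β.toNNReal x S) :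
    ∃ C : ℝ, 0 ≤ C ∧ ∀ s ∈ S, ∀ t ∈ S, ‖x t - x s‖ ≤ C * |t - s| ^ β := by
  obtain ⟨C, hC⟩ := h
  refine ⟨C, C.2, fun s hs t ht => ?_⟩
  have := hC.dist_le ht hs
  rwa [dist_eq_norm, Real.dist_eq, Real.coe_toNNReal _ hβ] at this

lemma exists_holderOnWith {E : Type*} [SeminormedAddCommGroup E] {β : ℝ} (hβ : 0 ≤ β) {S : Set ℝ}
    {x : ℝ → E} {C : ℝ} (h : ∀ s ∈ S, ∀ t ∈ S, s ≤ t → ‖x t - x s‖ ≤ C * |t - s| ^ β) :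
    ∃ C, HolderOnWith C β.toNNReal x S := by
  refine ⟨C.toNNReal, fun s hs t ht => ?_⟩
  rw [edist_dist, edist_dist, Real.coe_toNNReal _ hβ,
    ENNReal.ofReal_rpow_of_nonneg dist_nonneg hβ]
  change _ ≤ ENNReal.ofReal C * _
  rw [← ENNReal.ofReal_mul' (Real.rpow_nonneg dist_nonneg _)]
  refine ENNReal.ofReal_le_ofReal ?_
  rw [dist_eq_norm, Real.dist_eq]
  rcases le_total s t with h' | h'
  · rw [norm_sub_rev, abs_sub_comm]; exact h s hs t ht h'
  · exact h t ht s hs h'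

/-- The projection of the line onto `[a, b]`. -/
def clampIcc (a b v : ℝ) : ℝ := max a (min b v)

lemma clampIcc_mem {a b : ℝ} (hab : a ≤ b) (v : ℝ) : clampIcc a b v ∈ Icc a b :=
  ⟨le_max_left _ _, max_le hab (min_le_left _ _)⟩

lemma clampIcc_of_mem {a b v : ℝ} (hv : v ∈ Icc a b) : clampIcc a b v = v := by
  rw [clampIcc, min_eq_right hv.2, max_eq_right hv.1]

lemma clampIcc_of_ge {a b v : ℝ} (hab : a ≤ b) (hv : b ≤ v) : clampIcc a b v = b := by
  rw [clampIcc, min_eq_left hv, max_eq_right hab]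

lemma clampIcc_mono {a b s t : ℝ} (h : s ≤ t) : clampIcc a b s ≤ clampIcc a b t :=
  max_le_max_left _ (min_le_min_left _ h)

lemma continuous_clampIcc (a b : ℝ) : Continuous (clampIcc a b) := by
  unfold clampIcc; fun_prop

lemma clampIcc_sub_le_sub {a b s t : ℝ} (h : s ≤ t) :
    clampIcc a b t - clampIcc a b s ≤ t - s := by
  unfold clampIcc
  rcases max_choice a (min b t) with h1 | h1 <;> rcases max_choice a (min b s) with h2 | h2 <;>
  rcases min_choice b t with h3 | h3 <;> rcases min_choice b s with h4 | h4 <;>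
    rw [h1, h2] <;> (try rw [h3]) <;> (try rw [h4]) <;>
    linarith [le_max_left a (min b t), le_max_right a (min b t), le_max_left a (min b s),
      le_max_right a (min b s), min_le_left b t, min_le_right b t, min_le_left b s,
      min_le_right b s]

lemma clampIcc_sub_le {a b s t : ℝ} (hab : a ≤ b) (h : s ≤ t) :
    clampIcc a b t - clampIcc a b s ≤ max 1 (b - a) * min (t - s) 1 := by
  have h1 : clampIcc a b t - clampIcc a b s ≤ b - a := by
    linarith [(clampIcc_mem hab t).2, (clampIcc_mem hab s).1]
  rcases le_total (t - s) 1 with h' | h'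
  · rw [min_eq_left h']
    exact (clampIcc_sub_le_sub h).trans
      (le_mul_of_one_le_left (by linarith) (le_max_left _ _))
  · rw [min_eq_right h', mul_one]
    exact h1.trans (le_max_right _ _)

lemma clampIcc_sub_rpow_le {a b s t p : ℝ} (hab : a ≤ b) (h : s ≤ t) (hp : 0 ≤ p) :
    (clampIcc a b t - clampIcc a b s) ^ p ≤ max 1 (b - a) ^ p * (min (t - s) 1) ^ p := by
  rw [← Real.mul_rpow (by positivity) (le_min (by linarith) zero_le_one)]
  exact Real.rpow_le_rpow (sub_nonneg.2 (clampIcc_mono h)) (clampIcc_sub_le hab h) hp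

/-- The integrand `f(x)` is controlled by `x`, with a `q`-Hölder derivative. -/
structure IsControlled {ι κ : Type*} [Fintype ι] [DecidableEq ι] (β q a b : ℝ)
    (f : EuclideanSpace ℝ ι → κ → ℝ) (x : ℝ → EuclideanSpace ℝ ι) : Prop where
  cont : ∀ j, ContinuousOn (fun s => f (x s) j) (Icc a b)
  cont_deriv : ∀ i j, ContinuousOn
    (fun s => fderiv ℝ (fun p => f p j) (x s) (EuclideanSpace.single i 1)) (Icc a b)
  remainder : ∃ C : ℝ, 0 ≤ C ∧ ∀ j s v, a ≤ s → s ≤ v → v ≤ b →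
    |f (x v) j - f (x s) j - fderiv ℝ (fun p => f p j) (x s) (x v - x s)| ≤ C * (v - s) ^ (q + β)
  deriv : ∃ C : ℝ, 0 ≤ C ∧ ∀ i j s v, a ≤ s → s ≤ v → v ≤ b →
    |fderiv ℝ (fun p => f p j) (x v) (EuclideanSpace.single i 1) -
      fderiv ℝ (fun p => f p j) (x s) (EuclideanSpace.single i 1)| ≤ C * (v - s) ^ q

/-- The Riemann summand of second order of the integral. -/
def hnGerm {ι κ : Type*} [Fintype ι] [Fintype κ] [DecidableEq ι]
    (f : EuclideanSpace ℝ ι → κ → ℝ) (x : ℝ → EuclideanSpace ℝ ι)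
    (y : ℝ → EuclideanSpace ℝ κ) (A : ℝ → ℝ → ι → κ → ℝ) (s t : ℝ) : ℝ :=
  ∑ j, (f (x s) j * (y t j - y s j) +
    ∑ i, fderiv ℝ (fun p => f p j) (x s) (EuclideanSpace.single i 1) * A s t i j)

lemma fderiv_apply_eq_sum {ι : Type*} [Fintype ι] [DecidableEq ι]
    (L : EuclideanSpace ℝ ι →L[ℝ] ℝ) (w : EuclideanSpace ℝ ι) :
    L w = ∑ i, L (EuclideanSpace.single i 1) * w i := by
  have := (EuclideanSpace.basisFun ι ℝ).sum_repr w
  conv_lhs => rw [← this]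
  rw [map_sum]
  refine Finset.sum_congr rfl fun i _ => ?_
  rw [map_smul, smul_eq_mul, mul_comm, EuclideanSpace.basisFun_apply, EuclideanSpace.basisFun_repr]

lemma abs_apply_le_norm {ι κ : Type*} [Fintype ι] [Fintype κ] (A : ι → κ → ℝ) (i : ι) (j : κ) :
    |A i j| ≤ ‖A‖ :=
  (norm_le_pi_norm (A i) j).trans (norm_le_pi_norm A i)

section

variable {ι κ : Type*} [Fintype ι] [Fintype κ] {β a b : ℝ} {x : ℝ → EuclideanSpace ℝ ι}
  {y : ℝ → EuclideanSpace ℝ κ} {A : ℝ → ℝ → ι → κ → ℝ}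

namespace IsMultFunctional

lemma diag (h : IsMultFunctional β a b x y A) {s : ℝ} (h1 : a ≤ s) (h2 : s ≤ b) : A s s = 0 := by
  ext i j
  have := h.mult s s s h1 le_rfl le_rfl h2 i j
  simpa using this

lemma exists_bound (h : IsMultFunctional β a b x y A) (hβ : 0 < β) : ∃ C : ℝ, 0 ≤ C ∧
    (∀ s t, a ≤ s → s ≤ t → t ≤ b → ‖x t - x s‖ ≤ C * (t - s) ^ β) ∧
    (∀ s t, a ≤ s → s ≤ t → t ≤ b → ‖y t - y s‖ ≤ C * (t - s) ^ β) ∧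
    ∀ s t, a ≤ s → s ≤ t → t ≤ b → ‖A s t‖ ≤ C * (t - s) ^ (2 * β) := by
  obtain ⟨C₁, h1, hx⟩ := exists_holder_bound hβ.le h.holder_left
  obtain ⟨C₂, h2, hy⟩ := exists_holder_bound hβ.le h.holder_right
  obtain ⟨C₃, hA⟩ := h.bound
  have h3 := abs_nonneg C₃
  refine ⟨C₁ + C₂ + |C₃|, by positivity, fun s t hs hst ht => ?_, fun s t hs hst ht => ?_,
    fun s t hs hst ht => ?_⟩
  · have := hx s ⟨hs, hst.trans ht⟩ t ⟨hs.trans hst, ht⟩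
    rw [abs_of_nonneg (sub_nonneg.2 hst)] at this
    exact this.trans (mul_le_mul_of_nonneg_right (by linarith)
      (Real.rpow_nonneg (sub_nonneg.2 hst) _))
  · have := hy s ⟨hs, hst.trans ht⟩ t ⟨hs.trans hst, ht⟩
    rw [abs_of_nonneg (sub_nonneg.2 hst)] at this
    exact this.trans (mul_le_mul_of_nonneg_right (by linarith)
      (Real.rpow_nonneg (sub_nonneg.2 hst) _))
  · have h0 := Real.rpow_nonneg (sub_nonneg.2 hst) (2 * β)
    rcases hst.eq_or_lt with rfl | hst'
    · rw [h.diag hs ht, norm_zero]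
      positivity
    · exact (hA s t hs hst' ht).trans (mul_le_mul_of_nonneg_right
        (by linarith [le_abs_self C₃]) h0)

/-- Composition with the projection onto `[a, b]` freezes the functional outside the interval. The
constant is enlarged by a power of `max 1 (b - a)`, since the increments of the projection are at
most that multiple of the truncated increments. -/
lemma exists_stoppedRough (h : IsMultFunctional β a b x y A) (hβ : 0 < β) (hab : a ≤ b) :
    ∃ C : ℝ, (∀ j, CutHolder β C fun v => y (clampIcc a b v) j) ∧ ∀ i j,
      StoppedRough β C b (fun v => x (clampIcc a b v) i) (fun v => y (clampIcc a b v) j)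
        (fun s t => A (clampIcc a b s) (clampIcc a b t) i j) := by
  obtain ⟨C, hC, hx, hy, hA⟩ := h.exists_bound hβ
  set D := max 1 (b - a) with hD
  have hD1 : 1 ≤ D := le_max_left _ _
  have hD2 : D ^ β ≤ D ^ (2 * β) := Real.rpow_le_rpow_of_exponent_le hD1 (by linarith)
  have gen : ∀ {z s t p : ℝ}, s ≤ t → 0 ≤ p → D ^ p ≤ D ^ (2 * β) →
      z ≤ C * (clampIcc a b t - clampIcc a b s) ^ p →
      z ≤ C * D ^ (2 * β) * (min (t - s) 1) ^ p := by
    intro z s t p hst hp hDp hz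
    have h1 := clampIcc_sub_rpow_le hab hst hp
    have h2 : 0 ≤ (min (t - s) 1) ^ p :=
      Real.rpow_nonneg (le_min (sub_nonneg.2 hst) zero_le_one) _
    calc z ≤ C * (D ^ p * (min (t - s) 1) ^ p) := hz.trans (by gcongr)
      _ ≤ C * (D ^ (2 * β) * (min (t - s) 1) ^ p) := by gcongr
      _ = _ := by ring
  have hyj : ∀ j, CutHolder β (C * D ^ (2 * β)) fun v => y (clampIcc a b v) j := by
    intro j s t hst
    refine gen hst hβ.le hD2 (le_trans ?_ (hy _ _ (clampIcc_mem hab s).1 (clampIcc_mono hst)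
      (clampIcc_mem hab t).2))
    exact PiLp.norm_apply_le (y (clampIcc a b t) - y (clampIcc a b s)) j
  refine ⟨C * D ^ (2 * β), hyj, fun i j => ⟨?_, hyj j, ?_, ?_, ?_, ?_⟩⟩
  · intro s t hst
    refine gen hst hβ.le hD2 (le_trans ?_ (hx _ _ (clampIcc_mem hab s).1 (clampIcc_mono hst)
      (clampIcc_mem hab t).2))
    exact PiLp.norm_apply_le (x (clampIcc a b t) - x (clampIcc a b s)) i
  · intro s u t hsu hut
    exact h.mult _ _ _ (clampIcc_mem hab s).1 (clampIcc_mono hsu) (clampIcc_mono hut)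
      (clampIcc_mem hab t).2 i j
  · intro s t hst
    exact gen hst (by linarith) le_rfl ((abs_apply_le_norm _ i j).trans (hA _ _
      (clampIcc_mem hab s).1 (clampIcc_mono hst) (clampIcc_mem hab t).2))
  · intro s t ht
    rw [clampIcc_of_ge hab ht, clampIcc_of_ge hab le_rfl]
  · intro s t hs hst
    rw [clampIcc_of_ge hab hs, clampIcc_of_ge hab (hs.trans hst), h.diag hab le_rfl]
    rfl

end IsMultFunctional

variable [DecidableEq ι] {f : EuclideanSpace ℝ ι → κ → ℝ} {q : ℝ}

/-- The predictions from `s` and from `t` differ by the Taylor remainder between `t` and `s`, of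
order `q + β`, and by the change of the derivative times the increment of `x` after `s`, of order
`q` in `s - t` and `β` in `v - t`. -/
lemma IsControlled.exists_germBound (hf : IsControlled β q a b f x) (hβ : 0 < β) (hq : 0 < q)
    (hab : a ≤ b) {C : ℝ}
    (hx : ∀ i, CutHolder β C fun v => x (clampIcc a b v) i)
    (hx' : ∀ s t, a ≤ s → s ≤ t → t ≤ b → ‖x t - x s‖ ≤ C * (t - s) ^ β) (j : κ) :
    ∃ K, GermBound a b K q (q + β) (extrapolation (fun v => f (x (clampIcc a b v)) j)
        (fun i v => fderiv ℝ (fun p => f p j) (x (clampIcc a b v)) (EuclideanSpace.single i 1))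
        (fun i v => x (clampIcc a b v) i)) ∧
      ∀ i, GermBound a b K q q fun v _ =>
        fderiv ℝ (fun p => f p j) (x (clampIcc a b v)) (EuclideanSpace.single i 1) := by
  obtain ⟨C₁, h1, hR⟩ := hf.remainder
  obtain ⟨C₂, h2, hd⟩ := hf.deriv
  have hcl := continuous_clampIcc a b
  have hFc : Continuous fun v => f (x (clampIcc a b v)) j :=
    (hf.cont j).comp_continuous hcl (clampIcc_mem hab)
  have hdc : ∀ i, Continuous fun v =>
      fderiv ℝ (fun p => f p j) (x (clampIcc a b v)) (EuclideanSpace.single i 1) := fun i =>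
    (hf.cont_deriv i j).comp_continuous hcl (clampIcc_mem hab)
  have hxc : ∀ i, Continuous fun v => x (clampIcc a b v) i := fun i => (hx i).continuous hβ
  set N : ℝ := (Fintype.card ι : ℝ)
  have hN : 0 ≤ N := Nat.cast_nonneg _
  refine ⟨C₁ + (N + 1) * (C₂ * (|C| + 1)), ⟨by positivity, ?_, ?_⟩, fun i => ⟨by positivity, ?_, ?_⟩⟩
  · intro t s v hat hts hsv hvb
    have hs : s ∈ Icc a b := ⟨hat.trans hts, hsv.trans hvb⟩
    have ht : t ∈ Icc a b := ⟨hat, hts.trans hs.2⟩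
    have hv : v ∈ Icc a b := ⟨hs.1.trans hsv, hvb⟩
    simp only [extrapolation]
    rw [clampIcc_of_mem hs, clampIcc_of_mem ht, clampIcc_of_mem hv, add_sub_cancel_left]
    set G : ℝ → ι → ℝ := fun s i => fderiv ℝ (fun p => f p j) (x s) (EuclideanSpace.single i 1)
    have e : f (x s) j + ∑ i, G s i * (x v i - x s i) - (f (x t) j + ∑ i, G t i * (x v i - x t i)) =
        (f (x s) j - f (x t) j - fderiv ℝ (fun p => f p j) (x t) (x s - x t)) +
          ∑ i, (G s i - G t i) * (x v i - x s i) := by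
      have : ∀ i, G t i * (x v i - x t i) = G t i * (x s i - x t i) + G t i * (x v i - x s i) :=
        fun i => by ring
      rw [fderiv_apply_eq_sum]
      simp_rw [this, sub_mul]
      rw [Finset.sum_add_distrib, Finset.sum_sub_distrib]
      simp only [PiLp.sub_apply, G]
      ring
    have p0 : 0 ≤ (s - t) ^ q := Real.rpow_nonneg (sub_nonneg.2 hts) _
    have p1 : 0 ≤ (v - t) ^ β := Real.rpow_nonneg (by linarith) _
    have p2 : (s - t) ^ β ≤ (v - t) ^ β :=
      Real.rpow_le_rpow (by linarith) (by linarith) hβ.le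
    have p3 : (v - s) ^ β ≤ (v - t) ^ β :=
      Real.rpow_le_rpow (by linarith) (by linarith) hβ.le
    have p4 : 0 ≤ (v - s) ^ β := Real.rpow_nonneg (by linarith) _
    change |f (x s) j + ∑ i, G s i * (x v i - x s i) -
      (f (x t) j + ∑ i, G t i * (x v i - x t i))| ≤ _
    rw [e]
    have hsum : |∑ i, (G s i - G t i) * (x v i - x s i)| ≤
        N * (C₂ * (s - t) ^ q * ((|C| + 1) * (v - t) ^ β)) := by
      refine (Finset.abs_sum_le_sum_abs _ _).trans ?_
      have : ∀ i ∈ Finset.univ, |(G s i - G t i) * (x v i - x s i)| ≤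
          C₂ * (s - t) ^ q * ((|C| + 1) * (v - t) ^ β) := by
        intro i _
        rw [abs_mul]
        have hxi : |x v i - x s i| ≤ (|C| + 1) * (v - t) ^ β := by
          have h5 := (PiLp.norm_apply_le (x v - x s) i).trans (hx' s v hs.1 hsv hvb)
          refine h5.trans (mul_le_mul (by linarith [le_abs_self C]) p3 p4 (by positivity))
        exact mul_le_mul (hd i j t s hat hts hs.2) hxi (abs_nonneg _) (by positivity)
      refine (Finset.sum_le_sum this).trans ?_
      rw [Finset.sum_const, nsmul_eq_mul, Finset.card_univ]
    calc _ ≤ C₁ * (s - t) ^ (q + β) + N * (C₂ * (s - t) ^ q * ((|C| + 1) * (v - t) ^ β)) :=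
          (abs_add_le _ _).trans (add_le_add (hR j t s hat hts hs.2) hsum)
      _ ≤ C₁ * ((s - t) ^ q * (v - t) ^ β) +
          (N + 1) * (C₂ * (s - t) ^ q * ((|C| + 1) * (v - t) ^ β)) := by
          rw [Real.rpow_add_of_nonneg (sub_nonneg.2 hts) hq.le hβ.le]
          gcongr
          linarith
      _ = _ := by ring
  · have h5 : ∀ i, Continuous fun z : ℝ × ℝ => fderiv ℝ (fun p => f p j) (x (clampIcc a b z.1))
        (EuclideanSpace.single i 1) := fun i => (hdc i).comp continuous_fst
    have h6 : ∀ i, Continuous fun z : ℝ × ℝ => x (clampIcc a b z.1) i :=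
      fun i => (hxc i).comp continuous_fst
    have h7 : ∀ i, Continuous fun z : ℝ × ℝ => x (clampIcc a b z.2) i :=
      fun i => (hxc i).comp continuous_snd
    exact (hFc.comp continuous_fst).add (continuous_finsetSum _ fun i _ =>
      (h5 i).mul ((h7 i).sub (h6 i)))
  · intro t s v hat hts hsv hvb
    have hs : s ∈ Icc a b := ⟨hat.trans hts, hsv.trans hvb⟩
    have ht : t ∈ Icc a b := ⟨hat, hts.trans hs.2⟩
    rw [clampIcc_of_mem hs, clampIcc_of_mem ht, sub_self, Real.rpow_zero, mul_one]
    refine (hd i j t s hat hts hs.2).trans ?_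
    have p0 : 0 ≤ (s - t) ^ q := Real.rpow_nonneg (sub_nonneg.2 hts) _
    refine mul_le_mul_of_nonneg_right ?_ p0
    nlinarith [mul_nonneg hN (mul_nonneg h2 (abs_nonneg C)), mul_nonneg hN h2,
      mul_nonneg h2 (abs_nonneg C)]
  · exact (hdc i).comp continuous_fst

end

section

variable {ι κ : Type*} [Fintype ι] [Fintype κ] [DecidableEq ι] {β a b α q : ℝ}
  {x : ℝ → EuclideanSpace ℝ ι} {y : ℝ → EuclideanSpace ℝ κ} {A : ℝ → ℝ → ι → κ → ℝ}
  {f : EuclideanSpace ℝ ι → κ → ℝ}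

lemma compensatedLeft_eq {j : κ} {c v : ℝ} (hv : v ∈ Ioc a b) :
    compensatedLeft a c (fun p => f p j) x v = 1 / Real.Gamma (1 - c) *
      leftDeriv a c (extrapolation (fun v => f (x (clampIcc a b v)) j)
        (fun i v => fderiv ℝ (fun p => f p j) (x (clampIcc a b v)) (EuclideanSpace.single i 1))
        (fun i v => x (clampIcc a b v) i)) v := by
  have hvm : v ∈ Icc a b := ⟨hv.1.le, hv.2⟩
  rw [compensatedLeft, leftDeriv, Real.rpow_neg (sub_pos.2 hv.1).le, ← div_eq_mul_inv]
  congr 2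
  · simp [extrapolation, clampIcc_of_mem hvm]
  · congr 1
    refine intervalIntegral.integral_congr fun s hs => ?_
    rw [uIcc_of_le hv.1.le] at hs
    have hsm : s ∈ Icc a b := ⟨hs.1, hs.2.trans hv.2⟩
    simp only [extrapolation]
    rw [clampIcc_of_mem hvm, clampIcc_of_mem hsm, fderiv_apply_eq_sum, ← neg_add',
      Real.rpow_neg (sub_nonneg.2 hs.2), ← div_eq_mul_inv]
    congr 1
    simp only [PiLp.sub_apply, sub_self, mul_zero, Finset.sum_const_zero, add_zero]
    ring

lemma weylLeft_eq {g : ℝ → ℝ} {c v : ℝ} (hv : v ∈ Ioc a b) :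
    weylLeft a c g v = 1 / Real.Gamma (1 - c) *
      leftDeriv a c (fun s _ => g (clampIcc a b s)) v := by
  have hvm : v ∈ Icc a b := ⟨hv.1.le, hv.2⟩
  rw [weylLeft, leftDeriv, Real.rpow_neg (sub_pos.2 hv.1).le, ← div_eq_mul_inv,
    clampIcc_of_mem hvm]
  congr 3
  refine intervalIntegral.integral_congr fun s hs => ?_
  rw [uIcc_of_le hv.1.le] at hs
  have hsm : s ∈ Icc a b := ⟨hs.1, hs.2.trans hv.2⟩
  rw [clampIcc_of_mem hsm, ← neg_add', Real.rpow_neg (sub_nonneg.2 hs.2), ← div_eq_mul_inv]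

lemma tensorRight_congr {κ b v : ℝ} (hv : v ≤ b) {A A' : ℝ → ℝ → ℝ}
    (h : ∀ s ∈ Icc v b, A v s = A' v s) : tensorRight b κ A v = tensorRight b κ A' v := by
  unfold tensorRight
  rw [h b ⟨hv, le_rfl⟩]
  congr 3
  refine intervalIntegral.integral_congr fun s hs => ?_
  rw [uIcc_of_le hv] at hs
  rw [h s hs]

/-- The integral is a limit of Riemann sums of second order. -/
theorem exists_hnIntegral_riemann_bound (h : IsMultFunctional β a b x y A)
    (hf : IsControlled β q a b f x) (hα : 1 - β < α) (hβα : β < α) (hα1 : α < 1)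
    (hq : 2 * α - 1 < q) (hα2 : 1 / 2 < α) (hqα : α < q + β) (hab : a ≤ b) {L : ℝ} (hL : 0 ≤ L) :
    ∃ ε : ℕ → ℝ, Tendsto ε atTop (𝓝 0) ∧ ∀ n : ℕ, ∀ t : ℕ → ℝ, Monotone t → t 0 = a →
      t (n + 1) = b → (∀ j < n + 1, t (j + 1) - t j ≤ L / (n + 1 : ℕ)) →
      |hnIntegral α f x y A a b - ∑ k ∈ Finset.range (n + 1), hnGerm f x y A (t k) (t (k + 1))| ≤
        ε n := by
  -- The right-sided derivatives have order `θ = 1 - α`, and the hypothesis `1 - β < α` says that `θ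
  -- < β`.
  obtain ⟨θ, rfl⟩ : ∃ θ, α = 1 - θ := ⟨1 - α, by ring⟩
  have hθ : 0 < θ := by linarith
  have hθβ : θ < β := by linarith
  have hβ : 0 < β := hθ.trans hθβ
  obtain ⟨C, hy, hA⟩ := h.exists_stoppedRough hβ hab
  obtain ⟨C', _, hx', _, _⟩ := h.exists_bound hβ
  set F : κ → ℝ → ℝ := fun j v => f (x (clampIcc a b v)) j with hF
  set F' : κ → ι → ℝ → ℝ := fun j i v =>
    fderiv ℝ (fun p => f p j) (x (clampIcc a b v)) (EuclideanSpace.single i 1) with hF'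
  set X : ι → ℝ → ℝ := fun i v => x (clampIcc a b v) i with hX
  set Y : κ → ℝ → ℝ := fun j v => y (clampIcc a b v) j with hY
  set B : ι → κ → ℝ → ℝ → ℝ := fun i j s t => A (clampIcc a b s) (clampIcc a b t) i j with hB
  have hyb : ∀ j t, b ≤ t → Y j t = Y j b := by
    intro j t ht
    simp only [hY]
    rw [clampIcc_of_ge hab ht, clampIcc_of_ge hab le_rfl]
  have key : ∀ j, ∃ ε : ℕ → ℝ, Tendsto ε atTop (𝓝 0) ∧ ∀ n : ℕ, ∀ t : ℕ → ℝ, Monotone t →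
      t 0 = a → t (n + 1) = b → (∀ j < n + 1, t (j + 1) - t j ≤ L / (n + 1 : ℕ)) →
      |fracPairing a b θ (F j) (F' j) X (Y j) (fun i => B i j) - ∑ k ∈ Finset.range (n + 1),
        scalarGerm (F j) (F' j) (Y j) (fun i => B i j) (t k) (t (k + 1))| ≤ ε n := by
    intro j
    have hx : ∀ i, CutHolder β (max C C') fun v => x (clampIcc a b v) i := fun i s t hst =>
      ((hA i j).left s t hst).trans (mul_le_mul_of_nonneg_right (le_max_left _ _)
        (Real.rpow_nonneg (le_min (sub_nonneg.2 hst) zero_le_one) _))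
    obtain ⟨K, hP, hP'⟩ := hf.exists_germBound hβ (by linarith) hab hx
      (fun s t h1 h2 h3 => (hx' s t h1 h2 h3).trans (mul_le_mul_of_nonneg_right (le_max_right _ _)
        (Real.rpow_nonneg (sub_nonneg.2 h2) _))) j
    exact exists_riemann_bound hθ hθβ hβα (hy j) (hyb j) (fun i => hA i j) (by linarith)
      (by linarith) hP hP' hL
  choose ε hε hεb using key
  refine ⟨fun n => ∑ j, ε j n, ?_, ?_⟩
  · simpa using tendsto_finsetSum Finset.univ fun j _ => hε j
  intro n t ht ht0 htn hδ
  have htm : ∀ k ≤ n + 1, t k ∈ Icc a b := fun k hk =>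
    ⟨ht0 ▸ ht (Nat.zero_le k), htn ▸ ht hk⟩
  have hgerm : ∑ k ∈ Finset.range (n + 1), hnGerm f x y A (t k) (t (k + 1)) =
      ∑ j, ∑ k ∈ Finset.range (n + 1),
        scalarGerm (F j) (F' j) (Y j) (fun i => B i j) (t k) (t (k + 1)) := by
    rw [Finset.sum_comm]
    refine Finset.sum_congr rfl fun k hk => ?_
    have hk := Finset.mem_range.1 hk
    simp only [hnGerm, scalarGerm, hF, hF', hY, hB]
    rw [clampIcc_of_mem (htm k hk.le), clampIcc_of_mem (htm (k + 1) hk)]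
  -- All the derivatives in the formula see only values on `[a, b]`, where the projection is the
  -- identity. The prefactors `1 / Γ(θ)` and `1 / Γ(2θ)` come from the left-sided derivatives; those
  -- of the right-sided ones are part of `rightDeriv` and `tensorDeriv`.
  have hint : hnIntegral (1 - θ) f x y A a b =
      ∑ j, fracPairing a b θ (F j) (F' j) X (Y j) (fun i => B i j) := by
    simp only [fracPairing, hnIntegral]
    rw [Finset.sum_add_distrib, Finset.sum_neg_distrib, Finset.sum_comm]
    simp only [sub_sub_cancel]
    congr 1
    · congr 1
      refine Finset.sum_congr rfl fun j _ => ?_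
      rw [← intervalIntegral.integral_const_mul, intervalIntegral.integral_of_le hab,
        intervalIntegral.integral_of_le hab]
      refine setIntegral_congr_fun measurableSet_Ioc fun v hv => ?_
      rw [compensatedLeft_eq hv, sub_sub_cancel, mul_assoc]
      congr 2
      rw [← StoppedRough.weylRight_eq_rightDeriv (hy j) hθ hθβ (hyb j) hv.2]
      refine StoppedRough.weylRight_congr hv.2 fun s hs => ?_
      rw [clampIcc_of_mem ⟨hv.1.le.trans hs.1, hs.2⟩, clampIcc_of_mem ⟨hab, le_rfl⟩]
    · refine Finset.sum_congr rfl fun j _ => Finset.sum_congr rfl fun i _ => ?_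
      rw [← intervalIntegral.integral_const_mul, intervalIntegral.integral_of_le hab,
        intervalIntegral.integral_of_le hab]
      refine setIntegral_congr_fun measurableSet_Ioc fun v hv => ?_
      rw [weylLeft_eq hv, show 2 * (1 - θ) - 1 = 1 - (θ + θ) by ring, sub_sub_cancel, mul_assoc]
      congr 2
      rw [← (hA i j).weylRight_tensorRight_eq hθ hθβ hv.2]
      refine StoppedRough.weylRight_congr hv.2 fun s hs => ?_
      refine tensorRight_congr hs.2 fun u hu => ?_
      rw [clampIcc_of_mem ⟨hv.1.le.trans hs.1, hs.2⟩,
        clampIcc_of_mem ⟨(hv.1.le.trans hs.1).trans hu.1, hu.2⟩]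
  rw [hgerm, hint, ← Finset.sum_sub_distrib]
  exact (Finset.abs_sum_le_sum_abs _ _).trans (Finset.sum_le_sum fun j _ =>
    hεb j n t ht ht0 htn hδ)

end

/-! ### Limits of Riemann sums: uniqueness, additivity, sewing -/

/-- `I` is the limit of the Riemann sums of `Ξ` over partitions of `[s, t]` into `n` intervals of
length at most a constant times `1 / n`. -/
def IsRiemannLimit (Ξ : ℝ → ℝ → ℝ) (s t I : ℝ) : Prop :=
  ∀ L : ℝ, 0 ≤ L → ∃ ε : ℕ → ℝ, Tendsto ε atTop (𝓝 0) ∧ ∀ n : ℕ, ∀ τ : ℕ → ℝ, Monotone τ →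
    τ 0 = s → τ (n + 1) = t → (∀ j < n + 1, τ (j + 1) - τ j ≤ L / (n + 1 : ℕ)) →
    |I - ∑ k ∈ Finset.range (n + 1), Ξ (τ k) (τ (k + 1))| ≤ ε n

/-- The points of the partition of `[s, t]` into `n + 1` intervals of equal length. -/
def uniformPoint (s t : ℝ) (n k : ℕ) : ℝ := s + (t - s) * k / (n + 1 : ℕ)

lemma uniformPoint_mono {s t : ℝ} (h : s ≤ t) (n : ℕ) : Monotone (uniformPoint s t n) := by
  intro k l hkl
  unfold uniformPoint
  have : (k : ℝ) ≤ l := by exact_mod_cast hkl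
  have := sub_nonneg.2 h
  gcongr

lemma uniformPoint_zero (s t : ℝ) (n : ℕ) : uniformPoint s t n 0 = s := by simp [uniformPoint]

lemma uniformPoint_last (s t : ℝ) (n : ℕ) : uniformPoint s t n (n + 1) = t := by
  unfold uniformPoint
  have : ((n + 1 : ℕ) : ℝ) ≠ 0 := by positivity
  field_simp
  ring

lemma uniformPoint_sub (s t : ℝ) (n k : ℕ) :
    uniformPoint s t n (k + 1) - uniformPoint s t n k = (t - s) / (n + 1 : ℕ) := by
  unfold uniformPoint
  push_cast
  ring

/-- The Riemann sum over the partition into `n + 1` intervals of equal length. -/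
def uniformSum (Ξ : ℝ → ℝ → ℝ) (s t : ℝ) (n : ℕ) : ℝ :=
  ∑ k ∈ Finset.range (n + 1), Ξ (uniformPoint s t n k) (uniformPoint s t n (k + 1))

namespace IsRiemannLimit

variable {Ξ Ξ' : ℝ → ℝ → ℝ} {s u t I I₁ I₂ I' : ℝ}

lemma tendsto_uniformSum (h : IsRiemannLimit Ξ s t I) (hst : s ≤ t) :
    Tendsto (uniformSum Ξ s t) atTop (𝓝 I) := by
  obtain ⟨ε, hε, hb⟩ := h (t - s) (sub_nonneg.2 hst)
  rw [tendsto_iff_norm_sub_tendsto_zero]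
  refine squeeze_zero (fun _ => norm_nonneg _) (fun n => ?_) hε
  rw [norm_sub_rev]
  exact hb n _ (uniformPoint_mono hst n) (uniformPoint_zero s t n) (uniformPoint_last s t n)
    (fun j _ => (uniformPoint_sub s t n j).le)

lemma congr (h : IsRiemannLimit Ξ s t I)
    (he : ∀ u v, s ≤ u → u ≤ v → v ≤ t → Ξ u v = Ξ' u v) : IsRiemannLimit Ξ' s t I := by
  intro L hL
  obtain ⟨ε, hε, hb⟩ := h L hL
  refine ⟨ε, hε, fun n τ hτ h0 hn hm => ?_⟩
  rw [← Finset.sum_congr rfl fun k hk => ?_]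
  · exact hb n τ hτ h0 hn hm
  · exact he _ _ (h0 ▸ hτ (Nat.zero_le k)) (hτ (Nat.le_succ k))
      (hn ▸ hτ (Finset.mem_range.1 hk))

lemma unique (h : IsRiemannLimit Ξ s t I) (h' : IsRiemannLimit Ξ s t I') (hst : s ≤ t) : I = I' :=
  tendsto_nhds_unique (h.tendsto_uniformSum hst) (h'.tendsto_uniformSum hst)

lemma const_mul_add (h : IsRiemannLimit Ξ s t I) (h' : IsRiemannLimit Ξ' s t I') (c : ℝ) :
    IsRiemannLimit (fun u v => c * Ξ u v + Ξ' u v) s t (c * I + I') := by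
  intro L hL
  obtain ⟨ε, hε, hb⟩ := h L hL
  obtain ⟨ε', hε', hb'⟩ := h' L hL
  refine ⟨fun n => |c| * ε n + ε' n, by simpa using (hε.const_mul |c|).add hε',
    fun n τ hτ h0 hn hm => ?_⟩
  rw [Finset.sum_add_distrib, ← Finset.mul_sum]
  set X := ∑ k ∈ Finset.range (n + 1), Ξ (τ k) (τ (k + 1))
  set X' := ∑ k ∈ Finset.range (n + 1), Ξ' (τ k) (τ (k + 1))
  calc |c * I + I' - (c * X + X')| = |c * (I - X) + (I' - X')| := by ring_nf
    _ ≤ |c| * |I - X| + |I' - X'| := by rw [← abs_mul]; exact abs_add_le _ _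
    _ ≤ _ := by
      have h1 := hb n τ hτ h0 hn hm
      have h2 := hb' n τ hτ h0 hn hm
      exact add_le_add (mul_le_mul_of_nonneg_left h1 (abs_nonneg _)) h2

lemma comp_sub (h : IsRiemannLimit Ξ s t I) (r : ℝ) :
    IsRiemannLimit (fun u v => Ξ (u - r) (v - r)) (s + r) (t + r) I := by
  intro L hL
  obtain ⟨ε, hε, hb⟩ := h L hL
  refine ⟨ε, hε, fun n τ hτ h0 hn hm => ?_⟩
  exact hb n (fun k => τ k - r) (fun k l hkl => sub_le_sub_right (hτ hkl) r) (by simp [h0])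
    (by simp [hn]) (fun j hj => by simpa using hm j hj)

/-- Limits of Riemann sums are additive in the interval. -/
lemma add_adjacent (h : IsRiemannLimit Ξ s t I) (h₁ : IsRiemannLimit Ξ s u I₁)
    (h₂ : IsRiemannLimit Ξ u t I₂) (hsu : s ≤ u) (hut : u ≤ t) : I₁ + I₂ = I := by
  -- Two uniform partitions with `n + 1` intervals each join to one with `2 * n + 2` intervals that
  -- need not be uniform. Its mesh is at most `2 * (t - s) / (2 * n + 2)`; this is why the
  -- definition admits an arbitrary factor `L`.
  obtain ⟨ε, hε, hb⟩ := h (2 * (t - s)) (by linarith)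
  have hlim := (h₁.tendsto_uniformSum hsu).add (h₂.tendsto_uniformSum hut)
  refine tendsto_nhds_unique hlim ?_
  rw [tendsto_iff_norm_sub_tendsto_zero]
  have hε' : Tendsto (fun n : ℕ => ε (2 * n + 1)) atTop (𝓝 0) :=
    hε.comp (tendsto_atTop_mono (fun n => by simp only [id]; omega) tendsto_id)
  refine squeeze_zero (fun _ => norm_nonneg _) (fun n => ?_) hε'
  set τ : ℕ → ℝ := fun k => if k ≤ n + 1 then uniformPoint s u n k
    else uniformPoint u t n (k - (n + 1)) with hτ
  have hτ1 : ∀ k ≤ n + 1, τ k = uniformPoint s u n k := fun k hk => if_pos hk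
  have hτ2 : ∀ k, τ (n + 1 + k) = uniformPoint u t n k := by
    intro k
    rcases Nat.eq_zero_or_pos k with rfl | hk
    · rw [add_zero, hτ1 _ le_rfl, uniformPoint_last, uniformPoint_zero]
    · simp only [hτ]
      rw [if_neg (by omega), Nat.add_sub_cancel_left]
  have hmono : Monotone τ := by
    refine monotone_nat_of_le_succ fun k => ?_
    rcases lt_or_ge k (n + 1) with hk | hk
    · rw [hτ1 k hk.le, hτ1 (k + 1) hk]
      exact uniformPoint_mono hsu n (Nat.le_succ k)
    · obtain ⟨l, rfl⟩ := Nat.exists_eq_add_of_le hk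
      rw [hτ2, add_assoc, hτ2]
      exact uniformPoint_mono hut n (Nat.le_succ l)
  have h2n : 2 * n + 1 + 1 = n + 1 + (n + 1) := by ring
  have hmesh : ∀ j < 2 * n + 1 + 1, τ (j + 1) - τ j ≤ 2 * (t - s) / (2 * n + 1 + 1 : ℕ) := by
    intro j _
    have e : 2 * (t - s) / (2 * n + 1 + 1 : ℕ) = (t - s) / (n + 1 : ℕ) := by
      push_cast
      rw [show (2 : ℝ) * n + 1 + 1 = 2 * (n + 1) by ring, mul_div_mul_left _ _ two_ne_zero]
    rw [e]
    rcases lt_or_ge j (n + 1) with hk | hk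
    · rw [hτ1 j hk.le, hτ1 (j + 1) hk, uniformPoint_sub]
      gcongr
    · obtain ⟨l, rfl⟩ := Nat.exists_eq_add_of_le hk
      rw [hτ2, add_assoc, hτ2, uniformPoint_sub]
      gcongr
  have := hb (2 * n + 1) τ hmono (by rw [hτ1 0 (by omega), uniformPoint_zero])
    (by rw [h2n, hτ2, uniformPoint_last]) hmesh
  rw [h2n, Finset.sum_range_add] at this
  rw [norm_sub_rev, Real.norm_eq_abs]
  convert this using 3
  congr 1
  · refine Finset.sum_congr rfl fun k hk => ?_
    have hk := Finset.mem_range.1 hk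
    rw [hτ1 k hk.le, hτ1 (k + 1) hk]
  · refine Finset.sum_congr rfl fun k hk => ?_
    rw [hτ2, add_assoc, hτ2]

end IsRiemannLimit

lemma sum_range_two_mul (g : ℕ → ℝ) (N : ℕ) :
    ∑ k ∈ Finset.range (2 * N), g k = ∑ k ∈ Finset.range N, (g (2 * k) + g (2 * k + 1)) := by
  induction N with
  | zero => simp
  | succ N ih =>
    rw [mul_add, mul_one, Finset.sum_range_succ, Finset.sum_range_succ, ih, Finset.sum_range_succ]
    ring

/-- The sewing estimate: a limit of Riemann sums is close to a single summand. -/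
lemma IsRiemannLimit.abs_sub_le {Ξ : ℝ → ℝ → ℝ} {s t I K θ : ℝ} (h : IsRiemannLimit Ξ s t I)
    (hst : s ≤ t) (hθ : 1 < θ)
    (hΞ : ∀ u v w, s ≤ u → u ≤ v → v ≤ w → w ≤ t → |Ξ u w - Ξ u v - Ξ v w| ≤ K * (w - u) ^ θ) :
    |I - Ξ s t| ≤ K / (1 - 2 ^ (1 - θ)) * (t - s) ^ θ := by
  set r : ℝ := 2 ^ (1 - θ) with hr
  have hr0 : 0 < r := Real.rpow_pos_of_pos two_pos _
  have hr1 : r < 1 := Real.rpow_lt_one_of_one_lt_of_neg one_lt_two (by linarith)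
  -- Dyadic sums suffice. Inserting the midpoints at level `m` costs at most `2 ^ m * K * ((t - s) /
  -- 2 ^ m) ^ θ`, a geometric sequence of ratio `2 ^ (1 - θ) < 1`.
  set S : ℕ → ℝ := fun m => ∑ k ∈ Finset.range (2 ^ m),
    Ξ (s + (t - s) * k / 2 ^ m) (s + (t - s) * (k + 1 : ℕ) / 2 ^ m) with hS
  set W := K * (t - s) ^ θ with hW
  have hts : 0 ≤ t - s := sub_nonneg.2 hst
  have hstep : ∀ m, |S (m + 1) - S m| ≤ W * r ^ m := by
    intro m
    simp only [hS]
    rw [pow_succ', sum_range_two_mul]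
    simp only [pow_succ' (2 : ℝ) m]
    rw [← Finset.sum_sub_distrib]
    have hk : ∀ k ∈ Finset.range (2 ^ m),
        |Ξ (s + (t - s) * (2 * k : ℕ) / (2 * 2 ^ m)) (s + (t - s) * (2 * k + 1 : ℕ) / (2 * 2 ^ m)) +
          Ξ (s + (t - s) * (2 * k + 1 : ℕ) / (2 * 2 ^ m))
            (s + (t - s) * (2 * k + 1 + 1 : ℕ) / (2 * 2 ^ m)) -
          Ξ (s + (t - s) * k / 2 ^ m) (s + (t - s) * (k + 1 : ℕ) / 2 ^ m)| ≤
          K * ((t - s) / 2 ^ m) ^ θ := by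
      intro k hk
      have hk := Finset.mem_range.1 hk
      have e1 : s + (t - s) * (2 * k : ℕ) / (2 * 2 ^ m) = s + (t - s) * k / 2 ^ m := by
        push_cast; field_simp
      have e2 : s + (t - s) * (2 * k + 1 + 1 : ℕ) / (2 * 2 ^ m) =
          s + (t - s) * (k + 1 : ℕ) / 2 ^ m := by
        push_cast; field_simp; ring
      rw [e1, e2, abs_sub_comm, ← sub_sub]
      have hk' : ((k + 1 : ℕ) : ℝ) ≤ 2 ^ m := by exact_mod_cast hk
      have e3 : s + (t - s) * (k + 1 : ℕ) / 2 ^ m - (s + (t - s) * k / 2 ^ m) =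
          (t - s) / 2 ^ m := by push_cast; ring
      have := hΞ (s + (t - s) * k / 2 ^ m) (s + (t - s) * (2 * k + 1 : ℕ) / (2 * 2 ^ m))
        (s + (t - s) * (k + 1 : ℕ) / 2 ^ m) ?_ ?_ ?_ ?_
      · rwa [e3] at this
      · have : 0 ≤ (t - s) * k / 2 ^ m := by positivity
        linarith
      · rw [← e1]
        gcongr
        omega
      · rw [← e2]
        gcongr
        omega
      · have : (t - s) * (k + 1 : ℕ) / 2 ^ m ≤ t - s := by
          rw [div_le_iff₀ (by positivity)]
          exact mul_le_mul_of_nonneg_left hk' hts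
        linarith
    refine (Finset.abs_sum_le_sum_abs _ _).trans ((Finset.sum_le_sum hk).trans (le_of_eq ?_))
    rw [Finset.sum_const, Finset.card_range, nsmul_eq_mul, Real.div_rpow hts (by positivity), hW, hr]
    have e : ((2 : ℝ) ^ (1 - θ)) ^ m = (2 ^ m : ℝ) / (2 ^ m : ℝ) ^ θ := by
      rw [← Real.rpow_natCast, ← Real.rpow_natCast, ← Real.rpow_mul two_pos.le, ← Real.rpow_mul two_pos.le, ← Real.rpow_sub two_pos]
      congr 1; ring
    rw [e]
    push_cast
    ring
  have hS0 : S 0 = Ξ s t := by simp [hS]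
  have hW0 : 0 ≤ W := by
    have := (abs_nonneg _).trans (hstep 0)
    simpa using this
  have hbound : ∀ m, |S m - Ξ s t| ≤ W * ∑ k ∈ Finset.range m, r ^ k := by
    intro m
    induction m with
    | zero => simp [hS0]
    | succ m ih =>
      rw [Finset.sum_range_succ, mul_add]
      calc |S (m + 1) - Ξ s t| = |(S m - Ξ s t) + (S (m + 1) - S m)| := by ring_nf
        _ ≤ _ := (abs_add_le _ _).trans (add_le_add ih (hstep m))
  have hgeo : ∀ m, |S m - Ξ s t| ≤ W / (1 - r) := by
    intro m
    refine (hbound m).trans ?_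
    rw [div_eq_mul_inv]
    refine mul_le_mul_of_nonneg_left ?_ hW0
    rw [← tsum_geometric_of_lt_one hr0.le hr1]
    exact (summable_geometric_of_lt_one hr0.le hr1).sum_le_tsum _ fun _ _ => by positivity
  have hlim : Tendsto S atTop (𝓝 I) := by
    -- The sum over `2 ^ m` intervals is `uniformSum` at the index `2 ^ m - 1`.
    have h1 := (h.tendsto_uniformSum hst).comp
      (tendsto_atTop_mono (fun m : ℕ => (Nat.le_sub_one_of_lt (Nat.lt_two_pow_self (n := m))))
        tendsto_id)
    refine h1.congr fun m => ?_
    have e : 2 ^ m - 1 + 1 = 2 ^ m := Nat.sub_add_cancel Nat.one_le_two_pow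
    simp only [Function.comp, uniformSum, uniformPoint, hS]
    rw [e]
    push_cast
    rfl
  have := le_of_tendsto ((hlim.sub_const (Ξ s t)).abs) (Eventually.of_forall hgeo)
  calc _ ≤ W / (1 - r) := this
    _ = _ := by rw [hW]; ring

/-! ### Exponents, and additivity and estimates of the integral -/

/-- The relations between the exponents `α`, `β` and `q = γ β`. -/
structure Exponents (α β q : ℝ) : Prop where
  beta_lt : β < 1 / 2
  one_sub_lt : 1 - β < α
  lt_one : α < 1
  two_mul_sub_lt : 2 * α - 1 < q
  le_beta : q ≤ β

namespace Exponents

variable {α β q : ℝ}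

lemma beta_pos (h : Exponents α β q) : 0 < β := by linarith [h.one_sub_lt, h.lt_one]
lemma half_lt (h : Exponents α β q) : 1 / 2 < α := by linarith [h.one_sub_lt, h.beta_lt]
lemma q_pos (h : Exponents α β q) : 0 < q := by linarith [h.half_lt, h.two_mul_sub_lt]
lemma beta_lt_alpha (h : Exponents α β q) : β < α := by linarith [h.half_lt, h.beta_lt]
lemma alpha_lt (h : Exponents α β q) : α < q + β := by linarith [h.two_mul_sub_lt, h.one_sub_lt]
-- This is the condition for sewing: the additivity defect of the second-order summand has order `q
-- + 2 * β`.
lemma one_lt (h : Exponents α β q) : 1 < q + 2 * β := by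
  linarith [h.two_mul_sub_lt, h.one_sub_lt]

end Exponents

lemma exponents_of_hyp {α β γ : ℝ} (hβ : β ∈ Set.Ioo (1 / 3 : ℝ) (1 / 2)) (hγ_one : γ ≤ 1)
    (hα : 1 - β < α) (hα_two : α < 2 * β) (hα_holder : α < (γ * β + 1) / 2) :
    Exponents α β (γ * β) where
  beta_lt := hβ.2
  one_sub_lt := hα
  lt_one := by linarith [hβ.2]
  two_mul_sub_lt := by linarith
  le_beta := by nlinarith [hβ.1]

section

variable {ι κ : Type*} [Fintype ι] [Fintype κ] [DecidableEq ι] {α β a b q : ℝ}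
  {x : ℝ → EuclideanSpace ℝ ι} {y : ℝ → EuclideanSpace ℝ κ} {A : ℝ → ℝ → ι → κ → ℝ}
  {f : EuclideanSpace ℝ ι → κ → ℝ}

lemma IsMultFunctional.mono (h : IsMultFunctional β a b x y A) {a' b' : ℝ} (ha : a ≤ a')
    (hb : b' ≤ b) : IsMultFunctional β a' b' x y A where
  holder_left := h.holder_left.imp fun _ hC => hC.mono (Icc_subset_Icc ha hb)
  holder_right := h.holder_right.imp fun _ hC => hC.mono (Icc_subset_Icc ha hb)
  continuousOn := h.continuousOn.mono fun _ hp => ⟨ha.trans hp.1, hp.2.1, hp.2.2.trans hb⟩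
  mult s u t hs hsu hut ht := h.mult s u t (ha.trans hs) hsu hut (ht.trans hb)
  bound := h.bound.imp fun _ hc s t hs hst ht => hc s t (ha.trans hs) hst (ht.trans hb)

lemma IsControlled.mono (h : IsControlled β q a b f x) {a' b' : ℝ} (ha : a ≤ a')
    (hb : b' ≤ b) : IsControlled β q a' b' f x where
  cont j := (h.cont j).mono (Icc_subset_Icc ha hb)
  cont_deriv i j := (h.cont_deriv i j).mono (Icc_subset_Icc ha hb)
  remainder := h.remainder.imp fun _ hC =>
    ⟨hC.1, fun j s v hs hsv hv => hC.2 j s v (ha.trans hs) hsv (hv.trans hb)⟩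
  deriv := h.deriv.imp fun _ hC =>
    ⟨hC.1, fun i j s v hs hsv hv => hC.2 i j s v (ha.trans hs) hsv (hv.trans hb)⟩

theorem isRiemannLimit_hnIntegral (hE : Exponents α β q) (h : IsMultFunctional β a b x y A)
    (hf : IsControlled β q a b f x) {s t : ℝ} (hs : a ≤ s) (hst : s ≤ t) (ht : t ≤ b) :
    IsRiemannLimit (hnGerm f x y A) s t (hnIntegral α f x y A s t) := fun _ hL =>
  exists_hnIntegral_riemann_bound (h.mono hs ht) (hf.mono hs ht) hE.one_sub_lt hE.beta_lt_alpha
    hE.lt_one hE.two_mul_sub_lt hE.half_lt hE.alpha_lt hst hL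

/-- The fractional formula depends on both end points of the interval, so additivity cannot be read
off from it; it is inherited from the Riemann sums. -/
lemma hnIntegral_add_adjacent (hE : Exponents α β q) (h : IsMultFunctional β a b x y A)
    (hf : IsControlled β q a b f x) {s u t : ℝ} (hs : a ≤ s) (hsu : s ≤ u) (hut : u ≤ t)
    (ht : t ≤ b) :
    hnIntegral α f x y A s u + hnIntegral α f x y A u t = hnIntegral α f x y A s t :=
  (isRiemannLimit_hnIntegral hE h hf hs (hsu.trans hut) ht).add_adjacent
    (isRiemannLimit_hnIntegral hE h hf hs hsu (hut.trans ht))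
    (isRiemannLimit_hnIntegral hE h hf (hs.trans hsu) hut ht) hsu hut

/-- The multiplicative property cancels the first-order terms. What is left is the Taylor remainder
times an increment of `y`, and the change of the derivative times a tensor. -/
lemma hnGerm_sub_sub (h : IsMultFunctional β a b x y A) {s u t : ℝ} (hs : a ≤ s) (hsu : s ≤ u)
    (hut : u ≤ t) (ht : t ≤ b) :
    hnGerm f x y A s t - hnGerm f x y A s u - hnGerm f x y A u t =
      -∑ j, ((f (x u) j - f (x s) j - fderiv ℝ (fun p => f p j) (x s) (x u - x s)) *
        (y t j - y u j) + ∑ i, (fderiv ℝ (fun p => f p j) (x u) (EuclideanSpace.single i 1) -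
          fderiv ℝ (fun p => f p j) (x s) (EuclideanSpace.single i 1)) * A u t i j) := by
  simp only [hnGerm]
  rw [← Finset.sum_sub_distrib, ← Finset.sum_sub_distrib, ← Finset.sum_neg_distrib]
  refine Finset.sum_congr rfl fun j _ => ?_
  rw [fderiv_apply_eq_sum]
  set G : ℝ → ι → ℝ := fun s i => fderiv ℝ (fun p => f p j) (x s) (EuclideanSpace.single i 1)
  change f (x s) j * (y t j - y s j) + ∑ i, G s i * A s t i j - (f (x s) j * (y u j - y s j) +
    ∑ i, G s i * A s u i j) - (f (x u) j * (y t j - y u j) + ∑ i, G u i * A u t i j) =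
    -((f (x u) j - f (x s) j - ∑ i, G s i * (x u i - x s i)) * (y t j - y u j) +
      ∑ i, (G u i - G s i) * A u t i j)
  have : ∀ i, G s i * A s t i j = G s i * A s u i j + G s i * A u t i j +
      G s i * (x u i - x s i) * (y t j - y u j) := by
    intro i
    rw [← h.mult s u t hs hsu hut ht i j]; ring
  simp_rw [this, sub_mul]
  rw [Finset.sum_add_distrib, Finset.sum_add_distrib, Finset.sum_sub_distrib, ← Finset.sum_mul]
  ring

lemma abs_y_sub_le {C p s t : ℝ} {y : ℝ → EuclideanSpace ℝ κ}
    (h : ‖y t - y s‖ ≤ C * (t - s) ^ p) (j : κ) : |y t j - y s j| ≤ C * (t - s) ^ p :=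
  (PiLp.norm_apply_le (y t - y s) j).trans h

lemma exists_hnGerm_sub_le (hE : Exponents α β q) (h : IsMultFunctional β a b x y A)
    (hf : IsControlled β q a b f x) : ∃ K : ℝ, 0 ≤ K ∧ ∀ s u t, a ≤ s → s ≤ u → u ≤ t → t ≤ b →
      |hnGerm f x y A s t - hnGerm f x y A s u - hnGerm f x y A u t| ≤
        K * (t - s) ^ (q + 2 * β) := by
  obtain ⟨C, hC, -, hy, hA⟩ := h.exists_bound hE.beta_pos
  obtain ⟨C₁, h1, hR⟩ := hf.remainder
  obtain ⟨C₂, h2, hd⟩ := hf.deriv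
  refine ⟨∑ _j : κ, (C₁ * C + ∑ _i : ι, C₂ * C), by positivity, fun s u t hs hsu hut ht => ?_⟩
  have hq := hE.q_pos
  have hβ := hE.beta_pos
  rw [hnGerm_sub_sub h hs hsu hut ht, abs_neg]
  rw [Finset.sum_mul]
  refine (Finset.abs_sum_le_sum_abs _ _).trans (Finset.sum_le_sum fun j _ => ?_)
  have a1 : (u - s) ^ (q + β) ≤ (t - s) ^ (q + β) :=
    Real.rpow_le_rpow (by linarith) (by linarith) (by linarith)
  have a2 : (t - u) ^ β ≤ (t - s) ^ β := Real.rpow_le_rpow (by linarith) (by linarith) hβ.le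
  have a3 : (u - s) ^ q ≤ (t - s) ^ q := Real.rpow_le_rpow (by linarith) (by linarith) hq.le
  have a4 : (t - u) ^ (2 * β) ≤ (t - s) ^ (2 * β) :=
    Real.rpow_le_rpow (by linarith) (by linarith) (by linarith)
  have hts : 0 ≤ t - s := by linarith
  have e1 : (t - s) ^ (q + 2 * β) = (t - s) ^ (q + β) * (t - s) ^ β := by
    rw [← Real.rpow_add_of_nonneg hts (by linarith) hβ.le]; congr 1; ring
  have e2 : (t - s) ^ (q + 2 * β) = (t - s) ^ q * (t - s) ^ (2 * β) := by
    rw [← Real.rpow_add_of_nonneg hts hq.le (by linarith)]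
  rw [add_mul, Finset.sum_mul]
  refine (abs_add_le _ _).trans (add_le_add ?_ ((Finset.abs_sum_le_sum_abs _ _).trans
    (Finset.sum_le_sum fun i _ => ?_)))
  · rw [abs_mul, e1]
    calc _ ≤ (C₁ * (u - s) ^ (q + β)) * (C * (t - u) ^ β) :=
          mul_le_mul (hR j s u hs hsu (hut.trans ht))
            (abs_y_sub_le (hy u t (hs.trans hsu) hut ht) j) (abs_nonneg _)
            (mul_nonneg h1 (Real.rpow_nonneg (by linarith) _))
      _ ≤ (C₁ * (t - s) ^ (q + β)) * (C * (t - s) ^ β) := by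
          have := Real.rpow_nonneg (by linarith : 0 ≤ t - u) β
          gcongr
      _ = _ := by ring
  · rw [abs_mul, e2]
    calc _ ≤ (C₂ * (u - s) ^ q) * (C * (t - u) ^ (2 * β)) :=
          mul_le_mul (hd i j s u hs hsu (hut.trans ht))
            ((abs_apply_le_norm _ i j).trans (hA u t (hs.trans hsu) hut ht)) (abs_nonneg _)
            (mul_nonneg h2 (Real.rpow_nonneg (by linarith) _))
      _ ≤ (C₂ * (t - s) ^ q) * (C * (t - s) ^ (2 * β)) := by
          have := Real.rpow_nonneg (by linarith : 0 ≤ t - u) (2 * β)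
          gcongr
      _ = _ := by ring

/-- The integral over a short interval is close to its second-order Riemann summand. -/
theorem exists_abs_hnIntegral_sub_hnGerm_le (hE : Exponents α β q)
    (h : IsMultFunctional β a b x y A) (hf : IsControlled β q a b f x) :
    ∃ K : ℝ, 0 ≤ K ∧ ∀ s t, a ≤ s → s ≤ t → t ≤ b →
      |hnIntegral α f x y A s t - hnGerm f x y A s t| ≤ K * (t - s) ^ (q + 2 * β) := by
  obtain ⟨K, hK, hb⟩ := exists_hnGerm_sub_le hE h hf
  have hr : (2 : ℝ) ^ (1 - (q + 2 * β)) < 1 :=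
    Real.rpow_lt_one_of_one_lt_of_neg one_lt_two (by linarith [hE.one_lt])
  refine ⟨K / (1 - 2 ^ (1 - (q + 2 * β))), div_nonneg hK (by linarith), fun s t hs hst ht => ?_⟩
  exact (isRiemannLimit_hnIntegral hE h hf hs hst ht).abs_sub_le hst hE.one_lt
    fun u v w hu huv hvw hw => hb u v w (hs.trans hu) huv hvw (hw.trans ht)

lemma exists_abs_hnGerm_le (hβ : 0 < β) (h : IsMultFunctional β a b x y A)
    (hf : IsControlled β q a b f x) : ∃ K : ℝ, 0 ≤ K ∧ ∀ s t, a ≤ s → s ≤ t → t ≤ b →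
      |hnGerm f x y A s t| ≤ K * (t - s) ^ β := by
  obtain ⟨C, hC, -, hy, hA⟩ := h.exists_bound hβ
  choose M hM using fun j => isCompact_Icc.exists_bound_of_continuousOn (hf.cont j)
  choose N hN using fun i j => isCompact_Icc.exists_bound_of_continuousOn (hf.cont_deriv i j)
  refine ⟨∑ j, (|M j| * C + ∑ i, |N i j| * (C * |b - a| ^ β)), by positivity, fun s t hs hst ht => ?_⟩
  have hts : 0 ≤ t - s := by linarith
  have hs' : s ∈ Icc a b := ⟨hs, hst.trans ht⟩
  rw [hnGerm, Finset.sum_mul]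
  refine (Finset.abs_sum_le_sum_abs _ _).trans (Finset.sum_le_sum fun j _ => ?_)
  rw [add_mul, Finset.sum_mul]
  have p0 := Real.rpow_nonneg hts β
  refine (abs_add_le _ _).trans (add_le_add ?_ ((Finset.abs_sum_le_sum_abs _ _).trans
    (Finset.sum_le_sum fun i _ => ?_)))
  · rw [abs_mul, mul_assoc]
    exact mul_le_mul (((hM j s hs')).trans (le_abs_self _)) (abs_y_sub_le (hy s t hs hst ht) j)
      (abs_nonneg _) (abs_nonneg _)
  · rw [abs_mul, mul_assoc]
    refine mul_le_mul ((hN i j s hs').trans (le_abs_self _)) ?_ (abs_nonneg _) (abs_nonneg _)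
    refine ((abs_apply_le_norm _ i j).trans (hA s t hs hst ht)).trans ?_
    rw [two_mul, Real.rpow_add_of_nonneg hts hβ.le hβ.le, mul_assoc]
    have : (t - s) ^ β ≤ |b - a| ^ β :=
      Real.rpow_le_rpow hts ((by linarith : t - s ≤ b - a).trans (le_abs_self _)) hβ.le
    gcongr

end

/-! ### Smooth functions of Hölder paths as integrands -/

section

variable {d m : ℕ} {γ β a b : ℝ} {σ : EuclideanSpace ℝ (Fin d) → Fin d → Fin m → ℝ}

namespace DiffusionHyp

lemma differentiable (hσ : DiffusionHyp γ σ) (k : Fin d) (j : Fin m) :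
    Differentiable ℝ fun p => σ p k j :=
  fun p => differentiableAt_pi.1 (differentiableAt_pi.1
    (hσ.contDiff.differentiable one_ne_zero p) k) j

lemma fderiv_apply (hσ : DiffusionHyp γ σ) (k : Fin d) (j : Fin m) (p h) :
    fderiv ℝ (fun p => σ p k j) p h = fderiv ℝ σ p h k j := by
  have h1 := (hσ.contDiff.differentiable one_ne_zero p).hasFDerivAt
  rw [(hasFDerivAt_pi'.1 (hasFDerivAt_pi'.1 h1 k) j).fderiv]
  rfl

lemma norm_fderiv_sub_le (hσ : DiffusionHyp γ σ) (k : Fin d) (j : Fin m) (p p') :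
    ‖fderiv ℝ (fun p => σ p k j) p' - fderiv ℝ (fun p => σ p k j) p‖ ≤
      ‖fderiv ℝ σ p' - fderiv ℝ σ p‖ := by
  refine ContinuousLinearMap.opNorm_le_bound _ (norm_nonneg _) fun h => ?_
  rw [sub_apply, hσ.fderiv_apply, hσ.fderiv_apply]
  refine le_trans ?_ ((fderiv ℝ σ p' - fderiv ℝ σ p).le_opNorm h)
  exact abs_apply_le_norm ((fderiv ℝ σ p' - fderiv ℝ σ p) h) k j

/-- The Taylor estimate follows from the Hölder estimate by the mean value inequality on the segment
from `p` to `p'`, which stays in the ball by convexity. -/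
lemma exists_norm_fderiv_sub_le (hσ : DiffusionHyp γ σ) (hγ : 0 < γ) (N : ℝ) (k : Fin d) :
    ∃ C : ℝ, 0 ≤ C ∧ ∀ j, ∀ p ∈ Metric.closedBall (0 : EuclideanSpace ℝ (Fin d)) N,
      ∀ p' ∈ Metric.closedBall (0 : EuclideanSpace ℝ (Fin d)) N,
      ‖fderiv ℝ (fun p => σ p k j) p' - fderiv ℝ (fun p => σ p k j) p‖ ≤ C * ‖p' - p‖ ^ γ ∧
      |σ p' k j - σ p k j - fderiv ℝ (fun p => σ p k j) p (p' - p)| ≤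
        C * ‖p' - p‖ ^ γ * ‖p' - p‖ := by
  obtain ⟨C, hC⟩ := hσ.holder N
  have key : ∀ j, ∀ p ∈ Metric.closedBall (0 : EuclideanSpace ℝ (Fin d)) N,
      ∀ p' ∈ Metric.closedBall (0 : EuclideanSpace ℝ (Fin d)) N,
      ‖fderiv ℝ (fun p => σ p k j) p' - fderiv ℝ (fun p => σ p k j) p‖ ≤ C * ‖p' - p‖ ^ γ := by
    intro j p hp p' hp'
    refine (hσ.norm_fderiv_sub_le k j p p').trans ?_
    have := hC.dist_le hp' hp
    rwa [dist_eq_norm, dist_eq_norm, Real.coe_toNNReal _ hγ.le] at this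
  refine ⟨C, C.2, fun j p hp p' hp' => ⟨key j p hp p' hp', ?_⟩⟩
  have hseg : segment ℝ p p' ⊆ Metric.closedBall 0 N :=
    (convex_closedBall 0 N).segment_subset hp hp'
  refine Convex.norm_image_sub_le_of_norm_hasFDerivWithin_le' (s := segment ℝ p p')
    (f := fun p => σ p k j) (f' := fderiv ℝ fun p => σ p k j)
    (fun u _ => (hσ.differentiable k j u).hasFDerivAt.hasFDerivWithinAt) (fun u hu => ?_)
    (convex_segment p p') (left_mem_segment ℝ p p') (right_mem_segment ℝ p p')
  refine (key j p hp u (hseg hu)).trans ?_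
  have : ‖u - p‖ ≤ ‖p' - p‖ := by
    obtain ⟨θ, h0, rfl⟩ := (segment_eq_image' ℝ p p').le hu
    rw [add_sub_cancel_left, norm_smul, Real.norm_eq_abs, abs_of_nonneg h0.1]
    exact mul_le_of_le_one_left (norm_nonneg _) h0.2
  have hC' := C.2
  gcongr

/-- On a ball containing the range of the path, a `γ`-Hölder derivative composed with a `β`-Hölder
path is Hölder of order `γ * β`; this is the value of `q` in everything that follows. -/
lemma isControlled (hσ : DiffusionHyp γ σ) (hγ : 0 < γ) (hβ : 0 < β)
    {x : ℝ → EuclideanSpace ℝ (Fin d)} (hx : ∃ C, HolderOnWith C β.toNNReal x (Icc a b))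
    (k : Fin d) : IsControlled β (γ * β) a b (fun p => σ p k) x := by
  have hxc : ContinuousOn x (Icc a b) := by
    obtain ⟨C, hC⟩ := hx
    exact hC.continuousOn (Real.toNNReal_pos.2 hβ)
  obtain ⟨N, hN⟩ := isCompact_Icc.exists_bound_of_continuousOn hxc
  have hball : ∀ s ∈ Icc a b, x s ∈ Metric.closedBall (0 : EuclideanSpace ℝ (Fin d)) N := by
    intro s hs
    simpa using hN s hs
  obtain ⟨C, hC, hb⟩ := hσ.exists_norm_fderiv_sub_le hγ N k
  obtain ⟨D, hD, hx⟩ := exists_holder_bound hβ.le hx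
  have hxγ : ∀ s v, a ≤ s → s ≤ v → v ≤ b → ‖x v - x s‖ ^ γ ≤ D ^ γ * (v - s) ^ (γ * β) := by
    intro s v hs hsv hv
    have := hx s ⟨hs, hsv.trans hv⟩ v ⟨hs.trans hsv, hv⟩
    rw [abs_of_nonneg (sub_nonneg.2 hsv)] at this
    refine (Real.rpow_le_rpow (norm_nonneg _) this hγ.le).trans_eq ?_
    rw [Real.mul_rpow hD (Real.rpow_nonneg (sub_nonneg.2 hsv) _),
      ← Real.rpow_mul (sub_nonneg.2 hsv), mul_comm γ]
  refine ⟨fun j => (hσ.differentiable k j).continuous.comp_continuousOn hxc, fun i j => ?_,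
    ⟨C * D ^ γ * D, by positivity, fun j s v hs hsv hv => ?_⟩,
    ⟨C * D ^ γ, by positivity, fun i j s v hs hsv hv => ?_⟩⟩
  · have : Continuous fun p => fderiv ℝ (fun p => σ p k j) p (EuclideanSpace.single i 1) := by
      simp_rw [hσ.fderiv_apply]
      have := hσ.contDiff.continuous_fderiv one_ne_zero
      fun_prop
    exact this.comp_continuousOn hxc
  · refine (hb j _ (hball s ⟨hs, hsv.trans hv⟩) _ (hball v ⟨hs.trans hsv, hv⟩)).2.trans ?_
    have h1 := hxγ s v hs hsv hv
    have h2 := hx s ⟨hs, hsv.trans hv⟩ v ⟨hs.trans hsv, hv⟩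
    rw [abs_of_nonneg (sub_nonneg.2 hsv)] at h2
    have h3 := Real.rpow_nonneg (sub_nonneg.2 hsv) (γ * β)
    calc _ ≤ C * (D ^ γ * (v - s) ^ (γ * β)) * (D * (v - s) ^ β) := by gcongr
      _ = _ := by
        rw [Real.rpow_add_of_nonneg (sub_nonneg.2 hsv) (by positivity) hβ.le]; ring
  · rw [← sub_apply]
    have h1 := hxγ s v hs hsv hv
    refine ((ContinuousLinearMap.le_opNorm _ _).trans (mul_le_mul_of_nonneg_right
      (hb j _ (hball s ⟨hs, hsv.trans hv⟩) _ (hball v ⟨hs.trans hsv, hv⟩)).1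
        (norm_nonneg _))).trans ?_
    rw [PiLp.norm_single, norm_one, mul_one, mul_assoc]
    gcongr

end DiffusionHyp

end

/-! ### Integrals against `y ⊗ z` through the augmented path `(x, z)` -/

section

variable {ι κ μ : Type*} [Fintype ι] [Fintype κ] [Fintype μ] [DecidableEq ι] {α β a b q : ℝ}
  {x : ℝ → EuclideanSpace ℝ ι} {y : ℝ → EuclideanSpace ℝ κ} {z : ℝ → EuclideanSpace ℝ μ}
  {A : ℝ → ℝ → ι → κ → ℝ} {B : ℝ → ℝ → κ → μ → ℝ}
  {f : EuclideanSpace ℝ ι → κ → ℝ}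

lemma rpow_le_mul_rpow {u p p' c : ℝ} (hu : 0 ≤ u) (huc : u ≤ c) (hp : 0 ≤ p) (hpp : p ≤ p') :
    u ^ p' ≤ c ^ (p' - p) * u ^ p := by
  have e : u ^ p' = u ^ (p' - p) * u ^ p := by
    rw [← Real.rpow_add_of_nonneg hu (sub_nonneg.2 hpp) hp, sub_add_cancel]
  rw [e]
  exact mul_le_mul_of_nonneg_right (Real.rpow_le_rpow hu huc (sub_nonneg.2 hpp))
    (Real.rpow_nonneg hu _)

lemma exists_abs_le_of_continuousOn {g : κ → ℝ → ℝ}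
    (hg : ∀ j, ContinuousOn (g j) (Icc a b)) :
    ∃ M : ℝ, 0 ≤ M ∧ ∀ j, ∀ s ∈ Icc a b, |g j s| ≤ M := by
  choose M hM using fun j => isCompact_Icc.exists_bound_of_continuousOn (hg j)
  refine ⟨∑ j, |M j|, by positivity, fun j s hs => (hM j s hs).trans ((le_abs_self _).trans ?_)⟩
  exact Finset.single_le_sum (f := fun j => |M j|) (fun _ _ => abs_nonneg _) (Finset.mem_univ j)

/-- The exponent `q`, weaker than `β`, is enough: these increments are needed for the derivative in
the direction of `z` and in products with the `β`-Hölder increments of `z`. -/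
lemma IsControlled.exists_abs_sub_le (hf : IsControlled β q a b f x) (hq : 0 < q)
    (hqβ : q ≤ β) (hx : ∃ C, HolderOnWith C β.toNNReal x (Icc a b)) :
    ∃ K : ℝ, 0 ≤ K ∧ ∀ j s v, a ≤ s → s ≤ v → v ≤ b → |f (x v) j - f (x s) j| ≤ K * (v - s) ^ q := by
  have hβ : 0 < β := hq.trans_le hqβ
  obtain ⟨D, hD, hx⟩ := exists_holder_bound hβ.le hx
  obtain ⟨C, hC, hR⟩ := hf.remainder
  obtain ⟨M, hM, hG⟩ := exists_abs_le_of_continuousOn (κ := ι × κ)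
    (g := fun p s => fderiv ℝ (fun z => f z p.2) (x s) (EuclideanSpace.single p.1 1))
    fun p => hf.cont_deriv p.1 p.2
  refine ⟨C * |b - a| ^ β + ∑ _i : ι, M * (D * |b - a| ^ (β - q)), by positivity,
    fun j s v hs hsv hv => ?_⟩
  have hvs := sub_nonneg.2 hsv
  have hvb : v - s ≤ |b - a| := (by linarith : v - s ≤ b - a).trans (le_abs_self _)
  have h1 := hR j s v hs hsv hv
  have h2 : |fderiv ℝ (fun p => f p j) (x s) (x v - x s)| ≤
      (∑ _i : ι, M * (D * |b - a| ^ (β - q))) * (v - s) ^ q := by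
    rw [fderiv_apply_eq_sum, Finset.sum_mul]
    refine (Finset.abs_sum_le_sum_abs _ _).trans (Finset.sum_le_sum fun i _ => ?_)
    rw [abs_mul, mul_assoc]
    refine mul_le_mul (hG (i, j) s ⟨hs, hsv.trans hv⟩) ?_ (abs_nonneg _) hM
    have h3 := hx s ⟨hs, hsv.trans hv⟩ v ⟨hs.trans hsv, hv⟩
    rw [abs_of_nonneg hvs] at h3
    refine ((PiLp.norm_apply_le (x v - x s) i).trans h3).trans ?_
    rw [mul_assoc]
    exact mul_le_mul_of_nonneg_left (rpow_le_mul_rpow hvs hvb hq.le hqβ) hD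
  have h4 : C * (v - s) ^ (q + β) ≤ C * |b - a| ^ β * (v - s) ^ q := by
    rw [mul_assoc]
    refine mul_le_mul_of_nonneg_left ?_ hC
    have := rpow_le_mul_rpow hvs hvb hq.le (by linarith : q ≤ q + β)
    rwa [add_sub_cancel_left] at this
  rw [add_mul]
  calc _ = |(f (x v) j - f (x s) j - fderiv ℝ (fun p => f p j) (x s) (x v - x s)) +
        fderiv ℝ (fun p => f p j) (x s) (x v - x s)| := by ring_nf
    _ ≤ _ := (abs_add_le _ _).trans (add_le_add (h1.trans h4) h2)

/-- The path `(x, z)` with values in a Euclidean space with one more coordinate. -/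
def augmentPath (x : ℝ → EuclideanSpace ℝ ι) (z : ℝ → ℝ) (v : ℝ) : EuclideanSpace ℝ (ι ⊕ Unit) :=
  WithLp.toLp 2 (Sum.elim (fun i => x v i) fun _ => z v)

/-- The function `(p, q) ↦ (c - q) f(p)`. -/
def augmentFun (f : EuclideanSpace ℝ ι → κ → ℝ) (c : ℝ) (p : EuclideanSpace ℝ (ι ⊕ Unit)) (j : κ) :
    ℝ :=
  (c - p (Sum.inr ())) * f (WithLp.toLp 2 fun i => p (Sum.inl i)) j

/-- The tensor `(x, z) ⊗ y` computed from `A = x ⊗ y` and `B = y ⊗ z`. -/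
def augmentTensor (y : ℝ → EuclideanSpace ℝ κ) (z : ℝ → ℝ) (A : ℝ → ℝ → ι → κ → ℝ)
    (B : ℝ → ℝ → κ → ℝ) (s t : ℝ) : ι ⊕ Unit → κ → ℝ :=
  Sum.elim (fun i => A s t i) fun _ j => (z t - z s) * (y t j - y s j) - B s t j

lemma norm_augmentPath_sub_le (z : ℝ → ℝ) (s t : ℝ) :
    ‖augmentPath x z t - augmentPath x z s‖ ≤ ‖x t - x s‖ + |z t - z s| := by
  refine abs_le_of_sq_le_sq' ?_ (by positivity) |>.2
  rw [EuclideanSpace.norm_sq_eq, Fintype.sum_sum_type]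
  have : ∑ i, ‖(augmentPath x z t - augmentPath x z s) (Sum.inl i)‖ ^ 2 = ‖x t - x s‖ ^ 2 := by
    rw [EuclideanSpace.norm_sq_eq]; rfl
  rw [this, Fintype.sum_unique]
  change ‖x t - x s‖ ^ 2 + |z t - z s| ^ 2 ≤ _
  nlinarith [norm_nonneg (x t - x s), abs_nonneg (z t - z s)]

/-- The new block `z ⊗ y` arises from `y ⊗ z` by integration by parts. Its multiplicative property
is that of `B` with the opposite sign, the mixed products being supplied by the product of the full
increments. -/
lemma isMultFunctional_augment (hβ : 0 < β) (hA : IsMultFunctional β a b x y A)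
    (hB : IsMultFunctional β a b y z B) (l : μ) :
    IsMultFunctional β a b (augmentPath x fun v => z v l) y
      (augmentTensor y (fun v => z v l) A fun s t j => B s t j l) := by
  obtain ⟨C, hC, hx, hy, hAb⟩ := hA.exists_bound hβ
  obtain ⟨D, hD, -, hz, hBb⟩ := hB.exists_bound hβ
  have hzl : ∀ s t, a ≤ s → s ≤ t → t ≤ b → |z t l - z s l| ≤ D * (t - s) ^ β :=
    fun s t hs hst ht => (PiLp.norm_apply_le (z t - z s) l).trans (hz s t hs hst ht)
  refine ⟨?_, hA.holder_right, ?_, ?_, C + (D * C + D), ?_⟩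
  · refine exists_holderOnWith (C := C + D) hβ.le fun s hs t ht hst => ?_
    rw [abs_of_nonneg (sub_nonneg.2 hst), add_mul]
    exact (norm_augmentPath_sub_le _ s t).trans
      (add_le_add (hx s t hs.1 hst ht.2) (hzl s t hs.1 hst ht.2))
  · have hyc : ∀ j, ContinuousOn (fun v => y v j) (Icc a b) := fun j => by
      obtain ⟨K, hK⟩ := hA.holder_right
      exact (PiLp.continuous_apply 2 _ j).comp_continuousOn
        (hK.continuousOn (Real.toNNReal_pos.2 hβ))
    have hzc : ContinuousOn (fun v => z v l) (Icc a b) := by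
      obtain ⟨K, hK⟩ := hB.holder_right
      exact (PiLp.continuous_apply 2 _ l).comp_continuousOn
        (hK.continuousOn (Real.toNNReal_pos.2 hβ))
    have m1 : MapsTo Prod.fst {p : ℝ × ℝ | a ≤ p.1 ∧ p.1 < p.2 ∧ p.2 ≤ b} (Icc a b) :=
      fun p hp => ⟨hp.1, hp.2.1.le.trans hp.2.2⟩
    have m2 : MapsTo Prod.snd {p : ℝ × ℝ | a ≤ p.1 ∧ p.1 < p.2 ∧ p.2 ≤ b} (Icc a b) :=
      fun p hp => ⟨hp.1.trans hp.2.1.le, hp.2.2⟩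
    refine continuousOn_pi.2 fun i => continuousOn_pi.2 fun j => ?_
    rcases i with i | i
    · exact continuousOn_pi.1 (continuousOn_pi.1 hA.continuousOn i) j
    · exact (((hzc.comp continuousOn_snd m2).sub (hzc.comp continuousOn_fst m1)).mul
        (((hyc j).comp continuousOn_snd m2).sub ((hyc j).comp continuousOn_fst m1))).sub
        (continuousOn_pi.1 (continuousOn_pi.1 hB.continuousOn j) l)
  · intro s u t hs hsu hut ht i j
    rcases i with i | i
    · exact hA.mult s u t hs hsu hut ht i j
    · have := hB.mult s u t hs hsu hut ht j l
      simp only [augmentTensor, augmentPath, Sum.elim_inr]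
      linear_combination -this
  · intro s t hs hst ht
    have hts : 0 ≤ t - s := by linarith
    have p0 := Real.rpow_nonneg hts (2 * β)
    have p1 := Real.rpow_nonneg hts β
    have e : (t - s) ^ (2 * β) = (t - s) ^ β * (t - s) ^ β := by
      rw [two_mul, Real.rpow_add_of_nonneg hts hβ.le hβ.le]
    refine (pi_norm_le_iff_of_nonneg (by positivity)).2 fun i =>
      (pi_norm_le_iff_of_nonneg (by positivity)).2 fun j => ?_
    rcases i with i | i
    · refine ((abs_apply_le_norm (A s t) i j).trans (hAb s t hs hst.le ht)).trans
        (mul_le_mul_of_nonneg_right ?_ p0)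
      nlinarith [mul_nonneg hD hC]
    · change |(z t l - z s l) * (y t j - y s j) - B s t j l| ≤ _
      refine (abs_sub _ _).trans ?_
      have h1 : |(z t l - z s l) * (y t j - y s j)| ≤ D * C * (t - s) ^ (2 * β) := by
        rw [abs_mul, e]
        calc _ ≤ (D * (t - s) ^ β) * (C * (t - s) ^ β) :=
              mul_le_mul (hzl s t hs hst.le ht) (abs_y_sub_le (hy s t hs hst.le ht) j)
                (abs_nonneg _) (by positivity)
          _ = _ := by ring
      have h2 := (abs_apply_le_norm (B s t) j l).trans (hBb s t hs hst.le ht)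
      nlinarith [mul_nonneg hC p0]

end

section

variable {ι κ μ : Type*} [Fintype ι] [Fintype κ] [Fintype μ] [DecidableEq ι] {α β a b q : ℝ}
  {x : ℝ → EuclideanSpace ℝ ι} {y : ℝ → EuclideanSpace ℝ κ} {z : ℝ → EuclideanSpace ℝ μ}
  {A : ℝ → ℝ → ι → κ → ℝ} {B : ℝ → ℝ → κ → μ → ℝ}
  {f : EuclideanSpace ℝ ι → κ → ℝ}

/-- The projection to the coordinates in `ι`. -/
def projLeft (ι : Type*) [Fintype ι] : EuclideanSpace ℝ (ι ⊕ Unit) →L[ℝ] EuclideanSpace ℝ ι :=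
  LinearMap.toContinuousLinearMap
    { toFun := fun p => WithLp.toLp 2 fun i => p (Sum.inl i)
      map_add' := fun _ _ => rfl
      map_smul' := fun _ _ => rfl }

lemma hasFDerivAt_augmentFun (hf : ∀ j, Differentiable ℝ fun p => f p j) (c : ℝ) (j : κ)
    (p : EuclideanSpace ℝ (ι ⊕ Unit)) :
    HasFDerivAt (fun p => augmentFun f c p j)
      ((c - p (Sum.inr ())) • (fderiv ℝ (fun p => f p j) (projLeft ι p)).comp (projLeft ι) +
        f (projLeft ι p) j • -(EuclideanSpace.proj (𝕜 := ℝ) (Sum.inr ()) :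
          EuclideanSpace ℝ (ι ⊕ Unit) →L[ℝ] ℝ)) p := by
  have h1 : HasFDerivAt (fun p : EuclideanSpace ℝ (ι ⊕ Unit) => c - p (Sum.inr ()))
      (-(EuclideanSpace.proj (𝕜 := ℝ) (Sum.inr ()) : EuclideanSpace ℝ (ι ⊕ Unit) →L[ℝ] ℝ)) p :=
    (EuclideanSpace.proj (𝕜 := ℝ) (Sum.inr ()) :
      EuclideanSpace ℝ (ι ⊕ Unit) →L[ℝ] ℝ).hasFDerivAt.const_sub c
  have h2 : HasFDerivAt (fun p => f (projLeft ι p) j)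
      ((fderiv ℝ (fun p => f p j) (projLeft ι p)).comp (projLeft ι)) p :=
    (hf j _).hasFDerivAt.comp p (projLeft ι).hasFDerivAt
  exact h1.mul h2

lemma fderiv_augmentFun (hf : ∀ j, Differentiable ℝ fun p => f p j) (c : ℝ) (j : κ)
    (z : ℝ → ℝ) (s : ℝ) (h : EuclideanSpace ℝ (ι ⊕ Unit)) :
    fderiv ℝ (fun p => augmentFun f c p j) (augmentPath x z s) h =
      (c - z s) * fderiv ℝ (fun p => f p j) (x s) (projLeft ι h) - f (x s) j * h (Sum.inr ()) := by
  rw [(hasFDerivAt_augmentFun hf c j _).fderiv]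
  change (c - z s) * fderiv ℝ (fun p => f p j) (x s) (projLeft ι h) +
    f (x s) j * -h (Sum.inr ()) = _
  ring

lemma projLeft_single_inl (i : ι) :
    projLeft ι (EuclideanSpace.single (Sum.inl i) (1 : ℝ)) = EuclideanSpace.single i 1 := by
  ext j
  change (EuclideanSpace.single (Sum.inl i) (1 : ℝ) : EuclideanSpace ℝ (ι ⊕ Unit)) (Sum.inl j) = _
  simp

lemma projLeft_single_inr (i : Unit) :
    projLeft ι (EuclideanSpace.single (Sum.inr i) (1 : ℝ)) = 0 := by
  ext j
  change (EuclideanSpace.single (Sum.inr i) (1 : ℝ) : EuclideanSpace ℝ (ι ⊕ Unit)) (Sum.inl j) = _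
  simp

lemma fderiv_augmentFun_inl (hf : ∀ j, Differentiable ℝ fun p => f p j) (c : ℝ) (j : κ)
    (z : ℝ → ℝ) (s : ℝ) (i : ι) :
    fderiv ℝ (fun p => augmentFun f c p j) (augmentPath x z s)
      (EuclideanSpace.single (Sum.inl i) 1) =
      (c - z s) * fderiv ℝ (fun p => f p j) (x s) (EuclideanSpace.single i 1) := by
  rw [fderiv_augmentFun hf, projLeft_single_inl]
  simp

lemma fderiv_augmentFun_inr (hf : ∀ j, Differentiable ℝ fun p => f p j) (c : ℝ) (j : κ)
    (z : ℝ → ℝ) (s : ℝ) (i : Unit) :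
    fderiv ℝ (fun p => augmentFun f c p j) (augmentPath x z s)
      (EuclideanSpace.single (Sum.inr i) 1) = -f (x s) j := by
  rw [fderiv_augmentFun hf, projLeft_single_inr]
  simp

/-- By the product rule, the remainder of `(c - z) f(x)` is `c - z s` times the remainder of `f(x)`,
minus the product of the increments of `z` and `f(x)`. Both have order `q + β`. -/
lemma IsControlled.augment (hq : 0 < q) (hqβ : q ≤ β) (hf : IsControlled β q a b f x)
    (hfd : ∀ j, Differentiable ℝ fun p => f p j) (hx : ∃ C, HolderOnWith C β.toNNReal x (Icc a b))
    {z : ℝ → ℝ} {D : ℝ} (hD : 0 ≤ D) (hz : ∀ s t, a ≤ s → s ≤ t → t ≤ b → |z t - z s| ≤ D * (t - s) ^ β)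
    (hzc : ContinuousOn z (Icc a b)) (c : ℝ) :
    IsControlled β q a b (augmentFun f c) (augmentPath x z) := by
  obtain ⟨C, hC, hR⟩ := hf.remainder
  obtain ⟨C₁, hC₁, hG⟩ := hf.deriv
  obtain ⟨K, hK, hΔ⟩ := hf.exists_abs_sub_le hq hqβ hx
  obtain ⟨M, hM, hGM⟩ := exists_abs_le_of_continuousOn (κ := ι × κ)
    (g := fun p s => fderiv ℝ (fun z => f z p.2) (x s) (EuclideanSpace.single p.1 1))
    fun p => hf.cont_deriv p.1 p.2
  obtain ⟨N, hN, hcN⟩ := exists_abs_le_of_continuousOn (κ := Unit) (g := fun _ s => c - z s)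
    fun _ => continuousOn_const.sub hzc
  refine ⟨fun j => (continuousOn_const.sub hzc).mul (hf.cont j), fun i j => ?_,
    ⟨N * C + D * K, by positivity, fun j s v hs hsv hv => ?_⟩,
    ⟨N * C₁ + D * |b - a| ^ (β - q) * M + K, by positivity, fun i j s v hs hsv hv => ?_⟩⟩
  · rcases i with i | i
    · simp_rw [fderiv_augmentFun_inl hfd]
      exact (continuousOn_const.sub hzc).mul (hf.cont_deriv i j)
    · simp_rw [fderiv_augmentFun_inr hfd]
      exact (hf.cont j).neg
  · rw [fderiv_augmentFun hfd]
    change |(c - z v) * f (x v) j - (c - z s) * f (x s) j - ((c - z s) *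
      fderiv ℝ (fun p => f p j) (x s) (x v - x s) - f (x s) j * (z v - z s))| ≤ _
    have e : (c - z v) * f (x v) j - (c - z s) * f (x s) j - ((c - z s) *
        fderiv ℝ (fun p => f p j) (x s) (x v - x s) - f (x s) j * (z v - z s)) =
        (c - z s) * (f (x v) j - f (x s) j - fderiv ℝ (fun p => f p j) (x s) (x v - x s)) -
          (z v - z s) * (f (x v) j - f (x s) j) := by ring
    rw [e, add_mul]
    have hvs := sub_nonneg.2 hsv
    refine (abs_sub _ _).trans (add_le_add ?_ ?_)
    · rw [abs_mul, mul_assoc]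
      exact mul_le_mul (hcN () s ⟨hs, hsv.trans hv⟩) (hR j s v hs hsv hv) (abs_nonneg _) hN
    · rw [abs_mul, Real.rpow_add_of_nonneg hvs hq.le (hq.le.trans hqβ)]
      calc _ ≤ (D * (v - s) ^ β) * (K * (v - s) ^ q) :=
            mul_le_mul (hz s v hs hsv hv) (hΔ j s v hs hsv hv) (abs_nonneg _)
              (mul_nonneg hD (Real.rpow_nonneg hvs _))
        _ = _ := by ring
  · have hvs := sub_nonneg.2 hsv
    have p0 := Real.rpow_nonneg hvs q
    have p1 : 0 ≤ |b - a| ^ (β - q) := by positivity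
    rcases i with i | i
    · rw [fderiv_augmentFun_inl hfd, fderiv_augmentFun_inl hfd]
      set g := fun s => fderiv ℝ (fun p => f p j) (x s) (EuclideanSpace.single i 1) with hg
      change |(c - z v) * g v - (c - z s) * g s| ≤ _
      have e : (c - z v) * g v - (c - z s) * g s =
        (c - z v) * (g v - g s) - (z v - z s) * g s := by ring
      have hvb : v - s ≤ |b - a| := (by linarith : v - s ≤ b - a).trans (le_abs_self _)
      have h1 : |(c - z v) * (g v - g s)| ≤ N * (C₁ * (v - s) ^ q) := by
        rw [abs_mul]
        exact mul_le_mul (hcN () v ⟨hs.trans hsv, hv⟩) (hG i j s v hs hsv hv) (abs_nonneg _) hN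
      have h2 : |(z v - z s) * g s| ≤ D * (|b - a| ^ (β - q) * (v - s) ^ q) * M := by
        rw [abs_mul]
        refine mul_le_mul ((hz s v hs hsv hv).trans (mul_le_mul_of_nonneg_left
          (rpow_le_mul_rpow hvs hvb hq.le hqβ) hD)) (hGM (i, j) s ⟨hs, hsv.trans hv⟩)
          (abs_nonneg _) (by positivity)
      rw [e]
      refine (abs_sub _ _).trans ((add_le_add h1 h2).trans ?_)
      nlinarith [mul_nonneg hK p0]
    · rw [fderiv_augmentFun_inr hfd, fderiv_augmentFun_inr hfd, neg_sub_neg, abs_sub_comm]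
      refine (hΔ j s v hs hsv hv).trans (mul_le_mul_of_nonneg_right ?_ p0)
      have : 0 ≤ N * C₁ + D * |b - a| ^ (β - q) * M := by positivity
      linarith

/-- The contribution of `B = y ⊗ z` and of the product of the increments of `y` and `z`. -/
lemma hnGerm_augment (hfd : ∀ j, Differentiable ℝ fun p => f p j) (c : ℝ) (z : ℝ → ℝ)
    (B : ℝ → ℝ → κ → ℝ) (s t : ℝ) :
    hnGerm (augmentFun f c) (augmentPath x z) y (augmentTensor y z A B) s t =
      (c - z s) * hnGerm f x y A s t -
        ∑ j, f (x s) j * ((z t - z s) * (y t j - y s j) - B s t j) := by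
  simp only [hnGerm]
  rw [Finset.mul_sum, ← Finset.sum_sub_distrib]
  refine Finset.sum_congr rfl fun j _ => ?_
  rw [Fintype.sum_sum_type, Fintype.sum_unique (ι := Unit)]
  simp only [fderiv_augmentFun_inl hfd, fderiv_augmentFun_inr hfd]
  change (c - z s) * f (x s) j * (y t j - y s j) + (∑ i, (c - z s) *
    fderiv ℝ (fun p => f p j) (x s) (EuclideanSpace.single i 1) * A s t i j +
    -f (x s) j * ((z t - z s) * (y t j - y s j) - B s t j)) = _
  simp_rw [mul_assoc]
  rw [← Finset.mul_sum]
  ring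

/-- A multiplicative functional `(x, y, A)`, a functional `(y, z, B)` and a smooth integrand. -/
structure TensorIntegrand (α β q a b : ℝ) (f : EuclideanSpace ℝ ι → κ → ℝ)
    (x : ℝ → EuclideanSpace ℝ ι) (y : ℝ → EuclideanSpace ℝ κ) (z : ℝ → EuclideanSpace ℝ μ)
    (A : ℝ → ℝ → ι → κ → ℝ) (B : ℝ → ℝ → κ → μ → ℝ) : Prop where
  exponents : Exponents α β q
  left : IsMultFunctional β a b x y A
  right : IsMultFunctional β a b y z B
  controlled : IsControlled β q a b f x
  differentiable : ∀ j, Differentiable ℝ fun p => f p j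

namespace TensorIntegrand

lemma exists_right_bound (h : TensorIntegrand α β q a b f x y z A B) (l : μ) :
    ∃ D : ℝ, 0 ≤ D ∧ (∀ s t, a ≤ s → s ≤ t → t ≤ b → |z t l - z s l| ≤ D * (t - s) ^ β) ∧
      ContinuousOn (fun v => z v l) (Icc a b) := by
  obtain ⟨D, hD, -, hz, -⟩ := h.right.exists_bound h.exponents.beta_pos
  refine ⟨D, hD, fun s t hs hst ht => (PiLp.norm_apply_le (z t - z s) l).trans (hz s t hs hst ht),
    ?_⟩
  obtain ⟨K, hK⟩ := h.right.holder_right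
  exact (PiLp.continuous_apply 2 _ l).comp_continuousOn
    (hK.continuousOn (Real.toNNReal_pos.2 h.exponents.beta_pos))

lemma isRiemannLimit_augment (h : TensorIntegrand α β q a b f x y z A B) (l : μ) (c : ℝ) {s t : ℝ}
    (hs : a ≤ s) (hst : s ≤ t) (ht : t ≤ b) :
    IsRiemannLimit (fun u v => (c - z u l) * hnGerm f x y A u v -
      ∑ j, f (x u) j * ((z v l - z u l) * (y v j - y u j) - B u v j l)) s t
      (hnIntegral α (augmentFun f c) (augmentPath x fun v => z v l) y
        (augmentTensor y (fun v => z v l) A fun u v j => B u v j l) s t) := by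
  obtain ⟨D, hD, hz, hzc⟩ := h.exists_right_bound l
  exact (isRiemannLimit_hnIntegral h.exponents
    (isMultFunctional_augment h.exponents.beta_pos h.left h.right l)
    (h.controlled.augment h.exponents.q_pos h.exponents.le_beta h.differentiable h.left.holder_left
      hD hz hzc c) hs hst ht).congr fun u v _ _ _ => hnGerm_augment h.differentiable c _ _ u v

lemma isRiemannLimit (h : TensorIntegrand α β q a b f x y z A B) (l : μ) {s t : ℝ}
    (hs : a ≤ s) (hst : s ≤ t) (ht : t ≤ b) :
    IsRiemannLimit (fun u v => (z t l - z u l) * hnGerm f x y A u v -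
      ∑ j, f (x u) j * ((z v l - z u l) * (y v j - y u j) - B u v j l)) s t
      (hnTensorIntegral α f x y (fun v => z v l) A (fun u v j => B u v j l) s t) :=
  h.isRiemannLimit_augment l (z t l) hs hst ht

/-- In the tensor integral the constant `z t l` moves with the upper end point, which spoils
additivity. The Riemann summand is affine in this constant, so a fixed `c` can replace it at the
cost of a multiple of the integral of `f(x)` against `y`. -/
lemma hnTensorIntegral_eq_add (h : TensorIntegrand α β q a b f x y z A B) (l : μ) (c : ℝ) {s t : ℝ}
    (hs : a ≤ s) (hst : s ≤ t) (ht : t ≤ b) :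
    hnTensorIntegral α f x y (fun v => z v l) A (fun u v j => B u v j l) s t =
      (z t l - c) * hnIntegral α f x y A s t +
      hnIntegral α (augmentFun f c) (augmentPath x fun v => z v l) y
        (augmentTensor y (fun v => z v l) A fun u v j => B u v j l) s t := by
  refine (h.isRiemannLimit l hs hst ht).unique
    (((isRiemannLimit_hnIntegral h.exponents h.left h.controlled hs hst ht).const_mul_add
      (h.isRiemannLimit_augment l c hs hst ht) (z t l - c)).congr fun u v _ _ _ => ?_) hst
  ring

/-- The defect of additivity of the integral with respect to `y ⊗ z`. -/
theorem hnTensorIntegral_add_adjacent (h : TensorIntegrand α β q a b f x y z A B) (l : μ)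
    {s u t : ℝ} (hs : a ≤ s) (hsu : s ≤ u) (hut : u ≤ t) (ht : t ≤ b) :
    hnTensorIntegral α f x y (fun v => z v l) A (fun u v j => B u v j l) s u +
      hnTensorIntegral α f x y (fun v => z v l) A (fun u v j => B u v j l) u t +
      (z t l - z u l) * hnIntegral α f x y A s u =
      hnTensorIntegral α f x y (fun v => z v l) A (fun u v j => B u v j l) s t := by
  obtain ⟨D, hD, hz, hzc⟩ := h.exists_right_bound l
  rw [h.hnTensorIntegral_eq_add l 0 hs hsu (hut.trans ht),
    h.hnTensorIntegral_eq_add l 0 (hs.trans hsu) hut ht,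
    h.hnTensorIntegral_eq_add l 0 hs (hsu.trans hut) ht,
    ← hnIntegral_add_adjacent h.exponents h.left h.controlled hs hsu hut ht,
    ← hnIntegral_add_adjacent h.exponents
      (isMultFunctional_augment h.exponents.beta_pos h.left h.right l)
      (h.controlled.augment h.exponents.q_pos h.exponents.le_beta h.differentiable
        h.left.holder_left hD hz hzc 0) hs hsu hut ht]
  ring

/-- After the constant is fixed to `0`, each of the two integrals separately is only of order `β`.
Each is replaced by its summand, with an error of order `q + 2 * β`; the summands then combine so
that only products of two increments and the tensor `B` remain, all of order `2 * β`. -/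
theorem exists_abs_hnTensorIntegral_le (h : TensorIntegrand α β q a b f x y z A B) (l : μ) :
    ∃ K : ℝ, 0 ≤ K ∧ ∀ s t, a ≤ s → s ≤ t → t ≤ b →
      |hnTensorIntegral α f x y (fun v => z v l) A (fun u v j => B u v j l) s t| ≤
        K * (t - s) ^ (2 * β) := by
  have hE := h.exponents
  have hβ := hE.beta_pos
  obtain ⟨D, hD, hz, hzc⟩ := h.exists_right_bound l
  obtain ⟨K₀, h0, hI⟩ := exists_abs_hnIntegral_sub_hnGerm_le hE h.left h.controlled
  obtain ⟨K₁, h1, hg⟩ := exists_abs_hnGerm_le hβ h.left h.controlled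
  obtain ⟨K₂, h2, hJ⟩ := exists_abs_hnIntegral_sub_hnGerm_le hE
    (isMultFunctional_augment hβ h.left h.right l)
    (h.controlled.augment hE.q_pos hE.le_beta h.differentiable h.left.holder_left hD hz hzc 0)
  obtain ⟨M, hM, hf⟩ := exists_abs_le_of_continuousOn h.controlled.cont
  obtain ⟨N, hN, hzN⟩ := exists_abs_le_of_continuousOn (κ := Unit) (g := fun _ v => z v l)
    fun _ => hzc
  obtain ⟨C, hC, hy, -, hB⟩ := h.right.exists_bound hβ
  refine ⟨N * (K₀ * |b - a| ^ q) + K₂ * |b - a| ^ q + D * K₁ +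
    ∑ _j : κ, M * (D * C + C), by positivity, fun s t hs hst ht => ?_⟩
  have hts := sub_nonneg.2 hst
  have hs' : s ∈ Icc a b := ⟨hs, hst.trans ht⟩
  have htb : t - s ≤ |b - a| := (by linarith : t - s ≤ b - a).trans (le_abs_self _)
  have pq : (t - s) ^ (q + 2 * β) ≤ |b - a| ^ q * (t - s) ^ (2 * β) := by
    have := rpow_le_mul_rpow hts htb (by linarith : 0 ≤ 2 * β)
      (by linarith [hE.q_pos] : 2 * β ≤ q + 2 * β)
    rwa [add_sub_cancel_right] at this
  have e : (t - s) ^ (2 * β) = (t - s) ^ β * (t - s) ^ β := by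
    rw [two_mul, Real.rpow_add_of_nonneg hts hβ.le hβ.le]
  have p0 := Real.rpow_nonneg hts (2 * β)
  have p1 := Real.rpow_nonneg hts β
  rw [h.hnTensorIntegral_eq_add l 0 hs hst ht]
  have hI' := hI s t hs hst ht
  have hJ' := hJ s t hs hst ht
  rw [hnGerm_augment h.differentiable] at hJ'
  set I := hnIntegral α f x y A s t
  set J := hnIntegral α (augmentFun f 0) (augmentPath x fun v => z v l) y
        (augmentTensor y (fun v => z v l) A fun u v j => B u v j l) s t
  set g := hnGerm f x y A s t with hgd
  set S := ∑ j, f (x s) j * ((z t l - z s l) * (y t j - y s j) - B s t j l) with hS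
  have a1 : |z t l * (I - g)| ≤ N * (K₀ * |b - a| ^ q) * (t - s) ^ (2 * β) := by
    rw [abs_mul]
    calc _ ≤ N * (K₀ * (|b - a| ^ q * (t - s) ^ (2 * β))) :=
          mul_le_mul (hzN () t ⟨hs.trans hst, ht⟩) (hI'.trans (mul_le_mul_of_nonneg_left pq h0))
            (abs_nonneg _) hN
      _ = _ := by ring
  have a2 : |J - ((0 - z s l) * g - S)| ≤ K₂ * |b - a| ^ q * (t - s) ^ (2 * β) := by
    refine hJ'.trans ?_
    rw [mul_assoc]
    exact mul_le_mul_of_nonneg_left pq h2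
  have a3 : |(z t l - z s l) * g| ≤ D * K₁ * (t - s) ^ (2 * β) := by
    rw [abs_mul, e]
    calc _ ≤ (D * (t - s) ^ β) * (K₁ * (t - s) ^ β) :=
          mul_le_mul (hz s t hs hst ht) (hg s t hs hst ht) (abs_nonneg _) (by positivity)
      _ = _ := by ring
  have a4 : |S| ≤ (∑ _j : κ, M * (D * C + C)) * (t - s) ^ (2 * β) := by
    rw [hS, Finset.sum_mul]
    refine (Finset.abs_sum_le_sum_abs _ _).trans (Finset.sum_le_sum fun j _ => ?_)
    rw [abs_mul, mul_assoc]
    refine mul_le_mul (hf j s hs') ?_ (abs_nonneg _) hM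
    rw [add_mul]
    refine (abs_sub _ _).trans (add_le_add ?_ ?_)
    · rw [abs_mul, e]
      calc _ ≤ (D * (t - s) ^ β) * (C * (t - s) ^ β) :=
            mul_le_mul (hz s t hs hst ht) (abs_y_sub_le (hy s t hs hst ht) j) (abs_nonneg _)
              (by positivity)
        _ = _ := by ring
    · exact (abs_apply_le_norm (B s t) j l).trans (hB s t hs hst ht)
  have e2 : (z t l - 0) * I + J = z t l * (I - g) + (J - ((0 - z s l) * g - S)) +
      (z t l - z s l) * g - S := by ring
  rw [e2, add_mul, add_mul, add_mul]
  exact (abs_sub _ _).trans (add_le_add ((abs_add_le _ _).trans (add_le_add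
    ((abs_add_le _ _).trans (add_le_add a1 a2)) a3)) a4)

end TensorIntegrand

end

/-! ### Stieltjes integrals -/

lemma stieltjesIntegral_congr {f g g' : ℝ → ℝ} {a b : ℝ} (hab : a ≤ b)
    (h : ∀ v ∈ Icc a b, g v = g' v) : stieltjesIntegral f g a b = stieltjesIntegral f g' a b := by
  have e : (fun v => g (max a (min b v))) = fun v => g' (max a (min b v)) :=
    funext fun v => h _ (clampIcc_mem hab v)
  -- The condition of the `if`, its decidability and the measure all depend on the frozen function,
  -- so the equality is transported for arbitrary functions and instances.
  have : ∀ F G : ℝ → ℝ, F = G → ∀ (_ : Decidable (Monotone F)) (_ : Decidable (Monotone G)),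
      (if h : Monotone F then ∫ v in Ioc a b, f v ∂h.stieltjesFunction.measure else 0) =
      if h : Monotone G then ∫ v in Ioc a b, f v ∂h.stieltjesFunction.measure else 0 := by
    rintro F _ rfl _ _
    congr
  exact this _ _ e _ _

lemma monotone_clampIcc_comp {g : ℝ → ℝ} {c d : ℝ} (hcd : c ≤ d) (hg : MonotoneOn g (Icc c d)) :
    Monotone fun v => g (max c (min d v)) := fun _ _ h =>
  hg (clampIcc_mem hcd _) (clampIcc_mem hcd _) (clampIcc_mono h)

/-- The Stieltjes integrals over the subintervals are integrals against one measure. -/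
lemma exists_stieltjes_measure {g : ℝ → ℝ} {c d : ℝ} (hcd : c ≤ d) (hg : MonotoneOn g (Icc c d))
    (hgc : ContinuousOn g (Icc c d)) : ∃ μ : Measure ℝ, IsLocallyFiniteMeasure μ ∧
      (∀ a b, c ≤ a → a ≤ b → b ≤ d → μ (Ioc a b) = ENNReal.ofReal (g b - g a)) ∧
      ∀ f a b, c ≤ a → a ≤ b → b ≤ d → stieltjesIntegral f g a b = ∫ v in Ioc a b, f v ∂μ := by
  have gen : ∀ a b, c ≤ a → a ≤ b → b ≤ d → ∃ h : Monotone (fun v => g (max a (min b v))),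
      ∀ u v, h.stieltjesFunction.measure (Ioc u v) =
        ENNReal.ofReal (g (clampIcc a b v) - g (clampIcc a b u)) := by
    intro a b ha hab hb
    have h := monotone_clampIcc_comp hab (hg.mono (Icc_subset_Icc ha hb))
    refine ⟨h, fun u v => ?_⟩
    have hc : Continuous fun v => g (max a (min b v)) :=
      (hgc.mono (Icc_subset_Icc ha hb)).comp_continuous (continuous_clampIcc a b) (clampIcc_mem hab)
    rw [StieltjesFunction.measure_Ioc, h.stieltjesFunction_eq, h.stieltjesFunction_eq,
      hc.continuousAt.continuousWithinAt.rightLim_eq, hc.continuousAt.continuousWithinAt.rightLim_eq]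
    rfl
  obtain ⟨h, hμ⟩ := gen c d le_rfl hcd le_rfl
  refine ⟨h.stieltjesFunction.measure, inferInstance, fun a b ha hab hb => ?_,
    fun f a b ha hab hb => ?_⟩
  · rw [hμ, clampIcc_of_mem ⟨ha, hab.trans hb⟩, clampIcc_of_mem ⟨ha.trans hab, hb⟩]
  · obtain ⟨h', hμ'⟩ := gen a b ha hab hb
    rw [stieltjesIntegral, dif_pos h']
    congr 1
    -- Freezing `g` outside `[a, b]` and restricting the measure built on `[c, d]` to `(a, b]` give
    -- every half-open interval the same mass. By continuity of `g` the right limits in the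
    -- Stieltjes measure are values.
    refine Measure.ext_of_Ioc _ _ fun u v huv => ?_
    rw [Measure.restrict_apply measurableSet_Ioc, Measure.restrict_apply measurableSet_Ioc,
      Ioc_inter_Ioc, hμ, hμ']
    rcases le_total (min v b) (max u a) with hle | hle
    · rw [ENNReal.ofReal_of_nonpos, ENNReal.ofReal_of_nonpos]
      · exact sub_nonpos.2 (hg (clampIcc_mem hcd _) (clampIcc_mem hcd _) (clampIcc_mono hle))
      · exact sub_nonpos.2 (hg (Icc_subset_Icc ha hb (clampIcc_mem hab _))
          (Icc_subset_Icc ha hb (clampIcc_mem hab _)) (clampIcc_mono hle))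
    · have m1 : max u a ∈ Icc a b := ⟨le_max_right _ _, hle.trans (min_le_right _ _)⟩
      have m2 : min v b ∈ Icc a b := ⟨(le_max_right _ _).trans hle, min_le_right _ _⟩
      rw [clampIcc_of_mem m1, clampIcc_of_mem m2,
        clampIcc_of_mem (Icc_subset_Icc ha hb m1), clampIcc_of_mem (Icc_subset_Icc ha hb m2)]

/-- The defect of additivity of `∫_s^t (y(t) - y(v)) dg(v)`. -/
lemma stieltjesIntegral_add_adjacent {g y : ℝ → ℝ} {c d : ℝ} (hg : MonotoneOn g (Icc c d))
    (hgc : ContinuousOn g (Icc c d)) (hy : ContinuousOn y (Icc c d)) {s u t : ℝ} (hs : c ≤ s)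
    (hsu : s ≤ u) (hut : u ≤ t) (ht : t ≤ d) :
    stieltjesIntegral (fun v => y u - y v) g s u + stieltjesIntegral (fun v => y t - y v) g u t +
      (y t - y u) * (g u - g s) = stieltjesIntegral (fun v => y t - y v) g s t := by
  obtain ⟨μ, hμ, hIoc, hint⟩ :=
    exists_stieltjes_measure (hs.trans (hsu.trans (hut.trans ht))) hg hgc
  rw [hint _ _ _ hs hsu (hut.trans ht), hint _ _ _ (hs.trans hsu) hut ht,
    hint _ _ _ hs (hsu.trans hut) ht]
  have hi : ∀ p q r, c ≤ p → q ≤ d → IntegrableOn (fun v => y r - y v) (Ioc p q) μ :=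
    fun p q r hp hq => ((continuousOn_const.sub (hy.mono (Icc_subset_Icc hp hq))).integrableOn_compact
      isCompact_Icc).mono_set Ioc_subset_Icc_self
  have hfin : μ (Ioc s u) ≠ ⊤ := by rw [hIoc s u hs hsu (hut.trans ht)]; exact ENNReal.ofReal_ne_top
  -- On the first interval, passing from `y u` to `y t` costs their difference times the mass of
  -- `(s, u]`; this is the whole defect.
  have h1 : ∫ v in Ioc s u, (y t - y v) ∂μ =
      ∫ v in Ioc s u, (y u - y v) ∂μ + (y t - y u) * (g u - g s) := by
    have : ∫ _v in Ioc s u, (y t - y u) ∂μ = (y t - y u) * (g u - g s) := by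
      rw [setIntegral_const, Measure.real, hIoc s u hs hsu (hut.trans ht), ENNReal.toReal_ofReal,
        smul_eq_mul, mul_comm]
      exact sub_nonneg.2 (hg ⟨hs, hsu.trans (hut.trans ht)⟩ ⟨hs.trans hsu, hut.trans ht⟩ hsu)
    rw [← this, ← integral_add (hi _ _ _ hs (hut.trans ht)) (integrableOn_const hfin)]
    congr 1
    ext v
    ring
  rw [← Ioc_union_Ioc_eq_Ioc hsu hut, setIntegral_union (Ioc_disjoint_Ioc_of_le le_rfl)
    measurableSet_Ioc (hi _ _ _ hs (hut.trans ht)) (hi _ _ _ (hs.trans hsu) ht), h1]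
  ring

lemma abs_stieltjesIntegral_le {f g : ℝ → ℝ} {a b M : ℝ} (hab : a ≤ b)
    (hg : MonotoneOn g (Icc a b)) (hgc : ContinuousOn g (Icc a b))
    (hf : ∀ v ∈ Icc a b, |f v| ≤ M) : |stieltjesIntegral f g a b| ≤ M * (g b - g a) := by
  obtain ⟨μ, hμ, hIoc, hint⟩ := exists_stieltjes_measure hab hg hgc
  rw [hint f a b le_rfl hab le_rfl]
  have e := hIoc a b le_rfl hab le_rfl
  have hfin : μ (Ioc a b) < ⊤ := by rw [e]; exact ENNReal.ofReal_lt_top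
  have hf' : ∀ v ∈ Ioc a b, ‖f v‖ ≤ M := fun v hv => hf v ⟨hv.1.le, hv.2⟩
  refine (norm_setIntegral_le_of_norm_le_const hfin hf').trans_eq ?_
  rw [Measure.real, e, ENNReal.toReal_ofReal]
  exact sub_nonneg.2 (hg ⟨le_rfl, hab⟩ ⟨hab, le_rfl⟩ hab)

/-! ### The regulator -/

section

variable {ι : Type*} [Fintype ι] {ξ ξ' : ℝ → EuclideanSpace ℝ ι} {s t M τ : ℝ}

lemma norm_le_card_mul {v : EuclideanSpace ℝ ι} (hM : ∀ i, |v i| ≤ M) :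
    ‖v‖ ≤ Fintype.card ι * M := by
  have h1 : ‖v‖ ≤ ∑ i, |v i| := by
    rw [EuclideanSpace.norm_eq, Real.sqrt_le_left (Finset.sum_nonneg fun _ _ => abs_nonneg _)]
    exact Finset.sum_sq_le_sq_sum_of_nonneg fun _ _ => abs_nonneg _
  refine h1.trans ((Finset.sum_le_sum fun i _ => hM i).trans_eq ?_)
  rw [Finset.sum_const, nsmul_eq_mul, Finset.card_univ]

lemma regulator_apply (ξ : ℝ → EuclideanSpace ℝ ι) (t : ℝ) (i : ι) :
    regulator ξ t i = sSup ((fun s => max (-(ξ s i)) 0) '' Icc 0 t) := rfl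

lemma bddAbove_regulator (hξ : ContinuousOn ξ (Icc 0 t)) (i : ι) :
    BddAbove ((fun s => max (-(ξ s i)) 0) '' Icc 0 t) :=
  isCompact_Icc.bddAbove_image
    ((((PiLp.continuous_apply 2 _ i).comp_continuousOn hξ).neg).sup continuousOn_const)

lemma le_regulator (hξ : ContinuousOn ξ (Icc 0 t)) (hs : s ∈ Icc 0 t) (i : ι) :
    max (-(ξ s i)) 0 ≤ regulator ξ t i :=
  le_csSup (bddAbove_regulator hξ i) (mem_image_of_mem _ hs)

lemma regulator_le (ht : 0 ≤ t) {i : ι} (h : ∀ s ∈ Icc 0 t, max (-(ξ s i)) 0 ≤ M) :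
    regulator ξ t i ≤ M := by
  refine csSup_le ((nonempty_Icc.2 ht).image _) ?_
  rintro _ ⟨s, hs, rfl⟩
  exact h s hs

lemma regulator_congr (h : ∀ s ∈ Icc 0 t, ξ s = ξ' s) : regulator ξ t = regulator ξ' t := by
  ext i
  rw [regulator_apply, regulator_apply]
  congr 1
  exact image_congr fun s hs => by rw [h s hs]

lemma regulator_zero (h : ∀ i, 0 ≤ ξ 0 i) : regulator ξ 0 = 0 := by
  ext i
  rw [regulator_apply, Icc_self, image_singleton, csSup_singleton]
  simpa using h i

lemma add_regulator_nonneg (hξ : ContinuousOn ξ (Icc 0 t)) (ht : 0 ≤ t) (i : ι) :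
    0 ≤ ξ t i + regulator ξ t i := by
  have := le_regulator hξ (⟨ht, le_rfl⟩ : t ∈ Icc 0 t) i
  linarith [le_max_left (-(ξ t i)) 0]

lemma regulator_monotoneOn (hξ : ContinuousOn ξ (Icc 0 τ)) (i : ι) :
    MonotoneOn (fun t => regulator ξ t i) (Icc 0 τ) := fun _ hs _ ht hst =>
  regulator_le hs.1 fun _ hu => le_regulator (hξ.mono (Icc_subset_Icc_right ht.2))
    ⟨hu.1, hu.2.trans hst⟩ i

lemma max_neg_le {p q M : ℝ} (h : |p - q| ≤ M) : max (-p) 0 ≤ max (-q) 0 + M := by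
  have := abs_le.1 h
  refine max_le ?_ ?_ <;> linarith [le_max_left (-q) 0, le_max_right (-q) 0, abs_nonneg (p - q)]

/-- In each coordinate a running maximum is `1`-Lipschitz in the supremum norm. The dimension is the
price of returning to the Euclidean norm. -/
lemma norm_regulator_sub_regulator_le (ht : 0 ≤ t) (hξ : ContinuousOn ξ (Icc 0 t))
    (hξ' : ContinuousOn ξ' (Icc 0 t)) (h : ∀ s ∈ Icc 0 t, ‖ξ s - ξ' s‖ ≤ M) :
    ‖regulator ξ t - regulator ξ' t‖ ≤ Fintype.card ι * M := by
  have hi : ∀ i, ∀ s ∈ Icc 0 t, |ξ s i - ξ' s i| ≤ M := fun i s hs =>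
    (PiLp.norm_apply_le (ξ s - ξ' s) i).trans (h s hs)
  refine norm_le_card_mul fun i => ?_
  rw [PiLp.sub_apply, abs_sub_le_iff]
  constructor
  · have : regulator ξ t i ≤ regulator ξ' t i + M := regulator_le ht fun s hs =>
      (max_neg_le (hi i s hs)).trans (add_le_add_left (le_regulator hξ' hs i) _)
    linarith
  · have : regulator ξ' t i ≤ regulator ξ t i + M := regulator_le ht fun s hs =>
      (max_neg_le (by rw [abs_sub_comm]; exact hi i s hs)).trans
        (add_le_add_left (le_regulator hξ hs i) _)
    linarith

lemma norm_regulator_le (ht : 0 ≤ t) (hξ : ContinuousOn ξ (Icc 0 t))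
    (h : ∀ s ∈ Icc 0 t, ‖ξ s‖ ≤ M) : ‖regulator ξ t‖ ≤ Fintype.card ι * M := by
  have := norm_regulator_sub_regulator_le (ξ' := 0) ht hξ continuousOn_const (M := M)
    (by simpa using h)
  have h0 : regulator (0 : ℝ → EuclideanSpace ℝ ι) t = 0 := by
    ext i
    rw [regulator_apply]
    have : (fun s => max (-((0 : ℝ → EuclideanSpace ℝ ι) s i)) 0) = fun _ => (0 : ℝ) := by
      ext; simp
    rw [this, (nonempty_Icc.2 ht).image_const, csSup_singleton]
    rfl
  rwa [h0, sub_zero] at this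

/-- Up to `s` the maximum is already accounted for, and after `s` the path deviates from `ξ s` by at
most `M`. In this way the regulator inherits Hölder continuity. -/
lemma norm_regulator_sub_le (hs : 0 ≤ s) (hst : s ≤ t) (hξ : ContinuousOn ξ (Icc 0 t))
    (h : ∀ u ∈ Icc s t, ‖ξ u - ξ s‖ ≤ M) :
    ‖regulator ξ t - regulator ξ s‖ ≤ Fintype.card ι * M := by
  refine norm_le_card_mul fun i => ?_
  have hM : 0 ≤ M := (norm_nonneg _).trans (h s ⟨le_rfl, hst⟩)
  have hmono := regulator_monotoneOn hξ i ⟨hs, hst⟩ ⟨hs.trans hst, le_rfl⟩ hst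
  rw [PiLp.sub_apply, abs_of_nonneg (sub_nonneg.2 hmono), sub_le_iff_le_add']
  have hξs := hξ.mono (Icc_subset_Icc_right hst)
  refine regulator_le (hs.trans hst) fun w hw => ?_
  rcases le_total w s with hws | hws
  · linarith [le_regulator hξs ⟨hw.1, hws⟩ i]
  · have h1 := (PiLp.norm_apply_le (ξ w - ξ s) i).trans (h w ⟨hws, hw.2⟩)
    exact (max_neg_le h1).trans
      (add_le_add_left (le_regulator hξs (⟨hs, le_rfl⟩ : s ∈ Icc 0 s) i) _)

end

/-! ### Multiplicative functionals: a criterion, translation and glueing -/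

section

variable {ι κ : Type*} [Fintype ι] [Fintype κ] {β a b c : ℝ}
  {x x' : ℝ → EuclideanSpace ℝ ι} {y : ℝ → EuclideanSpace ℝ κ} {A A' : ℝ → ℝ → ι → κ → ℝ}

lemma exists_holderOnWith_congr {E : Type*} [SeminormedAddCommGroup E] {S : Set ℝ} {p : NNReal}
    {x x' : ℝ → E} (h : ∃ C, HolderOnWith C p x S) (he : ∀ s ∈ S, x s = x' s) :
    ∃ C, HolderOnWith C p x' S :=
  h.imp fun _ hC s hs t ht => by rw [← he s hs, ← he t ht]; exact hC s hs t ht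

lemma exists_holderOnWith_union {E : Type*} [SeminormedAddCommGroup E] (hβ : 0 ≤ β) {x : ℝ → E}
    (h₁ : ∃ C, HolderOnWith C β.toNNReal x (Icc a c))
    (h₂ : ∃ C, HolderOnWith C β.toNNReal x (Icc c b)) :
    ∃ C, HolderOnWith C β.toNNReal x (Icc a b) := by
  obtain ⟨C₁, hC₁, h₁⟩ := exists_holder_bound hβ h₁
  obtain ⟨C₂, hC₂, h₂⟩ := exists_holder_bound hβ h₂
  refine exists_holderOnWith (C := C₁ + C₂) hβ fun s hs t ht hst => ?_
  have p0 : 0 ≤ |t - s| ^ β := by positivity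
  rcases le_total t c with htc | htc
  · refine (h₁ s ⟨hs.1, hst.trans htc⟩ t ⟨ht.1, htc⟩).trans ?_
    gcongr; linarith
  rcases le_total c s with hcs | hcs
  · refine (h₂ s ⟨hcs, hs.2⟩ t ⟨htc, ht.2⟩).trans ?_
    gcongr; linarith
  have e : x t - x s = (x t - x c) + (x c - x s) := by abel
  have h3 : |t - c| ≤ |t - s| := by
    rw [abs_of_nonneg (by linarith), abs_of_nonneg (by linarith)]; linarith
  have h4 : |c - s| ≤ |t - s| := by
    rw [abs_of_nonneg (by linarith), abs_of_nonneg (by linarith)]; linarith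
  rw [e, add_mul, add_comm (C₁ * _)]
  refine (norm_add_le _ _).trans (add_le_add ?_ ?_)
  · refine (h₂ c ⟨le_rfl, htc.trans ht.2⟩ t ⟨htc, ht.2⟩).trans ?_
    gcongr
  · refine (h₁ s ⟨hs.1, hcs⟩ c ⟨hs.1.trans hcs, le_rfl⟩).trans ?_
    gcongr

/-- The continuity of a multiplicative functional follows from its other properties. -/
lemma isMultFunctional_of_bound (hβ : 0 < β) (hx : ∃ C, HolderOnWith C β.toNNReal x (Icc a b))
    (hy : ∃ C, HolderOnWith C β.toNNReal y (Icc a b))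
    (hmult : ∀ s u t, a ≤ s → s ≤ u → u ≤ t → t ≤ b → ∀ i j,
      A s u i j + A u t i j + (x u i - x s i) * (y t j - y u j) = A s t i j) {C : ℝ}
    (hA : ∀ s t, a ≤ s → s ≤ t → t ≤ b → ∀ i j, |A s t i j| ≤ C * (t - s) ^ (2 * β)) :
    IsMultFunctional β a b x y A := by
  refine ⟨hx, hy, ?_, hmult, |C|, fun s t hs hst ht => ?_⟩
  · have hxc : ∀ i, ContinuousOn (fun v => x v i) (Icc a b) := fun i => by
      obtain ⟨K, hK⟩ := hx
      exact (PiLp.continuous_apply 2 _ i).comp_continuousOn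
        (hK.continuousOn (Real.toNNReal_pos.2 hβ))
    have hyc : ∀ j, ContinuousOn (fun v => y v j) (Icc a b) := fun j => by
      obtain ⟨K, hK⟩ := hy
      exact (PiLp.continuous_apply 2 _ j).comp_continuousOn
        (hK.continuousOn (Real.toNNReal_pos.2 hβ))
    -- By the multiplicative property, `A s t` is expressed by the one-parameter path `A a` and by
    -- increments of `x` and `y`, so it suffices that this path is continuous.
    have hP : ∀ i j, ContinuousOn (fun v => A a v i j) (Icc a b) := by
      intro i j
      obtain ⟨D, hD, hxD⟩ := exists_holder_bound hβ.le hx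
      obtain ⟨D', hD', hyD⟩ := exists_holder_bound hβ.le hy
      have key : ∃ K, HolderOnWith K β.toNNReal (fun v => A a v i j) (Icc a b) := by
        refine exists_holderOnWith (C := |C| * |b - a| ^ β + D * |b - a| ^ β * D') hβ.le
          fun s hs t ht hst => ?_
        have hts := sub_nonneg.2 hst
        have htb : t - s ≤ |b - a| := by
          refine le_trans ?_ (le_abs_self (b - a)); linarith [hs.1, ht.2]
        have hsb : s - a ≤ |b - a| := by
          refine le_trans ?_ (le_abs_self (b - a)); linarith [hs.2]
        have e : A a t i j - A a s i j = A s t i j + (x s i - x a i) * (y t j - y s j) := by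
          rw [← hmult a s t le_rfl hs.1 hst ht.2 i j]; ring
        have h1 := hA s t hs.1 hst ht.2 i j
        have h2 := (PiLp.norm_apply_le (x s - x a) i).trans
          (hxD a ⟨le_rfl, hs.1.trans hs.2⟩ s hs)
        have h3 := (PiLp.norm_apply_le (y t - y s) j).trans (hyD s hs t ht)
        rw [Real.norm_eq_abs, e, add_mul, abs_of_nonneg hts]
        rw [abs_of_nonneg (sub_nonneg.2 hs.1)] at h2
        rw [abs_of_nonneg hts] at h3
        have p0 := Real.rpow_nonneg hts β
        refine (abs_add_le _ _).trans (add_le_add (h1.trans ?_) ?_)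
        · have := rpow_le_mul_rpow hts htb hβ.le (by linarith : β ≤ 2 * β)
          rw [two_mul, add_sub_cancel_right, ← two_mul] at this
          rw [mul_assoc]
          exact mul_le_mul (le_abs_self C) this (Real.rpow_nonneg hts _) (abs_nonneg _)
        · rw [abs_mul, mul_assoc (D * _)]
          refine mul_le_mul (h2.trans ?_) h3 (abs_nonneg _) (by positivity)
          exact mul_le_mul_of_nonneg_left
            (Real.rpow_le_rpow (sub_nonneg.2 hs.1) hsb hβ.le) hD
      obtain ⟨K, hK⟩ := key
      exact hK.continuousOn (Real.toNNReal_pos.2 hβ)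
    have m1 : MapsTo Prod.fst {p : ℝ × ℝ | a ≤ p.1 ∧ p.1 < p.2 ∧ p.2 ≤ b} (Icc a b) :=
      fun p hp => ⟨hp.1, hp.2.1.le.trans hp.2.2⟩
    have m2 : MapsTo Prod.snd {p : ℝ × ℝ | a ≤ p.1 ∧ p.1 < p.2 ∧ p.2 ≤ b} (Icc a b) :=
      fun p hp => ⟨hp.1.trans hp.2.1.le, hp.2.2⟩
    refine continuousOn_pi.2 fun i => continuousOn_pi.2 fun j => ?_
    refine ((((hP i j).comp continuousOn_snd m2).sub ((hP i j).comp continuousOn_fst m1)).sub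
      ((((hxc i).comp continuousOn_fst m1).sub (continuousOn_const (c := x a i))).mul
      (((hyc j).comp continuousOn_snd m2).sub ((hyc j).comp continuousOn_fst m1)))).congr ?_
    rintro ⟨s, t⟩ ⟨h1, h2, h3⟩
    have := hmult a s t le_rfl h1 h2.le h3 i j
    change A s t i j = A a t i j - A a s i j - (x s i - x a i) * (y t j - y s j)
    linarith
  · have p0 := Real.rpow_nonneg (sub_nonneg.2 hst.le) (2 * β)
    refine (pi_norm_le_iff_of_nonneg (by positivity)).2 fun i =>
      (pi_norm_le_iff_of_nonneg (by positivity)).2 fun j =>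
        (hA s t hs hst.le ht i j).trans (mul_le_mul_of_nonneg_right (le_abs_self C) p0)

namespace IsMultFunctional

lemma congr (hβ : 0 < β) (h : IsMultFunctional β a b x y A) (hx : ∀ s ∈ Icc a b, x s = x' s)
    (hA : ∀ s t, a ≤ s → s ≤ t → t ≤ b → A s t = A' s t) : IsMultFunctional β a b x' y A' := by
  obtain ⟨C, -, -, -, hb⟩ := h.exists_bound hβ
  refine isMultFunctional_of_bound (C := C) hβ (exists_holderOnWith_congr h.holder_left hx)
    h.holder_right (fun s u t hs hsu hut ht i j => ?_) fun s t hs hst ht i j => ?_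
  · rw [← hx s ⟨hs, hsu.trans (hut.trans ht)⟩, ← hx u ⟨hs.trans hsu, hut.trans ht⟩,
      ← hA s u hs hsu (hut.trans ht), ← hA u t (hs.trans hsu) hut ht,
      ← hA s t hs (hsu.trans hut) ht]
    exact h.mult s u t hs hsu hut ht i j
  · rw [← hA s t hs hst ht]
    exact (abs_apply_le_norm _ i j).trans (hb s t hs hst ht)

lemma comp_sub (hβ : 0 < β) (h : IsMultFunctional β a b x y A) (r : ℝ) :
    IsMultFunctional β (a + r) (b + r) (fun v => x (v - r)) (fun v => y (v - r))
      fun s t => A (s - r) (t - r) := by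
  obtain ⟨C, -, hx, hy, hb⟩ := h.exists_bound hβ
  refine isMultFunctional_of_bound (C := C) hβ (exists_holderOnWith (C := C) hβ.le ?_)
    (exists_holderOnWith (C := C) hβ.le ?_)
    (fun s u t hs hsu hut ht i j => h.mult _ _ _ (by linarith) (by linarith) (by linarith)
      (by linarith) i j) fun s t hs hst ht i j => ?_
  · intro s hs t ht hst
    have := hx (s - r) (t - r) (by linarith [hs.1]) (by linarith) (by linarith [ht.2])
    rwa [sub_sub_sub_cancel_right, ← abs_of_nonneg (sub_nonneg.2 hst)] at this
  · intro s hs t ht hst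
    have := hy (s - r) (t - r) (by linarith [hs.1]) (by linarith) (by linarith [ht.2])
    rwa [sub_sub_sub_cancel_right, ← abs_of_nonneg (sub_nonneg.2 hst)] at this
  · have := hb (s - r) (t - r) (by linarith) (by linarith) (by linarith)
    rw [sub_sub_sub_cancel_right] at this
    exact (abs_apply_le_norm _ i j).trans this

/-- A multiplicative functional is determined by its values on two adjacent intervals. -/
lemma eq_of_eq (h : IsMultFunctional β a b x y A) (h' : IsMultFunctional β a b x' y A')
    (hx : ∀ s ∈ Icc a b, x s = x' s)
    (h₁ : ∀ s t, a ≤ s → s ≤ t → t ≤ c → t ≤ b → A s t = A' s t)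
    (h₂ : ∀ s t, a ≤ s → c ≤ s → s ≤ t → t ≤ b → A s t = A' s t) {s t : ℝ} (hs : a ≤ s) (hst : s ≤ t)
    (ht : t ≤ b) : A s t = A' s t := by
  rcases le_total t c with htc | htc
  · exact h₁ s t hs hst htc ht
  rcases le_total c s with hcs | hcs
  · exact h₂ s t hs hcs hst ht
  ext i j
  rw [← h.mult s c t hs hcs htc ht i j, ← h'.mult s c t hs hcs htc ht i j,
    h₁ s c hs hcs le_rfl (htc.trans ht), h₂ c t (hs.trans hcs) le_rfl htc ht,
    hx s ⟨hs, hst.trans ht⟩, hx c ⟨hs.trans hcs, htc.trans ht⟩]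

end IsMultFunctional

open Classical in
/-- The multiplicative functional which is `A` on `[a, c]` and `A'` to the right of `c`. -/
def glue (a c : ℝ) (x : ℝ → EuclideanSpace ℝ ι) (y : ℝ → EuclideanSpace ℝ κ)
    (A A' : ℝ → ℝ → ι → κ → ℝ) (s t : ℝ) (i : ι) (j : κ) : ℝ :=
  (if t ≤ c then A a t i j else A a c i j + A' c t i j + (x c i - x a i) * (y t j - y c j)) -
    (if s ≤ c then A a s i j else A a c i j + A' c s i j + (x c i - x a i) * (y s j - y c j)) -
    (x s i - x a i) * (y t j - y s j)

/-- The glued tensor is the increment of a one-parameter path minus a product anchored at `a`. The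
multiplicative property is therefore an algebraic identity, whatever `A`, `A'` and the order of the
times. -/
lemma glue_mult (s u t : ℝ) (i : ι) (j : κ) :
    glue a c x y A A' s u i j + glue a c x y A A' u t i j + (x u i - x s i) * (y t j - y u j) =
      glue a c x y A A' s t i j := by
  simp only [glue]
  ring

lemma glue_eq_left {b' : ℝ} (h : IsMultFunctional β a b' x y A) (hb' : b' ≤ c) {s t : ℝ}
    (hs : a ≤ s) (hst : s ≤ t) (ht : t ≤ b') : glue a c x y A A' s t = A s t := by
  ext i j
  rw [glue, if_pos (ht.trans hb'), if_pos (hst.trans (ht.trans hb')),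
    ← h.mult a s t le_rfl hs hst ht]
  ring

lemma glue_eq_right (h : IsMultFunctional β c b x y A') {s t : ℝ} (hs : c ≤ s) (hst : s ≤ t) (ht : t ≤ b) :
    glue a c x y A A' s t = A' s t := by
  have key : ∀ v, c ≤ v → v ≤ b → ∀ i j, (if v ≤ c then A a v i j else
      A a c i j + A' c v i j + (x c i - x a i) * (y v j - y c j)) =
      A a c i j + A' c v i j + (x c i - x a i) * (y v j - y c j) := by
    intro v hv hvb i j
    split_ifs with hvc
    · obtain rfl := le_antisymm hv hvc
      rw [h.diag le_rfl hvb]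
      simp
    · rfl
  ext i j
  rw [glue, key t (hs.trans hst) ht, key s hs (hst.trans ht), ← h.mult c s t le_rfl hs hst ht]
  ring

/-- Across `c` the tensor is the sum of the two given tensors and of a product of increments on
either side, whence the constant `C + D + C * D`. -/
lemma isMultFunctional_glue (hβ : 0 < β)
    (h₁ : IsMultFunctional β a c x y A) (h₂ : IsMultFunctional β c b x y A') :
    IsMultFunctional β a b x y (glue a c x y A A') := by
  obtain ⟨C, hC, hx, -, hA⟩ := h₁.exists_bound hβ
  obtain ⟨D, hD, -, hy, hA'⟩ := h₂.exists_bound hβ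
  have hCD := mul_nonneg hC hD
  refine isMultFunctional_of_bound (C := C + D + C * D) hβ
    (exists_holderOnWith_union hβ.le h₁.holder_left h₂.holder_left)
    (exists_holderOnWith_union hβ.le h₁.holder_right h₂.holder_right)
    (fun s u t _ _ _ _ i j => glue_mult s u t i j) fun s t hs hst ht i j => ?_
  have p0 := Real.rpow_nonneg (sub_nonneg.2 hst) (2 * β)
  rcases le_total t c with htc | htc
  · rw [glue_eq_left h₁ le_rfl hs hst htc]
    refine ((abs_apply_le_norm _ i j).trans (hA s t hs hst htc)).trans ?_
    gcongr; linarith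
  rcases le_total c s with hcs | hcs
  · rw [glue_eq_right h₂ hcs hst ht]
    refine ((abs_apply_le_norm _ i j).trans (hA' s t hcs hst ht)).trans ?_
    gcongr; linarith
  rw [← glue_mult s c t, glue_eq_left h₁ le_rfl hs hcs le_rfl,
    glue_eq_right h₂ le_rfl htc ht]
  have q1 : (c - s) ^ (2 * β) ≤ (t - s) ^ (2 * β) :=
    Real.rpow_le_rpow (by linarith) (by linarith) (by linarith)
  have q2 : (t - c) ^ (2 * β) ≤ (t - s) ^ (2 * β) :=
    Real.rpow_le_rpow (by linarith) (by linarith) (by linarith)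
  have q3 : (c - s) ^ β ≤ (t - s) ^ β := Real.rpow_le_rpow (by linarith) (by linarith) hβ.le
  have q4 : (t - c) ^ β ≤ (t - s) ^ β := Real.rpow_le_rpow (by linarith) (by linarith) hβ.le
  have q5 : 0 ≤ (t - s) ^ β := Real.rpow_nonneg (sub_nonneg.2 hst) _
  have h1 := (abs_apply_le_norm _ i j).trans (hA s c hs hcs le_rfl)
  have h2 := (abs_apply_le_norm _ i j).trans (hA' c t le_rfl htc ht)
  have h3 := (PiLp.norm_apply_le (x c - x s) i).trans (hx s c hs hcs le_rfl)
  have h4 := (PiLp.norm_apply_le (y t - y c) j).trans (hy c t le_rfl htc ht)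
  rw [add_mul, add_mul]
  refine (abs_add_le _ _).trans (add_le_add ((abs_add_le _ _).trans (add_le_add
    (h1.trans (by gcongr)) (h2.trans (by gcongr)))) ?_)
  rw [abs_mul, two_mul, Real.rpow_add_of_nonneg (sub_nonneg.2 hst) hβ.le hβ.le]
  calc _ ≤ (C * (t - s) ^ β) * (D * (t - s) ^ β) :=
        mul_le_mul (h3.trans (by gcongr)) (h4.trans (by gcongr)) (abs_nonneg _) (by positivity)
    _ = _ := by ring

end

/-! ### The drift, and the reflected equation with a given forcing -/

section

variable {d : ℕ} {r T : ℝ} {f g : C(Icc (-r) T, EuclideanSpace ℝ (Fin d))} {t M : ℝ}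

lemma supNorm_le (hM : 0 ≤ M) (h : ∀ s : Icc (-r) T, (s : ℝ) ≤ t → ‖f s‖ ≤ M) :
    supNorm f t ≤ M :=
  Real.sSup_le (by rintro _ ⟨u, hu, rfl⟩; exact h u hu) hM

lemma supNorm_le_norm (f : C(Icc (-r) T, EuclideanSpace ℝ (Fin d))) (t : ℝ) : supNorm f t ≤ ‖f‖ :=
  supNorm_le (norm_nonneg _) fun s _ => f.norm_coe_le_norm s

end

section

variable {d : ℕ} {r T β : ℝ} {ρ : ENNReal}
  {b : ℝ → C(Icc (-r) T, EuclideanSpace ℝ (Fin d)) → EuclideanSpace ℝ (Fin d)}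

namespace DriftHyp

lemma aestronglyMeasurable (hb : DriftHyp r T ρ b) (f) :
    AEStronglyMeasurable (fun s => b s f) (volume.restrict (Icc 0 T)) := by
  let _ : MeasurableSpace C(Icc (-r) T, EuclideanSpace ℝ (Fin d)) := borel _
  have h : Measurable fun s : Icc 0 T => b s f := hb.measurable.comp measurable_prodMk_right
  exact (aemeasurable_restrict_of_measurable_subtype measurableSet_Icc h).aestronglyMeasurable

/-- Hölder's inequality with exponent `1 / (1 - β)` gives the integrals of `b₀` the modulus `(t - s)
^ β`; this is the role of the lower bound on `ρ`. Passing to `|b₀|` preserves the growth bound. -/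
lemma exists_growth (hb : DriftHyp r T ρ b) (hβ : 0 < β) (hβ1 : β < 1)
    (hρ : ENNReal.ofReal (1 / (1 - β)) ≤ ρ) : ∃ (L B : ℝ) (b₀ : ℝ → ℝ), 0 < L ∧ 0 ≤ B ∧
      IntegrableOn b₀ (Icc 0 T) ∧
      (∀ f, ∀ t ∈ Icc 0 T, ‖b t f‖ ≤ L * supNorm f t + b₀ t) ∧
      ∀ s t, 0 ≤ s → s ≤ t → t ≤ T → ∫ v in s..t, b₀ v ≤ B * (t - s) ^ β := by
  obtain ⟨L, hL, b₀, hb₀, hgr⟩ := hb.growth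
  set p := ENNReal.ofReal (1 / (1 - β)) with hp
  have h1β : 0 < 1 - β := by linarith
  have hb₁ : MemLp (fun t => |b₀ t|) p (volume.restrict (Icc 0 T)) :=
    (hb₀.mono_exponent hρ).norm
  have hp1 : 1 ≤ p := by
    rw [hp, ← ENNReal.ofReal_one]
    refine ENNReal.ofReal_le_ofReal ?_
    rw [le_div_iff₀ h1β]; linarith
  have hpr : p.toReal = 1 / (1 - β) := ENNReal.toReal_ofReal (by positivity)
  have hint : IntegrableOn (fun t => |b₀ t|) (Icc 0 T) := hb₁.integrable hp1
  refine ⟨L, (eLpNorm (fun t => |b₀ t|) p (volume.restrict (Icc 0 T))).toReal, fun t => |b₀ t|, hL,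
    ENNReal.toReal_nonneg, hint,
    fun f t ht => (hgr f t ht).trans (by linarith [le_abs_self (b₀ t)]), fun s t hs hst ht => ?_⟩
  have hsub : Ioc s t ⊆ Icc 0 T := fun v hv => ⟨hs.trans hv.1.le, hv.2.trans ht⟩
  have hle : volume.restrict (Ioc s t) ≤ volume.restrict (Icc 0 T) := Measure.restrict_mono_set _ hsub
  have h1 := eLpNorm_le_eLpNorm_mul_rpow_measure_univ hp1 (hb₁.1.mono_measure hle)
  have h2 : eLpNorm (fun t => |b₀ t|) 1 (volume.restrict (Ioc s t)) =
      ENNReal.ofReal (∫ v in s..t, |b₀ v|) := by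
    rw [eLpNorm_one_eq_lintegral_enorm, intervalIntegral.integral_of_le hst,
      ofReal_integral_eq_lintegral_ofReal (hint.mono_set hsub)
        (Eventually.of_forall fun _ => abs_nonneg _)]
    refine lintegral_congr fun v => ?_
    rw [Real.enorm_eq_ofReal (abs_nonneg _)]
  rw [h2, Measure.restrict_apply_univ, Real.volume_Ioc, hpr] at h1
  have e : 1 / (1 : ENNReal).toReal - 1 / (1 / (1 - β)) = β := by
    rw [one_div_one_div]; simp
  rw [e, ENNReal.ofReal_rpow_of_nonneg (sub_nonneg.2 hst) hβ.le] at h1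
  have h3 := h1.trans (mul_le_mul_left (eLpNorm_mono_measure _ hle) _)
  have hfin := hb₁.eLpNorm_ne_top
  rw [← ENNReal.ofReal_toReal hfin, ← ENNReal.ofReal_mul ENNReal.toReal_nonneg] at h3
  exact (ENNReal.ofReal_le_ofReal_iff
    (mul_nonneg ENNReal.toReal_nonneg (Real.rpow_nonneg (sub_nonneg.2 hst) _))).1 h3

lemma integrableOn (hb : DriftHyp r T ρ b) (hβ : 0 < β) (hβ1 : β < 1)
    (hρ : ENNReal.ofReal (1 / (1 - β)) ≤ ρ) (f) : IntegrableOn (fun s => b s f) (Icc 0 T) := by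
  obtain ⟨L, B, b₀, hL, -, hi, hgr, -⟩ := hb.exists_growth hβ hβ1 hρ
  refine Integrable.mono' ((integrableOn_const (C := L * ‖f‖)
    (by rw [Real.volume_Icc]; exact ENNReal.ofReal_ne_top)).add hi)
    (hb.aestronglyMeasurable f) ?_
  filter_upwards [ae_restrict_mem measurableSet_Icc] with t ht
  exact (hgr f t ht).trans (add_le_add_left
    (mul_le_mul_of_nonneg_left (supNorm_le_norm f t) hL.le) _)

lemma intervalIntegrable (hb : DriftHyp r T ρ b) (hβ : 0 < β) (hβ1 : β < 1)
    (hρ : ENNReal.ofReal (1 / (1 - β)) ≤ ρ) (f) {s t : ℝ} (hs : 0 ≤ s) (hst : s ≤ t) (ht : t ≤ T) :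
    IntervalIntegrable (fun s => b s f) volume s t := by
  rw [intervalIntegrable_iff_integrableOn_Icc_of_le hst]
  exact (hb.integrableOn hβ hβ1 hρ f).mono_set (Icc_subset_Icc hs ht)

lemma exists_integral_norm_le (hb : DriftHyp r T ρ b) (hβ : 0 < β) (hβ1 : β < 1)
    (hρ : ENNReal.ofReal (1 / (1 - β)) ≤ ρ) (f) : ∃ K : ℝ, 0 ≤ K ∧
      ∀ s t, 0 ≤ s → s ≤ t → t ≤ T → ∫ v in s..t, ‖b v f‖ ≤ K * (t - s) ^ β := by
  obtain ⟨L, B, b₀, hL, hB, hi, hgr, hB'⟩ := hb.exists_growth hβ hβ1 hρ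
  refine ⟨L * ‖f‖ * |T| ^ (1 - β) + B, by positivity, fun s t hs hst ht => ?_⟩
  have hi' : IntervalIntegrable b₀ volume s t := by
    rw [intervalIntegrable_iff_integrableOn_Icc_of_le hst]
    exact hi.mono_set (Icc_subset_Icc hs ht)
  have h1 : ∫ v in s..t, ‖b v f‖ ≤ ∫ v in s..t, (L * ‖f‖ + b₀ v) := by
    refine intervalIntegral.integral_mono_on hst
      (hb.intervalIntegrable hβ hβ1 hρ f hs hst ht).norm
      (intervalIntegrable_const.add hi') fun v hv => ?_
    exact (hgr f v ⟨hs.trans hv.1, hv.2.trans ht⟩).trans (add_le_add_left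
      (mul_le_mul_of_nonneg_left (supNorm_le_norm f v) hL.le) _)
  rw [intervalIntegral.integral_add intervalIntegrable_const hi',
    intervalIntegral.integral_const, smul_eq_mul] at h1
  refine h1.trans ?_
  rw [add_mul]
  refine add_le_add ?_ (hB' s t hs hst ht)
  have hts := sub_nonneg.2 hst
  have := rpow_le_mul_rpow hts ((by linarith : t - s ≤ T).trans (le_abs_self T)) hβ.le hβ1.le
  rw [Real.rpow_one] at this
  calc (t - s) * (L * ‖f‖) ≤ (|T| ^ (1 - β) * (t - s) ^ β) * (L * ‖f‖) := by gcongr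
    _ = _ := by ring

end DriftHyp

/-- The unreflected path with the stochastic integral replaced by a given forcing path `J`. -/
def forcedPath (b : ℝ → C(Icc (-r) T, EuclideanSpace ℝ (Fin d)) → EuclideanSpace ℝ (Fin d))
    (p : EuclideanSpace ℝ (Fin d)) (J : ℝ → EuclideanSpace ℝ (Fin d))
    (x : C(Icc (-r) T, EuclideanSpace ℝ (Fin d))) (t : ℝ) : EuclideanSpace ℝ (Fin d) :=
  p + (∫ s in (0 : ℝ)..t, b s x) + J t

/-- The hypotheses on the data of the reflected equation with forcing `J`. -/
structure ForcedHyp (r T β : ℝ) (ρ : ENNReal)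
    (b : ℝ → C(Icc (-r) T, EuclideanSpace ℝ (Fin d)) → EuclideanSpace ℝ (Fin d))
    (J : ℝ → EuclideanSpace ℝ (Fin d)) : Prop where
  delay_pos : 0 < r
  horizon_pos : 0 < T
  beta_pos : 0 < β
  beta_lt : β < 1
  exponent_le : ENNReal.ofReal (1 / (1 - β)) ≤ ρ
  drift : DriftHyp r T ρ b
  holder : ∃ K : ℝ, 0 ≤ K ∧ ∀ s t, 0 ≤ s → s ≤ t → t ≤ T → ‖J t - J s‖ ≤ K * (t - s) ^ β

variable {J J' : ℝ → EuclideanSpace ℝ (Fin d)} {p : EuclideanSpace ℝ (Fin d)}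
  {x x' : C(Icc (-r) T, EuclideanSpace ℝ (Fin d))}

namespace ForcedHyp

lemma intervalIntegrable (h : ForcedHyp r T β ρ b J) (x) {s t : ℝ} (hs : 0 ≤ s) (hst : s ≤ t)
    (ht : t ≤ T) : IntervalIntegrable (fun s => b s x) volume s t :=
  h.drift.intervalIntegrable h.beta_pos h.beta_lt h.exponent_le x hs hst ht

lemma exists_holder_forcedPath (h : ForcedHyp r T β ρ b J) (p) (x) : ∃ K : ℝ, 0 ≤ K ∧
    ∀ s t, 0 ≤ s → s ≤ t → t ≤ T →
      ‖forcedPath b p J x t - forcedPath b p J x s‖ ≤ K * (t - s) ^ β := by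
  obtain ⟨K, hK, hJ⟩ := h.holder
  obtain ⟨K', hK', hb⟩ := h.drift.exists_integral_norm_le h.beta_pos h.beta_lt h.exponent_le x
  refine ⟨K' + K, by positivity, fun s t hs hst ht => ?_⟩
  have e : forcedPath b p J x t - forcedPath b p J x s = (∫ v in s..t, b v x) + (J t - J s) := by
    rw [← intervalIntegral.integral_interval_sub_left
      (h.intervalIntegrable x le_rfl (hs.trans hst) ht)
      (h.intervalIntegrable x le_rfl hs (hst.trans ht))]
    simp only [forcedPath]
    abel
  rw [e, add_mul]
  exact (norm_add_le _ _).trans (add_le_add ((intervalIntegral.norm_integral_le_integral_norm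
    hst).trans (hb s t hs hst ht)) (hJ s t hs hst ht))

lemma exists_holder_regulator (h : ForcedHyp r T β ρ b J) (p) (x) :
    ContinuousOn (forcedPath b p J x) (Icc 0 T) ∧ ∃ K : ℝ, 0 ≤ K ∧
    ∀ s t, 0 ≤ s → s ≤ t → t ≤ T →
      ‖regulator (forcedPath b p J x) t - regulator (forcedPath b p J x) s‖ ≤ K * (t - s) ^ β := by
  obtain ⟨K, hK, hF⟩ := h.exists_holder_forcedPath p x
  have hc : ContinuousOn (forcedPath b p J x) (Icc 0 T) := by
    obtain ⟨C, hC⟩ := exists_holderOnWith (S := Icc 0 T) (C := K) h.beta_pos.le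
      fun s hs t ht hst => by
        rw [abs_of_nonneg (sub_nonneg.2 hst)]
        exact hF s t hs.1 hst ht.2
    exact hC.continuousOn (Real.toNNReal_pos.2 h.beta_pos)
  refine ⟨hc, Fintype.card (Fin d) * K, by positivity, fun s t hs hst ht => ?_⟩
  rw [mul_assoc]
  refine norm_regulator_sub_le hs hst (hc.mono (Icc_subset_Icc_right ht)) fun u hu => ?_
  refine (hF s u hs hu.1 (hu.2.trans ht)).trans (mul_le_mul_of_nonneg_left
    (Real.rpow_le_rpow (sub_nonneg.2 hu.1) (by linarith [hu.2]) h.beta_pos.le) hK)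

lemma continuousOn_regulator (h : ForcedHyp r T β ρ b J) (p) (x) :
    ContinuousOn (regulator (forcedPath b p J x)) (Icc 0 T) := by
  obtain ⟨-, K, hK, hF⟩ := h.exists_holder_regulator p x
  obtain ⟨C, hC⟩ := exists_holderOnWith (S := Icc 0 T) (C := K) h.beta_pos.le
    fun s hs t ht hst => by
      rw [abs_of_nonneg (sub_nonneg.2 hst)]
      exact hF s t hs.1 hst ht.2
  exact hC.continuousOn (Real.toNNReal_pos.2 h.beta_pos)

/-- One step of the Picard iteration. -/
lemma norm_sub_le_of_le (h : ForcedHyp r T β ρ b J) (p) {L N U τ : ℝ} {n : ℕ} (hL : 0 ≤ L)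
    (hU : 0 ≤ U) (hlip : ∀ f g : C(Icc (-r) T, EuclideanSpace ℝ (Fin d)), ‖f‖ ≤ N → ‖g‖ ≤ N →
      ∀ t ∈ Icc 0 T, ‖b t f - b t g‖ ≤ L * supNorm (f - g) t)
    (hx : ‖x‖ ≤ N) (hx' : ‖x'‖ ≤ N) (hτ : τ ≤ T)
    (hn : ∀ s : Icc (-r) T, (s : ℝ) ≤ τ →
      ‖x s - x' s‖ ≤ U * (((1 + d) * L * max (s : ℝ) 0) ^ n / n.factorial)) {t : ℝ} (ht : 0 ≤ t)
    (htτ : t ≤ τ) :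
    ‖(forcedPath b p J x t + regulator (forcedPath b p J x) t) -
      (forcedPath b p J x' t + regulator (forcedPath b p J x') t)‖ ≤
      U * (((1 + d) * L * t) ^ (n + 1) / (n + 1).factorial) := by
  -- The drift contributes the factor `L`, and `1 + d` counts the unreflected path and its
  -- regulator, which has Lipschitz constant `d`.
  set k : ℝ := (1 + d) * L with hk
  have hk0 : 0 ≤ k := by positivity
  have hsup : ∀ v ∈ Icc 0 t, supNorm (x - x') v ≤ U * ((k * v) ^ n / n.factorial) := by
    intro v hv
    have hkv : 0 ≤ k * v := mul_nonneg hk0 hv.1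
    refine supNorm_le (by positivity) fun s hs => ?_
    refine (hn s (hs.trans (hv.2.trans htτ))).trans ?_
    have : max (s : ℝ) 0 ≤ v := max_le hs hv.1
    gcongr
  set c : ℝ := L * U * (k ^ n / n.factorial) with hc
  have hc0 : 0 ≤ c := by positivity
  have hF : ∀ s ∈ Icc 0 t, ‖forcedPath b p J x s - forcedPath b p J x' s‖ ≤
      c * (t ^ (n + 1) / (n + 1)) := by
    intro s hs
    have e : forcedPath b p J x s - forcedPath b p J x' s = ∫ v in (0 : ℝ)..s, (b v x - b v x') := by
      rw [intervalIntegral.integral_sub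
        (h.intervalIntegrable x le_rfl hs.1 (hs.2.trans (htτ.trans hτ)))
        (h.intervalIntegrable x' le_rfl hs.1 (hs.2.trans (htτ.trans hτ)))]
      simp only [forcedPath]
      abel
    rw [e]
    have h1 : ‖∫ v in (0 : ℝ)..s, (b v x - b v x')‖ ≤ ∫ v in (0 : ℝ)..s, c * v ^ n := by
      refine intervalIntegral.norm_integral_le_of_norm_le hs.1 (Eventually.of_forall fun v hv => ?_)
        (Continuous.intervalIntegrable (by fun_prop) _ _)
      have hv' : v ∈ Icc 0 t := ⟨hv.1.le, hv.2.trans hs.2⟩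
      refine (hlip x x' hx hx' v ⟨hv'.1, hv'.2.trans (htτ.trans hτ)⟩).trans
        ((mul_le_mul_of_nonneg_left (hsup v hv') hL).trans_eq ?_)
      rw [hc, mul_pow]; ring
    refine h1.trans ?_
    rw [intervalIntegral.integral_const_mul, integral_pow]
    have : s ^ (n + 1) ≤ t ^ (n + 1) := pow_le_pow_left₀ hs.1 hs.2 _
    rw [zero_pow (Nat.succ_ne_zero n), sub_zero]
    gcongr
  have hct : Icc 0 t ⊆ Icc 0 T := Icc_subset_Icc_right (htτ.trans hτ)
  have hreg := norm_regulator_sub_regulator_le ht ((h.exists_holder_regulator p x).1.mono hct)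
    ((h.exists_holder_regulator p x').1.mono hct) hF
  rw [Fintype.card_fin] at hreg
  rw [add_sub_add_comm]
  refine (norm_add_le _ _).trans ((add_le_add (hF t ⟨ht, le_rfl⟩) hreg).trans_eq ?_)
  have hfac : ((n + 1).factorial : ℝ) = (n + 1) * n.factorial := by
    rw [Nat.factorial_succ]; push_cast; ring
  have : (n.factorial : ℝ) ≠ 0 := by positivity
  have : (n + 1 : ℝ) ≠ 0 := by positivity
  have e : c * (t ^ (n + 1) / (n + 1)) + d * (c * (t ^ (n + 1) / (n + 1))) =
      ((1 + d) * L) * (U * (k ^ n / n.factorial) * (t ^ (n + 1) / (n + 1))) := by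
    rw [hc]; ring
  rw [e, ← hk, hfac, mul_pow k t, pow_succ k]
  field_simp

/-- Two solutions with the same forcing coincide. -/
theorem eq_of_forced (h : ForcedHyp r T β ρ b J) {τ : ℝ} (hτ : τ ≤ T)
    (h0 : ∀ t : Icc (-r) T, (t : ℝ) ≤ 0 → x t = x' t)
    (hx : ∀ t : Icc (-r) T, 0 < (t : ℝ) → (t : ℝ) ≤ τ →
      x t = forcedPath b p J x t + regulator (forcedPath b p J x) t)
    (hx' : ∀ t : Icc (-r) T, 0 < (t : ℝ) → (t : ℝ) ≤ τ →
      x' t = forcedPath b p J x' t + regulator (forcedPath b p J x') t)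
    {t : Icc (-r) T} (ht : (t : ℝ) ≤ τ) : x t = x' t := by
  obtain ⟨L, hL, hlip⟩ := h.drift.lipschitz (max ‖x‖ ‖x'‖) (by positivity)
  -- The Picard estimate is iterated from the trivial bound by `‖x - x'‖`, and the factorials force
  -- the difference to vanish. The equation is used only up to `τ`; the rest of the paths enters
  -- through constants.
  have key : ∀ n : ℕ, ∀ s : Icc (-r) T, (s : ℝ) ≤ τ →
      ‖x s - x' s‖ ≤ ‖x - x'‖ * (((1 + d) * L * max (s : ℝ) 0) ^ n / n.factorial) := by
    intro n
    induction n with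
    | zero => intro s _; simpa using (x - x').norm_coe_le_norm s
    | succ n ih =>
      intro s hs
      rcases le_or_gt (s : ℝ) 0 with hs0 | hs0
      · rw [h0 s hs0, sub_self, norm_zero]
        positivity
      · rw [hx s hs0 hs, hx' s hs0 hs, max_eq_left hs0.le]
        exact h.norm_sub_le_of_le p hL.le (norm_nonneg _) hlip (le_max_left _ _) (le_max_right _ _)
          hτ ih hs0.le hs
  have hlim := (FloorSemiring.tendsto_pow_div_factorial_atTop
    ((1 + d) * L * max (t : ℝ) 0)).const_mul ‖x - x'‖
  rw [mul_zero] at hlim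
  have := ge_of_tendsto' hlim fun n => key n t ht
  exact sub_eq_zero.1 (norm_le_zero_iff.1 this)

end ForcedHyp

/-- Some iterate is a contraction. Its unique fixed point is also fixed by the map, because the map
commutes with its iterates. -/
lemma exists_fixedPoint_of_iterate {X : Type*} [MetricSpace X] [CompleteSpace X] [Nonempty X]
    {Φ : X → X} {c : ℕ → ℝ} (hc : Tendsto c atTop (𝓝 0))
    (h : ∀ n x y, dist (Φ^[n] x) (Φ^[n] y) ≤ c n * dist x y) : ∃ x, Φ x = x := by
  obtain ⟨n, hn⟩ := (hc.eventually_lt_const one_pos).exists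
  have hcon : ContractingWith (c n).toNNReal Φ^[n] := by
    refine ⟨by simpa using hn, LipschitzWith.of_dist_le_mul fun x y => (h n x y).trans ?_⟩
    exact mul_le_mul_of_nonneg_right (Real.le_coe_toNNReal _) dist_nonneg
  exact ⟨_, hcon.isFixedPt_fixedPoint_iterate⟩

/-- The Picard map. -/
def picardMap (b : ℝ → C(Icc (-r) T, EuclideanSpace ℝ (Fin d)) → EuclideanSpace ℝ (Fin d))
    (η J : ℝ → EuclideanSpace ℝ (Fin d)) (x : C(Icc (-r) T, EuclideanSpace ℝ (Fin d))) (t : ℝ) :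
    EuclideanSpace ℝ (Fin d) :=
  η (min t 0) - η 0 +
    (forcedPath b (η 0) J x (max t 0) + regulator (forcedPath b (η 0) J x) (max t 0))

namespace ForcedHyp

variable {η : ℝ → EuclideanSpace ℝ (Fin d)}

/-- The truncations `min t 0` and `max t 0` put the initial segment and the equation into one
formula, so continuity at `0` needs no separate argument. -/
lemma continuousOn_picardMap (h : ForcedHyp r T β ρ b J) (hη : ContinuousOn η (Icc (-r) 0)) (x) :
    ContinuousOn (picardMap b η J x) (Icc (-r) T) := by
  have h1 : MapsTo (fun t : ℝ => min t 0) (Icc (-r) T) (Icc (-r) 0) := fun t ht =>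
    ⟨le_min ht.1 (by linarith [h.delay_pos]), min_le_right _ _⟩
  have h2 : MapsTo (fun t : ℝ => max t 0) (Icc (-r) T) (Icc 0 T) := fun t ht =>
    ⟨le_max_right _ _, max_le ht.2 h.horizon_pos.le⟩
  exact ((hη.comp (by fun_prop) h1).sub continuousOn_const).add
    (((h.exists_holder_regulator (η 0) x).1.comp (by fun_prop) h2).add
      ((h.continuousOn_regulator (η 0) x).comp (by fun_prop) h2))

/-- At time `0` the unreflected path is `η 0 ≥ 0`, so the regulator vanishes and the two pieces
match. -/
lemma picardMap_of_nonpos (hJ : J 0 = 0) (hη0 : ∀ i, 0 ≤ η 0 i) (x) {t : ℝ} (ht : t ≤ 0) :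
    picardMap b η J x t = η t := by
  have e : forcedPath b (η 0) J x 0 = η 0 := by simp [forcedPath, hJ]
  rw [picardMap, min_eq_left ht, max_eq_right ht, e, regulator_zero (by rw [e]; exact hη0)]
  abel

lemma picardMap_of_nonneg (x) {t : ℝ} (ht : 0 ≤ t) : picardMap b η J x t =
    forcedPath b (η 0) J x t + regulator (forcedPath b (η 0) J x) t := by
  rw [picardMap, min_eq_right ht, max_eq_left ht, sub_self, zero_add]

/-- A bound for the solution which the Picard map preserves. -/
lemma exists_invariant (h : ForcedHyp r T β ρ b J) (hη : ContinuousOn η (Icc (-r) 0))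
    (hJ : J 0 = 0) (hη0 : ∀ i, 0 ≤ η 0 i) : ∃ M l : ℝ, 0 ≤ M ∧ 0 ≤ l ∧
      ∀ x : C(Icc (-r) T, EuclideanSpace ℝ (Fin d)),
        (∀ t : Icc (-r) T, ‖x t‖ ≤ M * Real.exp (l * max (t : ℝ) 0)) →
        ∀ t : Icc (-r) T, ‖picardMap b η J x t‖ ≤ M * Real.exp (l * max (t : ℝ) 0) := by
  obtain ⟨L, B, b₀, hL, hB, hi, hgr, hB'⟩ := h.drift.exists_growth h.beta_pos h.beta_lt h.exponent_le
  obtain ⟨K, hK, hJK⟩ := h.holder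
  obtain ⟨Cη, hCη⟩ := isCompact_Icc.exists_bound_of_continuousOn hη
  have hT := h.horizon_pos
  set c : ℝ := ‖η 0‖ + B * T ^ β + K * T ^ β with hc
  have hc0 : 0 ≤ c := by positivity
  set k : ℝ := 1 + d with hk
  have hk1 : 0 < k := by positivity
  -- With this rate the drift contributes `k * L * M / l = M / 2` times the exponential. The summand
  -- `2 * k * c` of `M` reserves the other half for the constants, and `|Cη|` covers the initial
  -- segment.
  set l : ℝ := 2 * k * L with hl
  have hl0 : 0 < l := by positivity
  set M : ℝ := 2 * k * c + |Cη| with hM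
  have hM0 : 0 ≤ M := by positivity
  refine ⟨M, l, hM0, hl0.le, fun x hx t => ?_⟩
  rcases le_or_gt (t : ℝ) 0 with ht | ht
  · rw [picardMap_of_nonpos hJ hη0 x ht, max_eq_right ht, mul_zero, Real.exp_zero, mul_one]
    refine (hCη t ⟨t.2.1, ht⟩).trans ((le_abs_self _).trans ?_)
    have : 0 ≤ 2 * k * c := by positivity
    linarith
  rw [picardMap_of_nonneg x ht.le, max_eq_left ht.le]
  have hF : ∀ s ∈ Icc 0 (t : ℝ), ‖forcedPath b (η 0) J x s‖ ≤
      c + L * M / l * Real.exp (l * t) := by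
    intro s hs
    have hsT : s ≤ T := hs.2.trans t.2.2
    have hrp : s ^ β ≤ T ^ β := Real.rpow_le_rpow hs.1 hsT h.beta_pos.le
    have h1 : ‖J s‖ ≤ K * T ^ β := by
      have := hJK 0 s le_rfl hs.1 hsT
      rw [hJ, sub_zero, sub_zero] at this
      exact this.trans (mul_le_mul_of_nonneg_left hrp hK)
    have hib : IntervalIntegrable b₀ volume 0 s := by
      rw [intervalIntegrable_iff_integrableOn_Icc_of_le hs.1]
      exact hi.mono_set (Icc_subset_Icc_right hsT)
    have hexp : IntervalIntegrable (fun v => L * M * Real.exp (l * v)) volume 0 s :=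
      Continuous.intervalIntegrable (by fun_prop) _ _
    have h2 : ‖∫ v in (0 : ℝ)..s, b v x‖ ≤ ∫ v in (0 : ℝ)..s, (L * M * Real.exp (l * v) + b₀ v) := by
      refine intervalIntegral.norm_integral_le_of_norm_le hs.1 (Eventually.of_forall fun v hv => ?_)
        (hexp.add hib)
      refine (hgr x v ⟨hv.1.le, hv.2.trans hsT⟩).trans (add_le_add_left ?_ _)
      rw [mul_assoc]
      refine mul_le_mul_of_nonneg_left (supNorm_le (by positivity) fun w hw => (hx w).trans ?_) hL.le
      have : max (w : ℝ) 0 ≤ v := max_le hw hv.1.le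
      gcongr
    have h3 : ∫ v in (0 : ℝ)..s, L * M * Real.exp (l * v) ≤ L * M / l * Real.exp (l * t) := by
      have hd : ∀ v ∈ uIcc 0 s, HasDerivAt (fun v => L * M / l * Real.exp (l * v))
          (L * M * Real.exp (l * v)) v := by
        intro v _
        have e : L * M * Real.exp (l * v) = L * M / l * (Real.exp (l * v) * (l * 1)) := by
          field_simp
        rw [e]
        exact (((hasDerivAt_id v).const_mul l).exp).const_mul (L * M / l)
      rw [intervalIntegral.integral_eq_sub_of_hasDerivAt hd hexp]
      have h4 : Real.exp (l * s) ≤ Real.exp (l * t) :=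
        Real.exp_le_exp.2 (mul_le_mul_of_nonneg_left hs.2 hl0.le)
      have h5 : 0 ≤ L * M / l := by positivity
      have h6 : 0 ≤ L * M / l * Real.exp (l * 0) := by positivity
      linarith [mul_le_mul_of_nonneg_left h4 h5]
    rw [intervalIntegral.integral_add hexp hib] at h2
    have h7 := hB' 0 s le_rfl hs.1 hsT
    rw [sub_zero] at h7
    have h8 := mul_le_mul_of_nonneg_left hrp hB
    have h9 : ‖forcedPath b (η 0) J x s‖ ≤ ‖η 0‖ + ‖∫ v in (0 : ℝ)..s, b v x‖ + ‖J s‖ :=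
      norm_add₃_le
    linarith
  have hreg := norm_regulator_le ht.le
    ((h.exists_holder_regulator (η 0) x).1.mono (Icc_subset_Icc_right t.2.2)) hF
  rw [Fintype.card_fin] at hreg
  have h1 := hF t ⟨ht.le, le_rfl⟩
  have e1 : 1 ≤ Real.exp (l * t) := Real.one_le_exp (by positivity)
  calc _ ≤ k * (c + L * M / l * Real.exp (l * t)) := by
        refine (norm_add_le _ _).trans ((add_le_add h1 hreg).trans_eq ?_)
        rw [hk]; ring
    _ = k * c + M / 2 * Real.exp (l * t) := by
        rw [hl]; field_simp
    _ ≤ M / 2 * Real.exp (l * t) + M / 2 * Real.exp (l * t) := by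
        refine add_le_add_left ?_ _
        have : k * c ≤ M / 2 := by rw [hM]; linarith [abs_nonneg Cη]
        nlinarith
    _ = _ := by ring

/-- Existence of a solution of the reflected equation with a given forcing. -/
theorem exists_forced (h : ForcedHyp r T β ρ b J) (hη : ContinuousOn η (Icc (-r) 0))
    (hJ : J 0 = 0) (hη0 : ∀ i, 0 ≤ η 0 i) :
    ∃ x : C(Icc (-r) T, EuclideanSpace ℝ (Fin d)), (∀ t : Icc (-r) T, (t : ℝ) ≤ 0 → x t = η t) ∧
      ∀ t : Icc (-r) T, 0 ≤ (t : ℝ) →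
        x t = forcedPath b (η 0) J x t + regulator (forcedPath b (η 0) J x) t := by
  obtain ⟨M, l, hM, hl, hinv⟩ := h.exists_invariant hη hJ hη0
  -- The drift is Lipschitz only on bounded sets. On this invariant closed set all paths are bounded
  -- by `N`, so one Lipschitz constant serves for all iterates.
  set S : Set C(Icc (-r) T, EuclideanSpace ℝ (Fin d)) :=
    {x | ∀ t : Icc (-r) T, ‖x t‖ ≤ M * Real.exp (l * max (t : ℝ) 0)} with hS
  have hclosed : IsClosed S := by
    have : S = ⋂ t : Icc (-r) T, {x | ‖x t‖ ≤ M * Real.exp (l * max (t : ℝ) 0)} := by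
      ext x; simp [hS]
    rw [this]
    refine isClosed_iInter fun t => isClosed_le ?_ continuous_const
    exact (continuous_eval_const t).norm
  have : CompleteSpace S := hclosed.completeSpace_coe
  have : Nonempty S := ⟨⟨0, fun t => by
    rw [ContinuousMap.zero_apply, norm_zero]; positivity⟩⟩
  set N : ℝ := M * Real.exp (l * T) with hN
  have hN0 : 0 ≤ N := by positivity
  have hSN : ∀ x ∈ S, ‖x‖ ≤ N := fun x hx => (ContinuousMap.norm_le x hN0).2 fun t => by
    refine (hx t).trans ?_
    have : max (t : ℝ) 0 ≤ T := max_le t.2.2 h.horizon_pos.le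
    rw [hN]
    gcongr
  set Φ : S → S := fun x => ⟨⟨(Icc (-r) T).domRestrict (picardMap b η J x),
    (h.continuousOn_picardMap hη x).domRestrict⟩, hinv x x.2⟩ with hΦ
  have hΦ_apply : ∀ (x : S) (t : Icc (-r) T), (Φ x).1 t = picardMap b η J x t := fun _ _ => rfl
  obtain ⟨L, hL, hlip⟩ := h.drift.lipschitz N hN0
  have key : ∀ n (x y : S), ∀ t : Icc (-r) T, ‖(Φ^[n] x).1 t - (Φ^[n] y).1 t‖ ≤
      dist x y * (((1 + d) * L * max (t : ℝ) 0) ^ n / n.factorial) := by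
    intro n x y
    induction n with
    | zero =>
      intro t
      simpa [Subtype.dist_eq, dist_eq_norm] using (x.1 - y.1).norm_coe_le_norm t
    | succ n ih =>
      intro t
      rw [Function.iterate_succ_apply', Function.iterate_succ_apply', hΦ_apply, hΦ_apply]
      rcases le_or_gt (t : ℝ) 0 with ht | ht
      · rw [picardMap_of_nonpos hJ hη0 _ ht, picardMap_of_nonpos hJ hη0 _ ht, sub_self, norm_zero]
        positivity
      · rw [picardMap_of_nonneg _ ht.le, picardMap_of_nonneg _ ht.le, max_eq_left ht.le]
        exact h.norm_sub_le_of_le (η 0) hL.le dist_nonneg hlip (hSN _ (Φ^[n] x).2)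
          (hSN _ (Φ^[n] y).2) t.2.2 (fun s _ => ih s) ht.le le_rfl
  obtain ⟨x, hx⟩ := exists_fixedPoint_of_iterate (Φ := Φ)
    (FloorSemiring.tendsto_pow_div_factorial_atTop ((1 + d) * L * T)) fun n x y => by
      rw [Subtype.dist_eq (Φ^[n] x), dist_eq_norm]
      have hT := h.horizon_pos
      refine (ContinuousMap.norm_le _ (by positivity)).2 fun t => (key n x y t).trans ?_
      have : max (t : ℝ) 0 ≤ T := max_le t.2.2 h.horizon_pos.le
      rw [mul_comm]
      gcongr
  have hx' : ∀ t : Icc (-r) T, x.1 t = picardMap b η J x t := fun t => by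
    conv_lhs => rw [← hx]
    rfl
  exact ⟨x, fun t ht => (hx' t).trans (picardMap_of_nonpos hJ hη0 _ ht),
    fun t ht => (hx' t).trans (picardMap_of_nonneg _ ht)⟩

end ForcedHyp

end

/-! ### Locality of the integral, and weighted Lebesgue integrals -/

section

variable {ι κ : Type*} [Fintype ι] [Fintype κ] [DecidableEq ι] {α β a b q : ℝ}
  {x x' : ℝ → EuclideanSpace ℝ ι} {y : ℝ → EuclideanSpace ℝ κ} {A A' : ℝ → ℝ → ι → κ → ℝ}
  {f : EuclideanSpace ℝ ι → κ → ℝ}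

lemma hnIntegral_self (α : ℝ) (f : EuclideanSpace ℝ ι → κ → ℝ) (x : ℝ → EuclideanSpace ℝ ι)
    (y : ℝ → EuclideanSpace ℝ κ) (A : ℝ → ℝ → ι → κ → ℝ) (a : ℝ) :
    hnIntegral α f x y A a a = 0 := by
  simp [hnIntegral]

lemma hnGerm_congr {s t : ℝ} (hx : x s = x' s) (hA : A s t = A' s t) :
    hnGerm f x y A s t = hnGerm f x' y A' s t := by
  rw [hnGerm, hnGerm, hx, hA]

lemma hnIntegral_congr (hE : Exponents α β q) (h : IsMultFunctional β a b x y A)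
    (h' : IsMultFunctional β a b x' y A') (hf : IsControlled β q a b f x)
    (hf' : IsControlled β q a b f x') (hx : ∀ s ∈ Icc a b, x s = x' s)
    (hA : ∀ s t, a ≤ s → s ≤ t → t ≤ b → A s t = A' s t) {s t : ℝ} (hs : a ≤ s) (hst : s ≤ t)
    (ht : t ≤ b) : hnIntegral α f x y A s t = hnIntegral α f x' y A' s t :=
  (isRiemannLimit_hnIntegral hE h hf hs hst ht).unique
    ((isRiemannLimit_hnIntegral hE h' hf' hs hst ht).congr fun u v hu huv hv =>
      (hnGerm_congr (hx u ⟨hs.trans hu, huv.trans (hv.trans ht)⟩)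
        (hA u v (hs.trans hu) huv (hv.trans ht))).symm) hst

lemma exists_abs_hnIntegral_le (hE : Exponents α β q) (h : IsMultFunctional β a b x y A)
    (hf : IsControlled β q a b f x) : ∃ K : ℝ, 0 ≤ K ∧ ∀ s t, a ≤ s → s ≤ t → t ≤ b →
      |hnIntegral α f x y A s t| ≤ K * (t - s) ^ β := by
  obtain ⟨K, hK, h1⟩ := exists_abs_hnIntegral_sub_hnGerm_le hE h hf
  obtain ⟨K', hK', h2⟩ := exists_abs_hnGerm_le hE.beta_pos h hf
  refine ⟨K * |b - a| ^ (q + 2 * β - β) + K', by positivity, fun s t hs hst ht => ?_⟩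
  have htb : t - s ≤ |b - a| := (by linarith : t - s ≤ b - a).trans (le_abs_self _)
  have h3 := rpow_le_mul_rpow (sub_nonneg.2 hst) htb hE.beta_pos.le
    (by linarith [hE.q_pos, hE.beta_pos] : β ≤ q + 2 * β)
  have e : hnIntegral α f x y A s t =
      (hnIntegral α f x y A s t - hnGerm f x y A s t) + hnGerm f x y A s t := by ring
  rw [e, add_mul, mul_assoc]
  exact (abs_add_le _ _).trans (add_le_add ((h1 s t hs hst ht).trans
    (mul_le_mul_of_nonneg_left h3 hK)) (h2 s t hs hst ht))

/-- The defect of additivity of `∫_s^t (y(t) - y(v)) g(v) dv`. -/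
lemma integral_sub_mul_add_adjacent {y g : ℝ → ℝ} {s u t : ℝ} (hsu : s ≤ u) (hut : u ≤ t)
    (hy : ContinuousOn y (Icc s t)) (hg : IntervalIntegrable g volume s t) :
    (∫ v in s..u, (y u - y v) * g v) + (∫ v in u..t, (y t - y v) * g v) +
      (y t - y u) * ∫ v in s..u, g v = ∫ v in s..t, (y t - y v) * g v := by
  have hu : u ∈ uIcc s t := by rw [uIcc_of_le (hsu.trans hut)]; exact ⟨hsu, hut⟩
  have hgu : IntervalIntegrable g volume s u := hg.mono_set (uIcc_subset_uIcc_left hu)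
  have hyg : ∀ c, IntervalIntegrable (fun v => (c - y v) * g v) volume s t := fun c =>
    hg.continuousOn_mul (by rw [uIcc_of_le (hsu.trans hut)]; exact continuousOn_const.sub hy)
  rw [← intervalIntegral.integral_add_adjacent_intervals
    ((hyg (y t)).mono_set (uIcc_subset_uIcc_left hu))
    ((hyg (y t)).mono_set (uIcc_subset_uIcc_right hu)), ← intervalIntegral.integral_const_mul,
    add_right_comm, ← intervalIntegral.integral_add
      ((hyg (y u)).mono_set (uIcc_subset_uIcc_left hu)) (hgu.const_mul _)]
  congr 2
  ext v
  ring

lemma abs_integral_mul_le {h g : ℝ → ℝ} {s t M : ℝ} (hst : s ≤ t) (hh : ∀ v ∈ Icc s t, |h v| ≤ M)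
    (hg : IntervalIntegrable g volume s t) :
    |∫ v in s..t, h v * g v| ≤ M * ∫ v in s..t, |g v| := by
  rw [← intervalIntegral.integral_const_mul]
  have hb : ∀ v ∈ Ioc s t, ‖h v * g v‖ ≤ M * |g v| := fun v hv => by
    rw [norm_mul]
    exact mul_le_mul_of_nonneg_right (hh v ⟨hv.1.le, hv.2⟩) (abs_nonneg _)
  exact intervalIntegral.norm_integral_le_of_norm_le hst (Eventually.of_forall hb)
    (hg.abs.const_mul M)

end

/-! ### The method of steps: the equation up to `τ` and its frozen forcing -/

section

variable {d m : ℕ} {r T : ℝ}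

lemma extendPath_of_mem {h : -r ≤ T} (x : C(Icc (-r) T, EuclideanSpace ℝ (Fin d))) {t : ℝ}
    (ht : t ∈ Icc (-r) T) : extendPath h x t = x ⟨t, ht⟩ :=
  IccExtend_of_mem h x ht

/-- The hypotheses of the existence and uniqueness theorem. -/
structure StepHyp (r T α β γ : ℝ) (ρ : ENNReal)
    (σ : EuclideanSpace ℝ (Fin d) → Fin d → Fin m → ℝ)
    (b : ℝ → C(Icc (-r) T, EuclideanSpace ℝ (Fin d)) → EuclideanSpace ℝ (Fin d))
    (η : ℝ → EuclideanSpace ℝ (Fin d)) (y : ℝ → EuclideanSpace ℝ (Fin m))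
    (ηy : ℝ → ℝ → Fin d → Fin m → ℝ) (yy : ℝ → ℝ → Fin m → Fin m → ℝ) : Prop where
  exponents : Exponents α β (γ * β)
  gamma_pos : 0 < γ
  delay_pos : 0 < r
  horizon_pos : 0 < T
  exponent_le : ENNReal.ofReal (1 / (1 - β)) ≤ ρ
  diffusion : DiffusionHyp γ σ
  drift : DriftHyp r T ρ b
  initial_nonneg : ∀ t ∈ Icc (-r) 0, ∀ i, 0 ≤ η t i
  initial : IsMultFunctional β 0 r (fun s => η (s - r)) y ηy
  tensor : IsMultFunctional β r T (fun s => y (s - r)) y yy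

/-- The right-hand side of the equation for `x_{·-r} ⊗ y` on `[r, T]`. -/
def laterTensor (h : -r ≤ T) (α : ℝ) (σ : EuclideanSpace ℝ (Fin d) → Fin d → Fin m → ℝ)
    (b : ℝ → C(Icc (-r) T, EuclideanSpace ℝ (Fin d)) → EuclideanSpace ℝ (Fin d))
    (η : ℝ → EuclideanSpace ℝ (Fin d)) (y : ℝ → EuclideanSpace ℝ (Fin m))
    (yy : ℝ → ℝ → Fin m → Fin m → ℝ) (x : C(Icc (-r) T, EuclideanSpace ℝ (Fin d)))
    (A : ℝ → ℝ → Fin d → Fin m → ℝ) (s t : ℝ) (k : Fin d) (l : Fin m) : ℝ :=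
  (∫ v in s..t, (y t l - y v l) * b (v - r) x k) +
    hnTensorIntegral α (fun p => σ p k) (fun v => extendPath h x (v - 2 * r)) (fun v => y (v - r))
      (fun v => y v l) (fun u v => A (u - r) (v - r)) (fun u v j => yy u v j l) s t +
    stieltjesIntegral (fun v => y t l - y v l)
      (fun v => regulator (unreflected h α σ b η y x A) (v - r) k) s t

/-- The equation on `[-r, τ]`, for a path on `[-r, T]`. -/
structure SolvesUpTo (h : -r ≤ T) (α β : ℝ)
    (σ : EuclideanSpace ℝ (Fin d) → Fin d → Fin m → ℝ)
    (b : ℝ → C(Icc (-r) T, EuclideanSpace ℝ (Fin d)) → EuclideanSpace ℝ (Fin d))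
    (η : ℝ → EuclideanSpace ℝ (Fin d)) (y : ℝ → EuclideanSpace ℝ (Fin m))
    (ηy : ℝ → ℝ → Fin d → Fin m → ℝ) (yy : ℝ → ℝ → Fin m → Fin m → ℝ) (τ : ℝ)
    (x : C(Icc (-r) T, EuclideanSpace ℝ (Fin d))) (A : ℝ → ℝ → Fin d → Fin m → ℝ) : Prop where
  initial : ∀ t : Icc (-r) T, (t : ℝ) ≤ 0 → x t = η t
  isMultFunctional : IsMultFunctional β 0 τ (fun s => extendPath h x (s - r)) y A
  eq_initial : ∀ s t, 0 ≤ s → s < t → t ≤ r → t ≤ τ → A s t = ηy s t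
  eq_later : ∀ s t, r ≤ s → s < t → t ≤ τ → A s t = laterTensor h α σ b η y yy x A s t
  equation : ∀ t : Icc (-r) T, 0 < (t : ℝ) → (t : ℝ) ≤ τ →
    x t = unreflected h α σ b η y x A t + regulator (unreflected h α σ b η y x A) t

/-- The stochastic integral, frozen outside `[0, τ]`. -/
def frozenForcing (h : -r ≤ T) (α : ℝ) (σ : EuclideanSpace ℝ (Fin d) → Fin d → Fin m → ℝ)
    (y : ℝ → EuclideanSpace ℝ (Fin m)) (x : C(Icc (-r) T, EuclideanSpace ℝ (Fin d)))
    (A : ℝ → ℝ → Fin d → Fin m → ℝ) (τ t : ℝ) : EuclideanSpace ℝ (Fin d) :=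
  WithLp.toLp 2 fun k =>
    hnIntegral α (fun p => σ p k) (fun s => extendPath h x (s - r)) y A 0 (clampIcc 0 τ t)

variable {α β γ : ℝ} {ρ : ENNReal} {σ : EuclideanSpace ℝ (Fin d) → Fin d → Fin m → ℝ}
  {b : ℝ → C(Icc (-r) T, EuclideanSpace ℝ (Fin d)) → EuclideanSpace ℝ (Fin d)}
  {η : ℝ → EuclideanSpace ℝ (Fin d)} {y : ℝ → EuclideanSpace ℝ (Fin m)}
  {ηy : ℝ → ℝ → Fin d → Fin m → ℝ} {yy : ℝ → ℝ → Fin m → Fin m → ℝ} {h : -r ≤ T} {τ τ' : ℝ}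
  {x x' : C(Icc (-r) T, EuclideanSpace ℝ (Fin d))} {A A' : ℝ → ℝ → Fin d → Fin m → ℝ}

namespace StepHyp

lemma beta_pos (H : StepHyp r T α β γ ρ σ b η y ηy yy) : 0 < β := H.exponents.beta_pos

lemma isControlled (H : StepHyp r T α β γ ρ σ b η y ηy yy)
    (hA : IsMultFunctional β 0 τ (fun s => extendPath h x (s - r)) y A) (k : Fin d) :
    IsControlled β (γ * β) 0 τ (fun p => σ p k) (fun s => extendPath h x (s - r)) :=
  H.diffusion.isControlled H.gamma_pos H.beta_pos hA.holder_left k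

/-- The driver is the second component of `ηy` on `[0, r]` and of `yy` on `[r, T]`; for `T ≤ r` the
first functional alone suffices. -/
lemma exists_holder_driver (H : StepHyp r T α β γ ρ σ b η y ηy yy) :
    ∃ C, HolderOnWith C β.toNNReal y (Icc 0 T) := by
  rcases le_total T r with hTr | hTr
  · exact (H.initial.mono le_rfl hTr).holder_right
  · exact exists_holderOnWith_union H.beta_pos.le H.initial.holder_right H.tensor.holder_right

lemma continuousOn_initial (H : StepHyp r T α β γ ρ σ b η y ηy yy) :
    ContinuousOn η (Icc (-r) 0) := by
  obtain ⟨C, hC⟩ := H.initial.holder_left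
  have h1 := (hC.continuousOn (Real.toNNReal_pos.2 H.beta_pos)).comp
    (f := fun t : ℝ => t + r) (s := Icc (-r) 0) (by fun_prop)
    fun t ht => ⟨by linarith [ht.1], by linarith [ht.2]⟩
  exact h1.congr fun t _ => by simp

/-- Freezing the integral at `τ` makes it a `β`-Hölder forcing on all of `[0, T]`, although the
functional is known only up to `τ`. By additivity its increments are integrals over clamped
intervals. -/
lemma forcedHyp (H : StepHyp r T α β γ ρ σ b η y ηy yy) (hτ0 : 0 ≤ τ)
    (hA : IsMultFunctional β 0 τ (fun s => extendPath h x (s - r)) y A) :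
    ForcedHyp r T β ρ b (frozenForcing h α σ y x A τ) := by
  refine ⟨H.delay_pos, H.horizon_pos, H.beta_pos, by linarith [H.exponents.beta_lt],
    H.exponent_le, H.drift, ?_⟩
  choose K hK hI using fun k => exists_abs_hnIntegral_le H.exponents hA (H.isControlled hA k)
  refine ⟨d * ∑ k, K k, mul_nonneg (by positivity) (Finset.sum_nonneg fun k _ => hK k),
    fun s t hs hst ht => ?_⟩
  rw [mul_assoc]
  have := norm_le_card_mul (v := frozenForcing h α σ y x A τ t - frozenForcing h α σ y x A τ s)
    (M := (∑ k, K k) * (t - s) ^ β) fun k => ?_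
  · simpa using this
  have hc := clampIcc_mono (a := 0) (b := τ) hst
  have ms := clampIcc_mem hτ0 s
  have mt := clampIcc_mem hτ0 t
  rw [PiLp.sub_apply]
  simp only [frozenForcing]
  rw [← hnIntegral_add_adjacent H.exponents hA (H.isControlled hA k) le_rfl ms.1 hc mt.2,
    add_sub_cancel_left]
  refine (hI k _ _ ms.1 hc mt.2).trans (mul_le_mul
    (Finset.single_le_sum (f := K) (fun k _ => hK k) (Finset.mem_univ k))
    (Real.rpow_le_rpow (sub_nonneg.2 hc) (clampIcc_sub_le_sub hst) H.beta_pos.le)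
    (Real.rpow_nonneg (sub_nonneg.2 hc) _) (Finset.sum_nonneg fun k _ => hK k))

lemma unreflected_eq_forcedPath {t : ℝ} (ht : t ∈ Icc 0 τ) :
    unreflected h α σ b η y x A t = forcedPath b (η 0) (frozenForcing h α σ y x A τ) x t := by
  rw [unreflected, forcedPath, frozenForcing, clampIcc_of_mem ht]

lemma frozenForcing_zero (hτ0 : 0 ≤ τ) : frozenForcing h α σ y x A τ 0 = 0 := by
  ext k
  simp only [frozenForcing]
  rw [clampIcc_of_mem ⟨le_rfl, hτ0⟩, hnIntegral_self]
  rfl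

lemma regulator_unreflected_eq {t : ℝ} (ht : t ∈ Icc 0 τ) :
    regulator (unreflected h α σ b η y x A) t =
      regulator (forcedPath b (η 0) (frozenForcing h α σ y x A τ) x) t :=
  regulator_congr fun _ hs => unreflected_eq_forcedPath ⟨hs.1, hs.2.trans ht.2⟩

lemma continuousOn_unreflected (H : StepHyp r T α β γ ρ σ b η y ηy yy) (hτ0 : 0 ≤ τ) (hτ : τ ≤ T)
    (hA : IsMultFunctional β 0 τ (fun s => extendPath h x (s - r)) y A) :
    ContinuousOn (unreflected h α σ b η y x A) (Icc 0 τ) :=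
  (((H.forcedHyp hτ0 hA).exists_holder_regulator (η 0) x).1.mono (Icc_subset_Icc_right hτ)).congr
    fun _ hs => unreflected_eq_forcedPath hs

lemma exists_holder_unreflected (H : StepHyp r T α β γ ρ σ b η y ηy yy) (hτ0 : 0 ≤ τ) (hτ : τ ≤ T)
    (hA : IsMultFunctional β 0 τ (fun s => extendPath h x (s - r)) y A) :
    ∃ K : ℝ, 0 ≤ K ∧ ∀ s t, 0 ≤ s → s ≤ t → t ≤ τ →
      ‖unreflected h α σ b η y x A t - unreflected h α σ b η y x A s‖ ≤ K * (t - s) ^ β ∧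
      ‖regulator (unreflected h α σ b η y x A) t - regulator (unreflected h α σ b η y x A) s‖ ≤
        K * (t - s) ^ β := by
  obtain ⟨K, hK, h1⟩ := (H.forcedHyp hτ0 hA).exists_holder_forcedPath (η 0) x
  obtain ⟨-, K', hK', h2⟩ := (H.forcedHyp hτ0 hA).exists_holder_regulator (η 0) x
  refine ⟨K + K', by positivity, fun s t hs hst ht => ?_⟩
  have p0 := Real.rpow_nonneg (sub_nonneg.2 hst) β
  have ms : s ∈ Icc 0 τ := ⟨hs, hst.trans ht⟩
  have mt : t ∈ Icc 0 τ := ⟨hs.trans hst, ht⟩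
  rw [unreflected_eq_forcedPath ms, unreflected_eq_forcedPath mt, regulator_unreflected_eq ms,
    regulator_unreflected_eq mt]
  exact ⟨(h1 s t hs hst (ht.trans hτ)).trans (mul_le_mul_of_nonneg_right (by linarith) p0),
    (h2 s t hs hst (ht.trans hτ)).trans (mul_le_mul_of_nonneg_right (by linarith) p0)⟩

/-- The tensor of `x_{·-2r}` and `y_{·-r}` is the translate of `A` by `r`. Hence on `[r, τ']` with
`τ' ≤ τ + r` it involves only what is known up to `τ`. -/
lemma tensorIntegrand (H : StepHyp r T α β γ ρ σ b η y ηy yy)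
    (hA : IsMultFunctional β 0 τ (fun s => extendPath h x (s - r)) y A) (hτ' : τ' ≤ τ + r)
    (hτT : τ' ≤ T) (k : Fin d) :
    TensorIntegrand α β (γ * β) r τ' (fun p => σ p k) (fun v => extendPath h x (v - 2 * r))
      (fun v => y (v - r)) y (fun u v => A (u - r) (v - r)) yy := by
  have h1 : IsMultFunctional β r τ' (fun v => extendPath h x (v - 2 * r)) (fun v => y (v - r))
      fun u v => A (u - r) (v - r) := by
    refine ((hA.comp_sub H.beta_pos r).mono (zero_add r).le hτ').congr H.beta_pos
      (fun s _ => ?_) fun _ _ _ _ _ => rfl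
    rw [sub_sub, ← two_mul]
  exact ⟨H.exponents, h1, H.tensor.mono le_rfl hτT,
    H.diffusion.isControlled H.gamma_pos H.beta_pos h1.holder_left k,
    H.diffusion.differentiable k⟩

/-- The integral against the translated functional is the increment of the integral. -/
lemma hnIntegral_translate (H : StepHyp r T α β γ ρ σ b η y ηy yy)
    (hA : IsMultFunctional β 0 τ (fun s => extendPath h x (s - r)) y A) (hτ' : τ' ≤ τ + r)
    (hτT : τ' ≤ T) (k : Fin d) {s u : ℝ} (hs : r ≤ s) (hsu : s ≤ u) (hu : u ≤ τ') :
    hnIntegral α (fun p => σ p k) (fun v => extendPath h x (v - 2 * r)) (fun v => y (v - r))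
      (fun u v => A (u - r) (v - r)) s u =
      hnIntegral α (fun p => σ p k) (fun s => extendPath h x (s - r)) y A 0 (u - r) -
      hnIntegral α (fun p => σ p k) (fun s => extendPath h x (s - r)) y A 0 (s - r) := by
  have hT := H.tensorIntegrand hA hτ' hτT k
  rw [eq_sub_iff_add_eq', ← hnIntegral_add_adjacent H.exponents hA (H.isControlled hA k) le_rfl
    (by linarith : 0 ≤ s - r) (by linarith : s - r ≤ u - r) (by linarith)]
  congr 1
  have h1 := (isRiemannLimit_hnIntegral H.exponents hA (H.isControlled hA k)
    (by linarith : 0 ≤ s - r) (by linarith : s - r ≤ u - r) (by linarith)).comp_sub r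
  rw [sub_add_cancel, sub_add_cancel] at h1
  refine (isRiemannLimit_hnIntegral H.exponents hT.left hT.controlled hs hsu hu).unique
    (h1.congr fun v w _ _ _ => ?_) hsu
  rw [hnGerm, hnGerm]
  have : v - r - r = v - 2 * r := by ring
  rw [this]

end StepHyp

end

/-! ### The method of steps: the tensor over the next interval -/

section

variable {d m : ℕ} {r T : ℝ} {α β γ : ℝ} {ρ : ENNReal}
  {σ : EuclideanSpace ℝ (Fin d) → Fin d → Fin m → ℝ}
  {b : ℝ → C(Icc (-r) T, EuclideanSpace ℝ (Fin d)) → EuclideanSpace ℝ (Fin d)}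
  {η : ℝ → EuclideanSpace ℝ (Fin d)} {y : ℝ → EuclideanSpace ℝ (Fin m)}
  {ηy : ℝ → ℝ → Fin d → Fin m → ℝ} {yy : ℝ → ℝ → Fin m → Fin m → ℝ} {h : -r ≤ T} {τ τ' : ℝ}
  {x x' : C(Icc (-r) T, EuclideanSpace ℝ (Fin d))} {A A' : ℝ → ℝ → Fin d → Fin m → ℝ}

namespace StepHyp

lemma intervalIntegrable_drift (H : StepHyp r T α β γ ρ σ b η y ηy yy) (x)
    {s t : ℝ} (hs : 0 ≤ s) (hst : s ≤ t) (ht : t ≤ T) :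
    IntervalIntegrable (fun v => b v x) volume s t :=
  H.drift.intervalIntegrable H.beta_pos (by linarith [H.exponents.beta_lt]) H.exponent_le x hs hst ht

lemma intervalIntegrable_drift_shift (H : StepHyp r T α β γ ρ σ b η y ηy yy) (x)
    (k : Fin d) {s t : ℝ} (hs : r ≤ s) (hst : s ≤ t) (ht : t ≤ T) :
    IntervalIntegrable (fun v => b (v - r) x k) volume s t := by
  have h1 := (H.intervalIntegrable_drift x (sub_nonneg.2 hs) (sub_le_sub_right hst r)
    (by linarith [H.delay_pos] : t - r ≤ T)).comp_sub_right r
  rw [sub_add_cancel, sub_add_cancel] at h1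
  rw [intervalIntegrable_iff] at h1 ⊢
  exact (EuclideanSpace.proj (𝕜 := ℝ) k :
    EuclideanSpace ℝ (Fin d) →L[ℝ] ℝ).integrable_comp h1

lemma integral_drift_shift (H : StepHyp r T α β γ ρ σ b η y ηy yy) (x)
    (k : Fin d) {s u : ℝ} (hs : r ≤ s) (hsu : s ≤ u) (hu : u ≤ T) :
    ∫ v in s..u, b (v - r) x k =
      (∫ v in (0 : ℝ)..(u - r), b v x) k - (∫ v in (0 : ℝ)..(s - r), b v x) k := by
  have hr := H.delay_pos
  rw [intervalIntegral.integral_comp_sub_right (fun v => b v x k), ← PiLp.sub_apply,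
    intervalIntegral.integral_interval_sub_left
      (H.intervalIntegrable_drift x le_rfl (by linarith) (by linarith))
      (H.intervalIntegrable_drift x le_rfl (by linarith) (by linarith))]
  exact (EuclideanSpace.proj (𝕜 := ℝ) k : EuclideanSpace ℝ (Fin d) →L[ℝ] ℝ).intervalIntegral_comp_comm
    (H.intervalIntegrable_drift x (by linarith) (by linarith) (by linarith))

lemma continuousOn_driver (H : StepHyp r T α β γ ρ σ b η y ηy yy) (l : Fin m) :
    ContinuousOn (fun v => y v l) (Icc 0 T) := by
  obtain ⟨C, hC⟩ := H.exists_holder_driver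
  exact (PiLp.continuous_apply 2 _ l).comp_continuousOn
    (hC.continuousOn (Real.toNNReal_pos.2 H.beta_pos))

lemma monotoneOn_regulator_shift (H : StepHyp r T α β γ ρ σ b η y ηy yy) (hτ0 : 0 ≤ τ) (hτ : τ ≤ T)
    (hA : IsMultFunctional β 0 τ (fun s => extendPath h x (s - r)) y A) (hτ' : τ' ≤ τ + r)
    (k : Fin d) :
    MonotoneOn (fun v => regulator (unreflected h α σ b η y x A) (v - r) k) (Icc r τ') ∧
      ContinuousOn (fun v => regulator (unreflected h α σ b η y x A) (v - r) k) (Icc r τ') := by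
  have hm : MapsTo (fun v : ℝ => v - r) (Icc r τ') (Icc 0 τ) := fun v hv =>
    ⟨sub_nonneg.2 hv.1, by linarith [hv.2]⟩
  constructor
  · exact fun s hs t ht hst => regulator_monotoneOn (H.continuousOn_unreflected hτ0 hτ hA) k (hm hs)
      (hm ht) (sub_le_sub_right hst r)
  · have h1 : ContinuousOn (regulator (unreflected h α σ b η y x A)) (Icc 0 τ) :=
      (((H.forcedHyp hτ0 hA).continuousOn_regulator (η 0) x).mono (Icc_subset_Icc_right hτ)).congr
        fun t ht => regulator_unreflected_eq ht
    exact (PiLp.continuous_apply 2 _ k).comp_continuousOn (h1.comp (by fun_prop) hm)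

/-- Each of the three terms fails to be additive by `y t l - y u l` times the increment, from `s -
r` to `u - r`, of the drift integral, the rough integral or the regulator. By the equation these
increments add up to that of `x`. -/
lemma laterTensor_mult (H : StepHyp r T α β γ ρ σ b η y ηy yy) (hτ0 : 0 ≤ τ) (hτ : τ ≤ T)
    (hA : IsMultFunctional β 0 τ (fun s => extendPath h x (s - r)) y A) (hτ' : τ' ≤ τ + r)
    (hτT : τ' ≤ T) (hx : ∀ t ∈ Icc 0 τ, extendPath h x t =
      unreflected h α σ b η y x A t + regulator (unreflected h α σ b η y x A) t)
    {s u t : ℝ} (hs : r ≤ s) (hsu : s ≤ u) (hut : u ≤ t) (ht : t ≤ τ') (k : Fin d) (l : Fin m) :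
    laterTensor h α σ b η y yy x A s u k l + laterTensor h α σ b η y yy x A u t k l +
      (extendPath h x (u - r) k - extendPath h x (s - r) k) * (y t l - y u l) =
      laterTensor h α σ b η y yy x A s t k l := by
  have hr := H.delay_pos
  have hy := H.continuousOn_driver l
  have h1 := integral_sub_mul_add_adjacent hsu hut
    (hy.mono (Icc_subset_Icc (by linarith) (by linarith)))
    (H.intervalIntegrable_drift_shift x k hs (hsu.trans hut) (ht.trans hτT))
  have h2 := (H.tensorIntegrand hA hτ' hτT k).hnTensorIntegral_add_adjacent l hs hsu hut ht
  obtain ⟨hm, hc⟩ := H.monotoneOn_regulator_shift hτ0 hτ hA hτ' k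
  have h3 := stieltjesIntegral_add_adjacent hm hc
    (hy.mono (Icc_subset_Icc hr.le hτT)) hs hsu hut ht
  rw [H.integral_drift_shift x k hs hsu (by linarith)] at h1
  rw [H.hnIntegral_translate hA hτ' hτT k hs hsu (hut.trans ht)] at h2
  rw [hx (u - r) ⟨by linarith, by linarith⟩, hx (s - r) ⟨by linarith, by linarith⟩]
  simp only [laterTensor]
  rw [← h1, ← h2, ← h3, PiLp.add_apply, PiLp.add_apply]
  have e : ∀ v, unreflected h α σ b η y x A v k = η 0 k + (∫ s in (0 : ℝ)..v, b s x) k +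
      hnIntegral α (fun p => σ p k) (fun s => extendPath h x (s - r)) y A 0 v := fun v => rfl
  rw [e, e]
  ring

/-- In the drift and regulator terms an increment of `y`, of order `β`, is integrated against a
`β`-Hölder integrator of bounded variation; the rough term is of order `2 * β` by
`exists_abs_hnTensorIntegral_le`. -/
lemma exists_abs_laterTensor_le (H : StepHyp r T α β γ ρ σ b η y ηy yy) (hτ0 : 0 ≤ τ) (hτ : τ ≤ T)
    (hA : IsMultFunctional β 0 τ (fun s => extendPath h x (s - r)) y A) (hτ' : τ' ≤ τ + r)
    (hτT : τ' ≤ T) : ∃ C : ℝ, ∀ s t, r ≤ s → s ≤ t → t ≤ τ' → ∀ k l,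
      |laterTensor h α σ b η y yy x A s t k l| ≤ C * (t - s) ^ (2 * β) := by
  have hβ := H.beta_pos
  have hr := H.delay_pos
  obtain ⟨D, hD, hy⟩ := exists_holder_bound hβ.le H.exists_holder_driver
  obtain ⟨K, hK, hb⟩ := H.drift.exists_integral_norm_le hβ (by linarith [H.exponents.beta_lt])
    H.exponent_le x
  obtain ⟨K', hK', hreg⟩ := H.exists_holder_unreflected hτ0 hτ hA
  choose E hE hten using fun p : Fin d × Fin m =>
    (H.tensorIntegrand hA hτ' hτT p.1).exists_abs_hnTensorIntegral_le p.2
  refine ⟨D * K + ∑ p, E p + D * K', fun s t hs hst ht k l => ?_⟩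
  have hts := sub_nonneg.2 hst
  have p1 := Real.rpow_nonneg hts β
  have e2 : (t - s) ^ (2 * β) = (t - s) ^ β * (t - s) ^ β := by
    rw [two_mul, Real.rpow_add_of_nonneg hts hβ.le hβ.le]
  have hyb : ∀ v ∈ Icc s t, |y t l - y v l| ≤ D * (t - s) ^ β := by
    intro v hv
    have h1 := hy v ⟨by linarith [hv.1], by linarith [hv.2]⟩ t ⟨by linarith, by linarith⟩
    rw [abs_of_nonneg (sub_nonneg.2 hv.2)] at h1
    refine ((PiLp.norm_apply_le (y t - y v) l).trans h1).trans (mul_le_mul_of_nonneg_left ?_ hD)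
    exact Real.rpow_le_rpow (sub_nonneg.2 hv.2) (by linarith [hv.1]) hβ.le
  have hint := H.intervalIntegrable_drift_shift x k hs hst (ht.trans hτT)
  have b1 : |∫ v in s..t, (y t l - y v l) * b (v - r) x k| ≤ D * K * (t - s) ^ (2 * β) := by
    refine (abs_integral_mul_le hst hyb hint).trans ?_
    have h1 : ∫ v in s..t, |b (v - r) x k| ≤ K * (t - s) ^ β := by
      have h2 := hb (s - r) (t - r) (by linarith) (by linarith) (by linarith)
      rw [sub_sub_sub_cancel_right] at h2
      refine le_trans ?_ h2
      rw [intervalIntegral.integral_comp_sub_right (fun v => |b v x k|)]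
      have hi := H.intervalIntegrable_drift x (by linarith : 0 ≤ s - r)
        (by linarith : s - r ≤ t - r) (by linarith)
      refine intervalIntegral.integral_mono_on (by linarith) ?_ hi.norm
        fun v _ => PiLp.norm_apply_le (b v x) k
      have hk : IntervalIntegrable (fun v => b v x k) volume (s - r) (t - r) := by
        rw [intervalIntegrable_iff] at hi ⊢
        exact (EuclideanSpace.proj (𝕜 := ℝ) k :
          EuclideanSpace ℝ (Fin d) →L[ℝ] ℝ).integrable_comp hi
      exact hk.abs
    calc _ ≤ D * (t - s) ^ β * (K * (t - s) ^ β) := by gcongr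
      _ = _ := by rw [e2]; ring
  have b2 := (hten (k, l) s t hs hst ht).trans (mul_le_mul_of_nonneg_right
    (Finset.single_le_sum (f := E) (fun p _ => hE p) (Finset.mem_univ (k, l)))
    (Real.rpow_nonneg hts (2 * β)))
  have b3 : |stieltjesIntegral (fun v => y t l - y v l)
      (fun v => regulator (unreflected h α σ b η y x A) (v - r) k) s t| ≤
      D * K' * (t - s) ^ (2 * β) := by
    obtain ⟨hm, hc⟩ := H.monotoneOn_regulator_shift hτ0 hτ hA hτ' k
    refine (abs_stieltjesIntegral_le hst (hm.mono (Icc_subset_Icc hs ht))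
      (hc.mono (Icc_subset_Icc hs ht)) hyb).trans ?_
    have h1 := (hreg (s - r) (t - r) (by linarith) (by linarith) (by linarith)).2
    rw [sub_sub_sub_cancel_right] at h1
    have h2 := (le_abs_self _).trans ((PiLp.norm_apply_le (regulator (unreflected h α σ b η y x A)
      (t - r) - regulator (unreflected h α σ b η y x A) (s - r)) k).trans h1)
    calc _ ≤ D * (t - s) ^ β * (K' * (t - s) ^ β) := mul_le_mul_of_nonneg_left h2 (by positivity)
      _ = _ := by rw [e2]; ring
  rw [laterTensor, add_mul, add_mul]
  exact (abs_add_le _ _).trans (add_le_add ((abs_add_le _ _).trans (add_le_add b1 b2)) b3)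

lemma unreflected_congr (H : StepHyp r T α β γ ρ σ b η y ηy yy) (hτ : τ ≤ T)
    (hA : IsMultFunctional β 0 τ (fun s => extendPath h x (s - r)) y A)
    (hA' : IsMultFunctional β 0 τ (fun s => extendPath h x' (s - r)) y A')
    (hx : ∀ t : Icc (-r) T, (t : ℝ) ≤ τ → x t = x' t)
    (hAA' : ∀ s t, 0 ≤ s → s ≤ t → t ≤ τ → A s t = A' s t) {t : ℝ} (ht : t ∈ Icc 0 τ) :
    unreflected h α σ b η y x A t = unreflected h α σ b η y x' A' t := by
  have hr := H.delay_pos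
  have e1 : ∫ s in (0 : ℝ)..t, b s x = ∫ s in (0 : ℝ)..t, b s x' := by
    rw [intervalIntegral.integral_of_le ht.1, intervalIntegral.integral_of_le ht.1]
    -- The half-open interval leaves out time `0`, at which the drift is not assumed to be
    -- hereditary.
    refine setIntegral_congr_fun measurableSet_Ioc fun v hv => ?_
    exact H.drift.hereditary v ⟨hv.1, (hv.2.trans ht.2).trans hτ⟩ x x' fun s hs =>
      hx s (hs.trans (hv.2.trans ht.2))
  have e2 : ∀ k, hnIntegral α (fun p => σ p k) (fun s => extendPath h x (s - r)) y A 0 t =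
      hnIntegral α (fun p => σ p k) (fun s => extendPath h x' (s - r)) y A' 0 t := fun k =>
    hnIntegral_congr H.exponents hA hA' (H.isControlled hA k) (H.isControlled hA' k)
      (fun s hs => by
        have hm : s - r ∈ Icc (-r) T := ⟨by linarith [hs.1], by linarith [hs.2]⟩
        rw [extendPath_of_mem x hm, extendPath_of_mem x' hm]
        exact hx _ (by change s - r ≤ τ; linarith [hs.2])) hAA' le_rfl ht.1 ht.2
  rw [unreflected, unreflected, e1]
  simp_rw [e2]

/-- Every occurrence of the path and of the tensor is delayed by at least `r`, so for times up to `τ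
+ r` only their values up to `τ` matter. -/
lemma laterTensor_congr (H : StepHyp r T α β γ ρ σ b η y ηy yy) (hτ : τ ≤ T)
    (hA : IsMultFunctional β 0 τ (fun s => extendPath h x (s - r)) y A)
    (hA' : IsMultFunctional β 0 τ (fun s => extendPath h x' (s - r)) y A')
    (hx : ∀ t : Icc (-r) T, (t : ℝ) ≤ τ → x t = x' t)
    (hAA' : ∀ s t, 0 ≤ s → s ≤ t → t ≤ τ → A s t = A' s t) (hτ' : τ' ≤ τ + r) (hτT : τ' ≤ T)
    {s t : ℝ} (hs : r ≤ s) (hst : s ≤ t) (ht : t ≤ τ') :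
    laterTensor h α σ b η y yy x A s t = laterTensor h α σ b η y yy x' A' s t := by
  have hr := H.delay_pos
  ext k l
  simp only [laterTensor]
  congr 1
  congr 1
  · rw [intervalIntegral.integral_of_le hst, intervalIntegral.integral_of_le hst]
    refine setIntegral_congr_fun measurableSet_Ioc fun v hv => ?_
    have : b (v - r) x = b (v - r) x' :=
      H.drift.hereditary (v - r) ⟨by linarith [hv.1], by linarith [hv.2]⟩ x x' fun s hs =>
        hx s (hs.trans (by linarith [hv.2]))
    simp only [this]
  · have h1 := H.tensorIntegrand hA hτ' hτT k
    have h2 := H.tensorIntegrand hA' hτ' hτT k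
    refine (h1.isRiemannLimit l hs hst ht).unique
      ((h2.isRiemannLimit l hs hst ht).congr fun u v hu huv hv => ?_) hst
    have hm : u - 2 * r ∈ Icc (-r) T := ⟨by linarith, by linarith⟩
    have e1 : extendPath h x' (u - 2 * r) = extendPath h x (u - 2 * r) := by
      rw [extendPath_of_mem x hm, extendPath_of_mem x' hm]
      exact (hx _ (by change u - 2 * r ≤ τ; linarith)).symm
    have e2 := hAA' (u - r) (v - r) (by linarith) (by linarith) (by linarith)
    rw [hnGerm_congr (x := fun v => extendPath h x' (v - 2 * r))
      (x' := fun v => extendPath h x (v - 2 * r)) (A := fun u v => A' (u - r) (v - r))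
      (A' := fun u v => A (u - r) (v - r)) e1 e2.symm, e1]
  · refine stieltjesIntegral_congr hst fun v hv => ?_
    rw [regulator_congr fun w hw => H.unreflected_congr hτ hA hA' hx hAA'
      ⟨hw.1, by linarith [hw.2, hv.2]⟩]

end StepHyp

/-! ### Uniqueness and continuation over one delay, and the conclusion -/

namespace SolvesUpTo

/-- The equation is imposed only for positive times. At `0` it follows from the initial condition,
because `η 0 ≥ 0` makes the regulator vanish. -/
lemma extendPath_eq (H : StepHyp r T α β γ ρ σ b η y ηy yy)
    (S : SolvesUpTo h α β σ b η y ηy yy τ x A) (hτ : τ ≤ T) {t : ℝ} (ht : t ∈ Icc 0 τ) :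
    extendPath h x t =
      unreflected h α σ b η y x A t + regulator (unreflected h α σ b η y x A) t := by
  have hr := H.delay_pos
  have hm : t ∈ Icc (-r) T := ⟨by linarith [ht.1], ht.2.trans hτ⟩
  rw [extendPath_of_mem x hm]
  rcases ht.1.eq_or_lt with rfl | h0
  · have e : unreflected h α σ b η y x A 0 = η 0 := by
      rw [unreflected]
      simp_rw [hnIntegral_self]
      rw [intervalIntegral.integral_same, add_zero]
      exact add_zero _
    rw [regulator_zero (by rw [e]; exact H.initial_nonneg 0 ⟨by linarith, le_rfl⟩), add_zero, e]
    exact S.initial _ le_rfl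
  · exact S.equation _ h0 ht.2

lemma isMultFunctional_initial (H : StepHyp r T α β γ ρ σ b η y ηy yy)
    (hx : ∀ t : Icc (-r) T, (t : ℝ) ≤ 0 → x t = η t) :
    IsMultFunctional β 0 r (fun s => extendPath h x (s - r)) y ηy := by
  have hT := H.horizon_pos
  refine H.initial.congr H.beta_pos (fun s hs => ?_) fun _ _ _ _ _ => rfl
  have hm : s - r ∈ Icc (-r) T := ⟨by linarith [hs.1], by linarith [hs.2]⟩
  rw [extendPath_of_mem x hm]
  exact (hx ⟨s - r, hm⟩ (sub_nonpos.2 hs.2)).symm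

lemma eq_initial_of_le (H : StepHyp r T α β γ ρ σ b η y ηy yy)
    (S : SolvesUpTo h α β σ b η y ηy yy τ x A) {s t : ℝ} (hs : 0 ≤ s) (hst : s ≤ t) (ht : t ≤ r)
    (htτ : t ≤ τ) : A s t = ηy s t := by
  rcases hst.eq_or_lt with rfl | hst
  · rw [S.isMultFunctional.diag hs htτ, H.initial.diag hs ht]
  · exact S.eq_initial s t hs hst ht htτ

/-- The Hölder continuity of `x_{·-r}` on `[r, τ']` is read off from the equation on `[0, τ]`, as
both the unreflected path and the regulator are `β`-Hölder. -/
lemma isMultFunctional_later (H : StepHyp r T α β γ ρ σ b η y ηy yy)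
    (S : SolvesUpTo h α β σ b η y ηy yy τ x A) (hτ0 : 0 ≤ τ) (hτ : τ ≤ T) (hτ' : τ' ≤ τ + r)
    (hτT : τ' ≤ T) : IsMultFunctional β r τ' (fun s => extendPath h x (s - r)) y
      (laterTensor h α σ b η y yy x A) := by
  have hr := H.delay_pos
  have hA := S.isMultFunctional
  obtain ⟨C, hC⟩ := H.exists_abs_laterTensor_le hτ0 hτ hA hτ' hτT
  obtain ⟨K, hK, hreg⟩ := H.exists_holder_unreflected hτ0 hτ hA
  refine isMultFunctional_of_bound (C := C) H.beta_pos
    (exists_holderOnWith (C := 2 * K) H.beta_pos.le fun s hs t ht hst => ?_)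
    (H.exists_holder_driver.imp fun _ hD => hD.mono (Icc_subset_Icc hr.le hτT))
    (fun s u t hs hsu hut ht i j => H.laterTensor_mult hτ0 hτ hA hτ' hτT
      (fun t ht => S.extendPath_eq H hτ ht) hs hsu hut ht i j)
    fun s t hs hst ht i j => hC s t hs hst ht i j
  obtain ⟨h1, h2⟩ := hreg (s - r) (t - r) (by linarith [hs.1]) (by linarith) (by linarith [ht.2])
  rw [S.extendPath_eq H hτ ⟨by linarith [ht.1], by linarith [ht.2]⟩,
    S.extendPath_eq H hτ ⟨by linarith [hs.1], by linarith [hs.2]⟩, add_sub_add_comm,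
    abs_of_nonneg (sub_nonneg.2 hst), two_mul, add_mul]
  rw [sub_sub_sub_cancel_right] at h1 h2
  exact (norm_add_le _ _).trans (add_le_add h1 h2)

/-- The equation determines the path and the tensor on one more interval of length `r`. -/
theorem eq_step (H : StepHyp r T α β γ ρ σ b η y ηy yy) (hτ0 : 0 ≤ τ) (hττ' : τ ≤ τ')
    (hτ' : τ' ≤ τ + r) (hτT : τ' ≤ T) (S : SolvesUpTo h α β σ b η y ηy yy τ' x A)
    (S' : SolvesUpTo h α β σ b η y ηy yy τ' x' A')
    (hx : ∀ t : Icc (-r) T, (t : ℝ) ≤ τ → x t = x' t)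
    (hAA' : ∀ s t, 0 ≤ s → s ≤ t → t ≤ τ → A s t = A' s t) :
    (∀ t : Icc (-r) T, (t : ℝ) ≤ τ' → x t = x' t) ∧
      ∀ s t, 0 ≤ s → s ≤ t → t ≤ τ' → A s t = A' s t := by
  have hr := H.delay_pos
  have hA := S.isMultFunctional
  have hA' := S'.isMultFunctional
  have hX : ∀ s ∈ Icc 0 τ', extendPath h x (s - r) = extendPath h x' (s - r) := by
    intro s hs
    have hm : s - r ∈ Icc (-r) T := ⟨by linarith [hs.1], by linarith [hs.2]⟩
    rw [extendPath_of_mem x hm, extendPath_of_mem x' hm]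
    exact hx _ (by change s - r ≤ τ; linarith [hs.2])
  -- On `[0, r]` the tensor is prescribed, after `r` it is computed from data up to `τ`, and across
  -- `r` the multiplicative property decides.
  have hAA : ∀ s t, 0 ≤ s → s ≤ t → t ≤ τ' → A s t = A' s t := fun s t hs hst ht =>
    hA.eq_of_eq hA' (c := r) hX
      (fun s t hs hst ht htτ => (S.eq_initial_of_le H hs hst ht htτ).trans
        (S'.eq_initial_of_le H hs hst ht htτ).symm)
      (fun s t hs hrs hst ht => by
        rcases hst.eq_or_lt with rfl | hst
        · rw [hA.diag hs ht, hA'.diag hs ht]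
        · rw [S.eq_later s t hrs hst ht, S'.eq_later s t hrs hst ht]
          exact H.laterTensor_congr (hττ'.trans hτT) (hA.mono le_rfl hττ') (hA'.mono le_rfl hττ')
            hx hAA' hτ' hτT hrs hst.le ht) hs hst ht
  -- Equal tensors over equal delayed paths give equal forcings, so both paths solve the same forced
  -- equation up to `τ'`.
  have hJ : ∀ t ∈ Icc 0 τ', frozenForcing h α σ y x' A' τ' t = frozenForcing h α σ y x A τ' t := by
    intro t ht
    ext k
    simp only [frozenForcing]
    rw [clampIcc_of_mem ht]
    exact (hnIntegral_congr H.exponents hA hA' (H.isControlled hA k) (H.isControlled hA' k) hX hAA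
      le_rfl ht.1 ht.2).symm
  have hU : ∀ t ∈ Icc 0 τ', unreflected h α σ b η y x' A' t =
      forcedPath b (η 0) (frozenForcing h α σ y x A τ') x' t := fun t ht => by
    rw [StepHyp.unreflected_eq_forcedPath ht, forcedPath, forcedPath, hJ t ht]
  refine ⟨fun t ht => (H.forcedHyp (hτ0.trans hττ') hA).eq_of_forced (p := η 0) hτT
    (fun t ht => (S.initial t ht).trans (S'.initial t ht).symm) (fun t h0 ht => ?_)
    (fun t h0 ht => ?_) ht, hAA⟩
  · rw [S.equation t h0 ht, StepHyp.unreflected_eq_forcedPath ⟨h0.le, ht⟩,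
      StepHyp.regulator_unreflected_eq ⟨h0.le, ht⟩]
  · rw [S'.equation t h0 ht, hU t ⟨h0.le, ht⟩,
      regulator_congr fun s hs => hU s ⟨hs.1, hs.2.trans ht⟩]

/-- A solution can be continued on one more interval of length `r`. -/
theorem exists_step (H : StepHyp r T α β γ ρ σ b η y ηy yy) (hτ0 : 0 ≤ τ) (hττ' : τ ≤ τ')
    (hτ' : τ' ≤ τ + r) (hτT : τ' ≤ T) (S : SolvesUpTo h α β σ b η y ηy yy τ x A) :
    ∃ x' A', SolvesUpTo h α β σ b η y ηy yy τ' x' A' := by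
  have hr := H.delay_pos
  have hτ := hττ'.trans hτT
  have hA := S.isMultFunctional
  have hini := isMultFunctional_initial (h := h) H S.initial
  -- On `[0, τ']` the delayed path uses `x` only up to `τ`, so the new tensor can be built before
  -- the path is continued.
  set A' := glue 0 r (fun s => extendPath h x (s - r)) y ηy (laterTensor h α σ b η y yy x A) with hA'd
  have hleft : ∀ s t, 0 ≤ s → s ≤ t → t ≤ r → A' s t = ηy s t := fun s t hs hst ht =>
    glue_eq_left hini le_rfl hs hst ht
  have hright : ∀ s t, r ≤ s → s ≤ t → t ≤ τ' → A' s t = laterTensor h α σ b η y yy x A s t :=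
    fun s t hs hst ht => glue_eq_right (S.isMultFunctional_later H hτ0 hτ hτ' hτT)
      hs hst ht
  have hA' : IsMultFunctional β 0 τ' (fun s => extendPath h x (s - r)) y A' := by
    rcases le_total τ' r with hle | hle
    · exact (hini.mono le_rfl hle).congr H.beta_pos (fun _ _ => rfl)
        fun s t hs hst ht => (hleft s t hs hst (ht.trans hle)).symm
    · exact isMultFunctional_glue H.beta_pos hini
        (S.isMultFunctional_later H hτ0 hτ hτ' hτT)
  have hAA' : ∀ s t, 0 ≤ s → s ≤ t → t ≤ τ → A s t = A' s t := fun s t hs hst ht =>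
    hA.eq_of_eq (hA'.mono le_rfl hττ') (c := r) (fun _ _ => rfl)
      (fun s t hs hst ht htτ => (S.eq_initial_of_le H hs hst ht htτ).trans
        (hleft s t hs hst ht).symm)
      (fun s t hs hrs hst ht => by
        rcases hst.eq_or_lt with rfl | hst
        · rw [hA.diag hs ht, hA'.diag hs (ht.trans hττ')]
        · rw [S.eq_later s t hrs hst ht, hright s t hrs hst.le (ht.trans hττ')]) hs hst ht
  have hF := H.forcedHyp (hτ0.trans hττ') hA'
  obtain ⟨x', hx'0, hx'⟩ := hF.exists_forced H.continuousOn_initial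
    (StepHyp.frozenForcing_zero (hτ0.trans hττ')) (H.initial_nonneg 0 ⟨by linarith, le_rfl⟩)
  have hU : ∀ t ∈ Icc 0 τ, unreflected h α σ b η y x A t =
      forcedPath b (η 0) (frozenForcing h α σ y x A' τ') x t := fun t ht => by
    rw [H.unreflected_congr hτ hA (hA'.mono le_rfl hττ') (fun _ _ => rfl) hAA' ht]
    exact StepHyp.unreflected_eq_forcedPath ⟨ht.1, ht.2.trans hττ'⟩
  -- The forced equation was solved afresh from time `0`; uniqueness shows that its solution still
  -- agrees with `x` up to `τ`.
  have hxx' : ∀ t : Icc (-r) T, (t : ℝ) ≤ τ → x t = x' t := fun t ht =>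
    hF.eq_of_forced (p := η 0) hτ (fun t ht => (S.initial t ht).trans (hx'0 t ht).symm)
      (fun t h0 ht => by
        rw [S.equation t h0 ht, hU t ⟨h0.le, ht⟩,
          regulator_congr fun s hs => hU s ⟨hs.1, hs.2.trans ht⟩])
      (fun t h0 _ => hx' t h0.le) ht
  have hX : ∀ s ∈ Icc 0 τ', extendPath h x (s - r) = extendPath h x' (s - r) := by
    intro s hs
    have hm : s - r ∈ Icc (-r) T := ⟨by linarith [hs.1], by linarith [hs.2]⟩
    rw [extendPath_of_mem x hm, extendPath_of_mem x' hm]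
    exact hxx' _ (by change s - r ≤ τ; linarith [hs.2])
  have hB : IsMultFunctional β 0 τ' (fun s => extendPath h x' (s - r)) y A' :=
    hA'.congr H.beta_pos hX fun _ _ _ _ _ => rfl
  have hV : ∀ t ∈ Icc 0 τ', forcedPath b (η 0) (frozenForcing h α σ y x A' τ') x' t =
      unreflected h α σ b η y x' A' t := by
    intro t ht
    rw [unreflected, forcedPath, frozenForcing, clampIcc_of_mem ht]
    congr 2
    ext k
    exact hnIntegral_congr H.exponents hA' hB (H.isControlled hA' k) (H.isControlled hB k) hX
      (fun _ _ _ _ _ => rfl) le_rfl ht.1 ht.2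
  refine ⟨x', A', hx'0, hB, fun s t hs hst ht _ => hleft s t hs hst.le ht,
    fun s t hs hst ht => ?_, fun t h0 ht => ?_⟩
  · rw [hright s t hs hst.le ht]
    exact H.laterTensor_congr hτ hA (hB.mono le_rfl hττ') hxx' hAA' hτ' hτT hs hst.le ht
  · rw [hx' t h0.le, hV t ⟨h0.le, ht⟩, regulator_congr fun s hs => hV s ⟨hs.1, hs.2.trans ht⟩]

lemma mono (S : SolvesUpTo h α β σ b η y ηy yy τ' x A) (hτ : τ ≤ τ') :
    SolvesUpTo h α β σ b η y ηy yy τ x A where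
  initial := S.initial
  isMultFunctional := S.isMultFunctional.mono le_rfl hτ
  eq_initial s t hs hst ht htτ := S.eq_initial s t hs hst ht (htτ.trans hτ)
  eq_later s t hs hst ht := S.eq_later s t hs hst (ht.trans hτ)
  equation t h0 ht := S.equation t h0 (ht.trans hτ)

/-- At `τ = 0` any continuous path that extends `η` will do, and the solution with zero forcing is
one. -/
lemma exists_zero (H : StepHyp r T α β γ ρ σ b η y ηy yy) (h : -r ≤ T) :
    ∃ x A, SolvesUpTo h α β σ b η y ηy yy 0 x A := by
  have hr := H.delay_pos
  have hF : ForcedHyp r T β ρ b 0 :=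
    ⟨hr, H.horizon_pos, H.beta_pos, by linarith [H.exponents.beta_lt], H.exponent_le, H.drift,
      0, le_rfl, fun s t _ _ _ => by simp⟩
  obtain ⟨x, hx, -⟩ := hF.exists_forced H.continuousOn_initial rfl
    (H.initial_nonneg 0 ⟨by linarith, le_rfl⟩)
  exact ⟨x, ηy, hx, (isMultFunctional_initial H hx).mono le_rfl hr.le, fun _ _ _ _ _ _ => rfl,
    fun s t hs hst ht => by linarith, fun t h0 ht => by linarith⟩

lemma exists_upTo (H : StepHyp r T α β γ ρ σ b η y ηy yy) (h : -r ≤ T) (n : ℕ) :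
    ∃ x A, SolvesUpTo h α β σ b η y ηy yy (min (n * r) T) x A := by
  have hr := H.delay_pos
  have hT := H.horizon_pos
  induction n with
  | zero =>
    obtain ⟨x, A, S⟩ := exists_zero H h
    exact ⟨x, A, S.mono (by simp)⟩
  | succ n ih =>
    obtain ⟨x, A, S⟩ := ih
    push_cast
    exact exists_step H (by positivity) (min_le_min_right _ (by nlinarith))
      (by rw [← min_add_add_right]; exact min_le_min (by linarith) (by linarith))
      (min_le_right _ _) S

lemma eq_upTo (H : StepHyp r T α β γ ρ σ b η y ηy yy) (S : SolvesUpTo h α β σ b η y ηy yy T x A)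
    (S' : SolvesUpTo h α β σ b η y ηy yy T x' A') (n : ℕ) :
    (∀ t : Icc (-r) T, (t : ℝ) ≤ min (n * r) T → x t = x' t) ∧
      ∀ s t, 0 ≤ s → s ≤ t → t ≤ min (n * r) T → A s t = A' s t := by
  have hr := H.delay_pos
  have hT := H.horizon_pos
  induction n with
  | zero =>
    rw [Nat.cast_zero, zero_mul, min_eq_left hT.le]
    refine ⟨fun t ht => (S.initial t ht).trans (S'.initial t ht).symm, fun s t hs hst ht => ?_⟩
    exact (S.eq_initial_of_le H hs hst (ht.trans hr.le) (ht.trans hT.le)).trans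
      (S'.eq_initial_of_le H hs hst (ht.trans hr.le) (ht.trans hT.le)).symm
  | succ n ih =>
    push_cast
    exact eq_step H (by positivity) (min_le_min_right _ (by nlinarith))
      (by rw [← min_add_add_right]; exact min_le_min (by linarith) (by linarith))
      (min_le_right _ _) (S.mono (min_le_right _ _)) (S'.mono (min_le_right _ _)) ih.1 ih.2

lemma isSolution (H : StepHyp r T α β γ ρ σ b η y ηy yy)
    (S : SolvesUpTo h α β σ b η y ηy yy T x A) : IsSolution h α β σ b η y ηy yy x := by
  refine ⟨fun t i => ?_, S.initial, A, ⟨S.isMultFunctional, S.eq_initial, fun s t hs hst ht k l => ?_⟩,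
    fun t h0 => S.equation t h0 t.2.2⟩
  · rcases le_or_gt (t : ℝ) 0 with ht | ht
    · rw [S.initial t ht]
      exact H.initial_nonneg t ⟨t.2.1, ht⟩ i
    · rw [S.equation t ht t.2.2, PiLp.add_apply]
      exact add_regulator_nonneg ((H.continuousOn_unreflected H.horizon_pos.le le_rfl
        S.isMultFunctional).mono (Icc_subset_Icc_right t.2.2)) ht.le i
  · rw [S.eq_later s t hs hst ht]
    rfl

lemma of_isSolution (hx : IsSolution h α β σ b η y ηy yy x) :
    ∃ A, SolvesUpTo h α β σ b η y ηy yy T x A := by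
  obtain ⟨-, h0, A, hA, heq⟩ := hx
  exact ⟨A, h0, hA.isMultFunctional, hA.eq_initial,
    fun s t hs hst ht => by ext k l; exact hA.eq_later s t hs hst ht k l,
    fun t ht _ => heq t ht⟩

end SolvesUpTo

/-- The delay equation with reflection has exactly one solution. -/
theorem StepHyp.existsUnique_isSolution (H : StepHyp r T α β γ ρ σ b η y ηy yy) (h : -r ≤ T) :
    ∃! x, IsSolution h α β σ b η y ηy yy x := by
  obtain ⟨n, hn⟩ := exists_nat_ge (T / r)
  have hnT : min (n * r) T = T := min_eq_right ((div_le_iff₀ H.delay_pos).1 hn)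
  obtain ⟨x, A, S⟩ := SolvesUpTo.exists_upTo H h n
  rw [hnT] at S
  refine ⟨x, S.isSolution H, fun x' hx' => ?_⟩
  -- A solution carries its tensor only existentially. The induction therefore compares paths and
  -- tensors together, since each step needs both.
  obtain ⟨A', S'⟩ := SolvesUpTo.of_isSolution hx'
  have := (SolvesUpTo.eq_upTo H S' S n).1
  rw [hnT] at this
  exact ContinuousMap.ext fun t => this t t.2.2

end

end DelayReflection

end

theorem theorem2p1 {d m : ℕ} (β γ α r T : ℝ) (ρ : ENNReal)
    (hβ : β ∈ Set.Ioo (1 / 3 : ℝ) (1 / 2)) (hr : 0 < r) (hT : 0 < T)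
    (hγ : 1 / β - 2 < γ) (hγ_one : γ ≤ 1)
    (hα : 1 - β < α) (hα_two : α < 2 * β) (hα_holder : α < (γ * β + 1) / 2)
    (hρ : ENNReal.ofReal (1 / (1 - β)) ≤ ρ)
    (σ : EuclideanSpace ℝ (Fin d) → Fin d → Fin m → ℝ)
    (b : ℝ → C(Set.Icc (-r) T, EuclideanSpace ℝ (Fin d)) → EuclideanSpace ℝ (Fin d))
    (η : ℝ → EuclideanSpace ℝ (Fin d)) (y : ℝ → EuclideanSpace ℝ (Fin m))
    (ηy : ℝ → ℝ → Fin d → Fin m → ℝ) (yy : ℝ → ℝ → Fin m → Fin m → ℝ)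
    (hσ : DelayReflection.DiffusionHyp γ σ)
    (hb : DelayReflection.DriftHyp r T ρ b)
    (hη : ∀ t ∈ Set.Icc (-r) 0, ∀ i, 0 ≤ η t i)
    (hηy : DelayReflection.IsMultFunctional β 0 r (fun s => η (s - r)) y ηy)
    (hyy : DelayReflection.IsMultFunctional β r T (fun s => y (s - r)) y yy) :
    ∃! x : C(Set.Icc (-r) T, EuclideanSpace ℝ (Fin d)),
      DelayReflection.IsSolution (by linarith : -r ≤ T) α β σ b η y ηy yy x := by
  have hβ0 : 0 < β := by linarith [hβ.1]
  have hγ0 : 0 < γ := by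
    refine lt_trans ?_ hγ
    rw [sub_pos, lt_div_iff₀ hβ0]
    linarith [hβ.2]
  exact DelayReflection.StepHyp.existsUnique_isSolution
    ⟨DelayReflection.exponents_of_hyp hβ hγ_one hα hα_two hα_holder, hγ0, hr, hT, hρ, hσ, hb, hη,
      hηy, hyy⟩ _
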